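/- **Setting.** Let $m\ge 2$ and let $p_0,\dots,p_{m-1}$ be points of the plane, given in increasing order of their (distinct) $x$-coordinates. The vertices of their upper hull are the extreme points of their convex hull that have no point of the convex hull strictly above them. An upper hull is represented in memory by the sorted array of its vertices together with a label for every point (on the hull or not). An algorithm is a fixed program, the same for all $m$, for a synchronous CREW PRAM with words of $O(\log m)$ bits. It accesses the points only through Boolean primitives: the orientation test of three points and the comparison of the $x$- or $y$-coordinates of two points. Each evaluation of a primitive returns the wrong answer with probability at most $p$, independently of all others, where $p<1/2$ is known; all other computation is exact. *Span* is the number of parallel steps, and *work* is the total number of operations performed by all processors. A *noisy operation* is one invocation of a noise-tolerant routine, carried out by means of noisy primitives, of one of the following kinds: deciding one primitive; locating a point, by its $x$-coordinate, in a chain of points sorted by $x$-coordinate; a max-find (a topmost point of a list of points, or a segment of largest or of smallest slope in a list of segments); finding the upper tangent of two chains separated by a vertical line. Primitives are used only inside such routines, and of what a routine computes only its result is kept. The span and the work of the routines are part of the span and the work of the algorithm, down to the single primitives. **Lemma.** For all $p\in[0,1/2)$ and $c\ge1$ there are two algorithms, and constants that depend only on $p$ and $c$, such that for all $m\ge2$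 and all points as above the following hold. 1. (Failure sweep.) Given any purported upper hull, that is, any subset $H$ of the $m$ points in the above representation, the first algorithm decides whether $H$ is exactly the set of vertices of the upper hull, in $O(\log(m^2))$ span and $O(m\log(m^2))$ work, using $O(m)$ noisy operations. 2. (Brute-force recomputation.) The second algorithm computes the upper hull of the $m$ points in $O(\log(m^2))$ span and $O(m^{3/2}\log(m^2))$ work, using $O(m)$ noisy operations. Each of the two holds with high probability in $m^2$: with probability at least $1-(m^2)^{-c}$ the output is correct, all the stated bounds hold, and all the noisy operations return correct results. -/

import Mathlib

open MeasureTheory ProbabilityTheory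

namespace NoisyHull

noncomputable section

/-! ### Geometry -/

/-- The (indices of the) vertices of the upper hull of a finite family of points of the plane:
extreme points of the convex hull with no point of the convex hull strictly above them. -/
def upperHull {m : ℕ} (P : Fin m → ℝ × ℝ) : Finset (Fin m) :=
  open Classical in
  Finset.univ.filter fun i =>
    P i ∈ (convexHull ℝ (Set.range P)).extremePoints ℝ ∧
      ∀ q ∈ convexHull ℝ (Set.range P), q.1 = (P i).1 → q.2 ≤ (P i).2

/-- The point named by a machine word. Words that are not smaller than `m` name the origin. -/
def pt {m : ℕ} (P : Fin m → ℝ × ℝ) (i : ℕ) : ℝ × ℝ :=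
  if h : i < m then P ⟨i, h⟩ else (0, 0)

/-- The cross product of two vectors of the plane. -/
def cross (u v : ℝ × ℝ) : ℝ := u.1 * v.2 - u.2 * v.1

/-- The orientation determinant; it is positive iff `a, b, c` is a left turn. -/
def orient (a b c : ℝ × ℝ) : ℝ := cross (b - a) (c - a)

/-- The Boolean geometric primitives. They are the only access that an algorithm has to the
points, and every evaluation of one of them is noisy. -/
inductive Prim
  | leftTurn
  | xLess
  | yLess

/-- The true answer of a primitive; the two comparisons ignore their third argument. -/
def Prim.Holds {m : ℕ} (P : Fin m → ℝ × ℝ) : Prim → ℕ → ℕ → ℕ → Prop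
  | .leftTurn, a, b, c => 0 < orient (pt P a) (pt P b) (pt P c)
  | .xLess, a, b, _ => (pt P a).1 < (pt P b).1
  | .yLess, a, b, _ => (pt P a).2 < (pt P b).2

/-! ### Programs of the CREW PRAM -/

/-- The shared memory consists of arrays of words; `mem a k` is cell `k` of array `a`. -/
abbrev Memory := ℕ → ℕ → ℕ

/-- The arithmetic operations on words. -/
inductive BinOp
  | add | sub | mul | div | mod | lt | eq

/-- Subtraction is truncated at zero, and the comparisons return `1` or `0`. -/
def BinOp.eval : BinOp → ℕ → ℕ → ℕ
  | .add, a, b => a + b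
  | .sub, a, b => a - b
  | .mul, a, b => a * b
  | .div, a, b => a / b
  | .mod, a, b => a % b
  | .lt, a, b => if a < b then 1 else 0
  | .eq, a, b => if a = b then 1 else 0

/-- Expressions that a single processor evaluates: constants, its own number, a cell of the shared
memory, arithmetic, a case distinction. -/
inductive Expr
  | const (k : ℕ)
  | pid
  | read (arr : ℕ) (idx : Expr)
  | bin (o : BinOp) (e₁ e₂ : Expr)
  | ite (b e₁ e₂ : Expr)

/-- The value of an expression for processor `i`. -/
def Expr.eval (mem : Memory) (i : ℕ) : Expr → ℕ
  | .const k => k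
  | .pid => i
  | .read arr e => mem arr (e.eval mem i)
  | .bin o e₁ e₂ => o.eval (e₁.eval mem i) (e₂.eval mem i)
  | .ite b e₁ e₂ => if b.eval mem i ≠ 0 then e₁.eval mem i else e₂.eval mem i

/-- What a processor writes in a parallel step: a computed word, or the noisy answer (`0` or `1`)
to one geometric primitive. -/
inductive Rhs
  | calc (e : Expr)
  | query (τ : Prim) (a b c : Expr)

/-- The criterion of a max-find: the topmost point, the segment of largest slope, the segment of
smallest slope. -/
inductive Key
  | topmost
  | steepest
  | shallowest

/-- The kinds of noise-tolerant operations, with the expressions by which the `j`-th of several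
simultaneous invocations finds its arguments (evaluated with `j` as processor number):
one primitive; the search for a point in a chain stored in consecutive cells; a maximum among
items stored in consecutive cells of two arrays; the upper tangent of two stored chains. -/
inductive OpExpr
  | decide (τ : Prim) (a b c : Expr)
  | locate (arr : ℕ) (start len q : Expr)
  | maxFind (key : Key) (arr₁ arr₂ : ℕ) (start len : Expr)
  | tangent (arr : ℕ) (start₁ len₁ start₂ len₂ : Expr)

/-- Programs. All processors run the same program in lockstep.
* `step n g arr idx rhs`: a single parallel step of processors `0, …, n - 1`; those with `g ≠ 0`
  write the value of `rhs` to cell `idx` of array `arr`.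
* `op n call out body`: simultaneous invocations `0, …, n - 1` of a noise-tolerant operation, which
  are carried out by `body`; invocation `j` leaves its result in cells `2 * j` and `2 * j + 1` of
  array `out`. -/
inductive Cmd
  | skip
  | step (n guard : Expr) (arr : ℕ) (idx : Expr) (rhs : Rhs)
  | seq (c₁ c₂ : Cmd)
  | ite (b : Expr) (c₁ c₂ : Cmd)
  | loop (b : Expr) (c : Cmd)
  | op (n : Expr) (call : OpExpr) (out : ℕ) (body : Cmd)

/-! ### Noise-tolerant operations and their correct results -/

/-- An invocation of a noise-tolerant operation, with the values of its arguments. -/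
inductive OpInst
  | decide (τ : Prim) (a b c : ℕ)
  | locate (chain : List ℕ) (q : ℕ)
  | maxFind (key : Key) (items : List (ℕ × ℕ))
  | tangent (L R : List ℕ)

/-- The content of `len` consecutive cells. -/
def segment (mem : Memory) (arr start len : ℕ) : List ℕ :=
  (List.range len).map fun k => mem arr (start + k)

/-- The arguments of invocation `j`. -/
def OpExpr.inst (mem : Memory) (j : ℕ) : OpExpr → OpInst
  | .decide τ a b c => .decide τ (a.eval mem j) (b.eval mem j) (c.eval mem j)
  | .locate arr start len q =>
      .locate (segment mem arr (start.eval mem j) (len.eval mem j)) (q.eval mem j)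
  | .maxFind key arr₁ arr₂ start len =>
      .maxFind key ((segment mem arr₁ (start.eval mem j) (len.eval mem j)).zip
        (segment mem arr₂ (start.eval mem j) (len.eval mem j)))
  | .tangent arr start₁ len₁ start₂ len₂ =>
      .tangent (segment mem arr (start₁.eval mem j) (len₁.eval mem j))
        (segment mem arr (start₂.eval mem j) (len₂.eval mem j))

/-- The form of the items of a max-find: a point is given as a pair `(a, a)`, a segment by the
names of its left and its right endpoint. -/
def Key.Admits : Key → ℕ × ℕ → Prop
  | .topmost, e => e.1 = e.2
  | .steepest, e => e.1 < e.2
  | .shallowest, e => e.1 < e.2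

/-- `key.Le P e f`: item `f` is at least as good as item `e`. For two vectors that point to the
right, the second has the larger slope iff the cross product is positive. -/
def Key.Le {m : ℕ} (P : Fin m → ℝ × ℝ) : Key → ℕ × ℕ → ℕ × ℕ → Prop
  | .topmost, e, f => (pt P e.1).2 ≤ (pt P f.1).2
  | .steepest, e, f => 0 ≤ cross (pt P e.2 - pt P e.1) (pt P f.2 - pt P f.1)
  | .shallowest, e, f => 0 ≤ cross (pt P f.2 - pt P f.1) (pt P e.2 - pt P e.1)

/-- `r` is a correct result of the invocation. Points are named in the order of their
`x`-coordinates, so a chain is an increasing list of names.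
* A primitive: its true answer.
* A search: the number `r.1` of chain points to the left of `q`, so that the edge of the chain
  directly above or below `q` joins the chain points number `r.1 - 1` and `r.1`.
* A max-find: the position of a best item.
* An upper tangent of a chain `L` and a chain `R` to the right of it: the positions of two points
  such that no point of `L` and `R` is above the line through them.
The searches among nothing return `(0, 0)`. -/
def OpInst.Correct {m : ℕ} (P : Fin m → ℝ × ℝ) : OpInst → ℕ × ℕ → Prop
  | .decide τ a b c, r => (r.1 = 1 ∧ τ.Holds P a b c ∨ r.1 = 0 ∧ ¬ τ.Holds P a b c) ∧ r.2 = 0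
  | .locate chain q, r =>
      chain.Pairwise (· < ·) ∧ r.1 ≤ chain.length ∧ r.2 = 0 ∧
        (∀ a ∈ chain.take r.1, (pt P a).1 ≤ (pt P q).1) ∧
        (∀ a ∈ chain.drop r.1, (pt P q).1 ≤ (pt P a).1)
  | .maxFind key items, r =>
      items.Nodup ∧ (∀ e ∈ items, key.Admits e) ∧ r.2 = 0 ∧
        (items = [] ∧ r.1 = 0 ∨ ∃ f, items[r.1]? = some f ∧ ∀ e ∈ items, key.Le P e f)
  | .tangent L R, r =>
      (L ++ R).Pairwise (· < ·) ∧
        ((L = [] ∨ R = []) ∧ r = (0, 0) ∨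
          ∃ u v, L[r.1]? = some u ∧ R[r.2]? = some v ∧
            ∀ w ∈ L ++ R, orient (pt P u) (pt P v) (pt P w) ≤ 0)

/-! ### Execution -/

/-- A state of the machine: the memory, the number of parallel steps and the number of operations
so far, and the invocations of noise-tolerant operations so far, with their results. -/
structure State where
  mem : Memory
  span : ℕ
  work : ℕ
  log : List (OpInst × (ℕ × ℕ))

/-- Account for one parallel step of `n` processors. -/
def State.tick (s : State) (n : ℕ) : State :=
  { s with span := s.span + 1, work := s.work + n }

/-- The word that processor `i` writes in the parallel step number `t`. The answer to a primitive
is flipped iff `flip t i` is true. -/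
def Rhs.eval {m : ℕ} (P : Fin m → ℝ × ℝ) (flip : ℕ → ℕ → Bool) (mem : Memory) (t i : ℕ) :
    Rhs → ℕ
  | .calc e => e.eval mem i
  | .query τ a b c =>
      open Classical in
      if xor (decide (τ.Holds P (a.eval mem i) (b.eval mem i) (c.eval mem i))) (flip t i)
      then 1 else 0

/-- Only a query uses noisy primitives. -/
def Rhs.IsQuery : Rhs → Prop
  | .calc _ => False
  | .query _ _ _ _ => True

/-- The memory after a simultaneous write of `val i` to cell `idx i` of array `arr` by all
processors `i < n` with `act i`. -/
def writeAll (mem : Memory) (arr n : ℕ) (act : ℕ → Bool) (idx val : ℕ → ℕ) : Memory :=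
  fun a k =>
    if a = arr then
      match (List.range n).find? fun i => act i && idx i == k with
      | some i => val i
      | none => mem a k
    else mem a k

/-- The memory after `n` simultaneous invocations with result array `out`: the results are copied
from the memory `mem'` that the operation leaves, everything else is as it was before. -/
def returnResults (mem mem' : Memory) (out n : ℕ) : Memory :=
  fun a k => if a = out ∧ k < 2 * n then mem' a k else mem a k

/-- `Exec P flip B inOp c s s'`: on points `P`, with noise `flip` and words smaller than `B`,
program `c` runs from state `s` to state `s'`. The machine gets stuck if two processors write to the
same cell in the same step, and if a word overflows. Noisy primitives are used inside the
noise-tolerant operations only (`inOp = true`), and those are not nested. -/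
inductive Exec {m : ℕ} (P : Fin m → ℝ × ℝ) (flip : ℕ → ℕ → Bool) (B : ℕ) :
    Bool → Cmd → State → State → Prop
  | skip (inOp : Bool) (s : State) : Exec P flip B inOp .skip s s
  | step (inOp : Bool) (s : State) (n guard : Expr) (arr : ℕ) (idx : Expr) (rhs : Rhs)
      (hquery : rhs.IsQuery → inOp = true)
      (hexcl : ∀ i < n.eval s.mem 0, ∀ j < n.eval s.mem 0,
        guard.eval s.mem i ≠ 0 → guard.eval s.mem j ≠ 0 →
          idx.eval s.mem i = idx.eval s.mem j → i = j)
      (hword : ∀ i < n.eval s.mem 0, guard.eval s.mem i ≠ 0 →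
        rhs.eval P flip s.mem s.span i < B) :
      Exec P flip B inOp (.step n guard arr idx rhs) s
        { s.tick (n.eval s.mem 0) with
          mem := writeAll s.mem arr (n.eval s.mem 0) (fun i => guard.eval s.mem i != 0)
            (fun i => idx.eval s.mem i) (fun i => rhs.eval P flip s.mem s.span i) }
  | seq (inOp : Bool) (c₁ c₂ : Cmd) (s₁ s₂ s₃ : State)
      (h₁ : Exec P flip B inOp c₁ s₁ s₂) (h₂ : Exec P flip B inOp c₂ s₂ s₃) :
      Exec P flip B inOp (.seq c₁ c₂) s₁ s₃
  | iteTrue (inOp : Bool) (b : Expr) (c₁ c₂ : Cmd) (s s' : State)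
      (hb : b.eval s.mem 0 ≠ 0) (h : Exec P flip B inOp c₁ (s.tick 1) s') :
      Exec P flip B inOp (.ite b c₁ c₂) s s'
  | iteFalse (inOp : Bool) (b : Expr) (c₁ c₂ : Cmd) (s s' : State)
      (hb : b.eval s.mem 0 = 0) (h : Exec P flip B inOp c₂ (s.tick 1) s') :
      Exec P flip B inOp (.ite b c₁ c₂) s s'
  | loopDone (inOp : Bool) (b : Expr) (c : Cmd) (s : State) (hb : b.eval s.mem 0 = 0) :
      Exec P flip B inOp (.loop b c) s (s.tick 1)
  | loopNext (inOp : Bool) (b : Expr) (c : Cmd) (s s' s'' : State) (hb : b.eval s.mem 0 ≠ 0)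
      (h : Exec P flip B inOp c (s.tick 1) s')
      (hloop : Exec P flip B inOp (.loop b c) s' s'') :
      Exec P flip B inOp (.loop b c) s s''
  | op (n : Expr) (call : OpExpr) (out : ℕ) (body : Cmd) (s s' : State)
      (h : Exec P flip B true body (s.tick (n.eval s.mem 0)) s') :
      Exec P flip B false (.op n call out body) s
        { s' with
          mem := returnResults s.mem s'.mem out (n.eval s.mem 0)
          log := s.log ++ (List.range (n.eval s.mem 0)).map fun j =>
            (call.inst s.mem j, (s'.mem out (2 * j), s'.mem out (2 * j + 1))) }

/-! ### Input, output, noise -/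

/-- The representation of an upper hull with vertex set `H` in memory: the number of its vertices
in cell 1 of array 0, the vertices sorted by `x`-coordinate in array 1 (an implicit balanced search
tree), the label of every point (on the hull or not) in array 2. -/
def StoresHull {m : ℕ} (H : Finset (Fin m)) (mem : Memory) : Prop :=
  mem 0 1 = H.card ∧
    (∀ k : Fin H.card, mem 1 k = H.orderEmbOfFin rfl k) ∧
    (∀ i : Fin m, mem 2 i = if i ∈ H then 1 else 0)

/-- The input memory: the number `m` of points in cell 0 of array 0 and the representation of a
(purported) upper hull. All other cells are zero. -/
def inputMem {m : ℕ} (H : Finset (Fin m)) : Memory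
  | 0, 0 => m
  | 0, 1 => H.card
  | 1, k => if h : k < H.card then H.orderEmbOfFin rfl ⟨k, h⟩ else 0
  | 2, i => if h : i < m then (if (⟨i, h⟩ : Fin m) ∈ H then 1 else 0) else 0
  | _, _ => 0

/-- The start of a computation. -/
def start (mem : Memory) : State := ⟨mem, 0, 0, []⟩

/-- `flip t i ω` says that a primitive evaluated by processor `i` in step `t` errs. The errors are
independent, and each has probability at most `p`. -/
structure IsNoise {Ω : Type*} [MeasurableSpace Ω] (μ : Measure Ω) (p : ℝ)
    (flip : ℕ → ℕ → Ω → Bool) : Prop where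
  measurable : ∀ t i, Measurable (flip t i)
  indep : iIndepFun (fun (k : ℕ × ℕ) => flip k.1 k.2) μ
  error_le : ∀ t i, μ {ω | flip t i ω = true} ≤ ENNReal.ofReal p

/-- With noise `flip` and words smaller than `B`, the program `c` stops on input `mem` in a state
with property `post`, within `T` parallel steps and `W` operations in total, and it has used at most
`N` noise-tolerant operations, all of which have returned correct results. -/
def Succeeds {m : ℕ} (P : Fin m → ℝ × ℝ) (flip : ℕ → ℕ → Bool) (B : ℕ) (c : Cmd) (mem : Memory)
    (T W N : ℝ) (post : Memory → Prop) : Prop :=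
  ∃ s : State, Exec P flip B false c (start mem) s ∧
    (s.span : ℝ) ≤ T ∧ (s.work : ℝ) ≤ W ∧ (s.log.length : ℝ) ≤ N ∧
    (∀ e ∈ s.log, e.1.Correct P e.2) ∧ post s.mem

end

end NoisyHull

namespace NoisyHull

noncomputable section

/-! ### Machines with a time budget, and total-correctness triples -/

/-! All noise is confined to one event. A primitive is decided by the majority of `R = K * a`
evaluations, where `a = ⌈log₁₆ m⌉`. `Machine.Reliable` says that for every start `t ≤ T` and every
processor below `N`, fewer than half of the evaluations in the `R` steps `t, t + 4, …` err. The
event concerns the flips alone, so it does not matter that later queries depend on earlier answers.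
By Hoeffding's inequality and a union bound over the `(T + 1) * N` pairs (`IsNoise.majority_error`,
`IsNoise.unreliable_le`), it fails with probability at most `(m²)^(-c)` once `K` is large in terms
of `p` and `c` (`failure_probability_le`). On the event every vote is right, and both programs are
analysed deterministically, with costs in units of `R` steps and `N * R` operations. The time budget
`T` keeps all votes within the range of the event.

The geometry reduces to comparisons of slopes: a hull vertex is a point strictly above all chords
(`mem_upperHull_iff`).

Failure sweep: prefix sums of the labels give every point its neighbours in `H`, and one vote per
point decides whether it is above their chord. If the outermost points are in `H`, this local test
characterises the hull (`forall_iff_aboveChords`): true vertices pass it, hence belong to `H`, while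
among the surplus elements between two consecutive vertices the lowest relative to their chord
fails.

Brute force: the tangent from a point to the points on its right yields a pointer to its successor
on the hull of the rest, and the hull vertices are the points that no pointer jumps over
(`aboveChords_iff`). The `m` tangent operations share one body that runs on `m * q²` processors,
where `q = 2 ^ a`, so that `m ≤ q⁴` and `q² ≤ 4 √m`. Starting from single points, `q` blocks at a
time are merged, in four levels. In each level, two prefix maxima find the last block vertex before
every point (`lastVertex_spec`). Then every point searches every later block of its superblock for
the tangent point, with `q` probes per round and at most three rounds (`lt_best_iff`,
`search_round`). Finally the `q` candidates of a point are compared pairwise (`winner_spec`). This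
takes a bounded number of votes and doubling folds, hence `O(R)` steps and `O(m q² R)` operations.
-/

/-- The data that stay fixed during a run: the points, the noise, the word bound, the number of
processors, the number of votes that decide a primitive, and a bound for the number of steps. -/
structure Machine (m : ℕ) where
  P : Fin m → ℝ × ℝ
  flip : ℕ → ℕ → Bool
  B : ℕ
  N : ℕ
  R : ℕ
  T : ℕ

/-- From memory `M`, the program `c` runs within `T` steps and `W` operations and without
invocations of noise-tolerant operations to a memory with property `Q`, provided that `T` steps are
left in the time budget. -/
def Runs {m : ℕ} (X : Machine m) (inOp : Bool) (c : Cmd) (M : Memory) (T W : ℕ)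
    (Q : Memory → Prop) : Prop :=
  ∀ s : State, s.mem = M → s.span + T ≤ X.T →
    ∃ s', Exec X.P X.flip X.B inOp c s s' ∧ s'.span ≤ s.span + T ∧ s'.work ≤ s.work + W ∧
      s'.log = s.log ∧ Q s'.mem

/-- A run whose cost is measured in units of `R` steps and `N * R` operations. -/
def Uses {m : ℕ} (X : Machine m) (inOp : Bool) (c : Cmd) (M : Memory) (u : ℕ)
    (Q : Memory → Prop) : Prop :=
  Runs X inOp c M (u * X.R) (u * (X.N * X.R)) Q

/-! ### Composition of runs: sequences and loops. -/

section Rules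

variable {m : ℕ} {X : Machine m} {inOp : Bool}

theorem Runs.mono {c : Cmd} {M : Memory} {T W T' W' : ℕ} {Q Q' : Memory → Prop}
    (h : Runs X inOp c M T W Q) (hT : T ≤ T') (hW : W ≤ W') (hQ : ∀ M', Q M' → Q' M') :
    Runs X inOp c M T' W' Q' := by
  intro s hs hb
  obtain ⟨s', h1, h2, h3, h4, h5⟩ := h s hs (by omega)
  exact ⟨s', h1, by omega, by omega, h4, hQ _ h5⟩

theorem Runs.seq {c₁ c₂ : Cmd} {M : Memory} {T₁ W₁ T₂ W₂ : ℕ} {Q₁ Q : Memory → Prop}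
    (h₁ : Runs X inOp c₁ M T₁ W₁ Q₁) (h₂ : ∀ M', Q₁ M' → Runs X inOp c₂ M' T₂ W₂ Q) :
    Runs X inOp (.seq c₁ c₂) M (T₁ + T₂) (W₁ + W₂) Q := by
  intro s hs hb
  obtain ⟨s', a1, a2, a3, a4, a5⟩ := h₁ s hs (by omega)
  obtain ⟨s'', b1, b2, b3, b4, b5⟩ := h₂ _ a5 s' rfl (by omega)
  exact ⟨s'', .seq _ _ _ _ _ _ a1 b1, by omega, by omega, b4.trans a4, b5⟩

theorem Uses.mono {c : Cmd} {M : Memory} {u u' : ℕ} {Q Q' : Memory → Prop}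
    (h : Uses X inOp c M u Q) (hu : u ≤ u') (hQ : ∀ M', Q M' → Q' M') :
    Uses X inOp c M u' Q' :=
  Runs.mono h (Nat.mul_le_mul_right _ hu) (Nat.mul_le_mul_right _ hu) hQ

theorem Uses.seq {c₁ c₂ : Cmd} {M : Memory} {u₁ u₂ : ℕ} {Q₁ Q : Memory → Prop}
    (h₁ : Uses X inOp c₁ M u₁ Q₁) (h₂ : ∀ M', Q₁ M' → Uses X inOp c₂ M' u₂ Q) :
    Uses X inOp (.seq c₁ c₂) M (u₁ + u₂) Q :=
  Runs.mono (Runs.seq h₁ h₂) (by rw [add_mul]) (by rw [add_mul]) fun _ h => h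

/-- Induction on the number of rounds still to come, since `loopNext` peels off the first one. The
final state is `s'.tick 1` because the failing test costs a step as well. -/
theorem exec_loop {b : Expr} {c : Cmd} (I : ℕ → State → Prop) (n : ℕ)
    (hstep : ∀ k < n, ∀ s, I k s → b.eval s.mem 0 ≠ 0 ∧
      ∃ s', Exec X.P X.flip X.B inOp c (s.tick 1) s' ∧ I (k + 1) s')
    (hend : ∀ s, I n s → b.eval s.mem 0 = 0) (s : State) (hs : I 0 s) :
    ∃ s', Exec X.P X.flip X.B inOp (.loop b c) s (s'.tick 1) ∧ I n s' := by
  have key : ∀ j ≤ n, ∀ s, I (n - j) s →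
      ∃ s', Exec X.P X.flip X.B inOp (.loop b c) s (s'.tick 1) ∧ I n s' := by
    intro j
    induction j with
    | zero => exact fun _ s h => ⟨s, .loopDone _ _ _ _ (hend s h), h⟩
    | succ j ih =>
      intro hj s h
      obtain ⟨hb, s', he, hI⟩ := hstep (n - (j + 1)) (by omega) s h
      rw [show n - (j + 1) + 1 = n - j by omega] at hI
      obtain ⟨s'', he', hI'⟩ := ih (by omega) s' hI
      exact ⟨s'', .loopNext _ _ _ _ _ _ hb he he', hI'⟩
  exact key n le_rfl s (by simpa using hs)

theorem Runs.loop {b : Expr} {c : Cmd} {M : Memory} {T W : ℕ} (I : ℕ → Memory → Prop) (n : ℕ)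
    (h0 : I 0 M)
    (hstep : ∀ k < n, ∀ M', I k M' → b.eval M' 0 ≠ 0 ∧ Runs X inOp c M' T W (I (k + 1)))
    (hend : ∀ M', I n M' → b.eval M' 0 = 0) :
    Runs X inOp (.loop b c) M (n * (T + 1) + 1) (n * (W + 1) + 1) (I n) := by
  intro s hs hb
  obtain ⟨s', h1, -, h2, h3, h4⟩ := exec_loop (X := X) (inOp := inOp) (b := b) (c := c)
    (fun k s' => k ≤ n ∧ s'.span ≤ s.span + k * (T + 1) ∧ s'.work ≤ s.work + k * (W + 1) ∧
      s'.log = s.log ∧ I k s'.mem) n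
    (by
      rintro k hk s' ⟨-, h2, h3, h4, h5⟩
      obtain ⟨hb', hr⟩ := hstep k hk _ h5
      have hkn : (k + 1) * (T + 1) ≤ n * (T + 1) := Nat.mul_le_mul_right _ hk
      have e1 : (k + 1) * (T + 1) = k * (T + 1) + (T + 1) := by ring
      have e2 : (k + 1) * (W + 1) = k * (W + 1) + (W + 1) := by ring
      obtain ⟨s'', a1, a2, a3, a4, a5⟩ := hr (s'.tick 1) rfl (by simp only [State.tick]; omega)
      simp only [State.tick] at a2 a3 a4
      exact ⟨hb', s'', a1, hk, by omega, by omega, a4.trans h4, a5⟩)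
    (fun s' h => hend _ h.2.2.2.2) s (by simp [hs, h0])
  exact ⟨_, h1, by simp only [State.tick]; omega, by simp only [State.tick]; omega, h4.1, h4.2⟩

/-- Each test costs one step and one operation and is charged as a whole unit, which is enough as
`R` and `N` are positive. -/
theorem Uses.loop {b : Expr} {c : Cmd} {M : Memory} {u : ℕ} (hN : 0 < X.N) (hR : 0 < X.R)
    (I : ℕ → Memory → Prop) (n : ℕ) (h0 : I 0 M)
    (hstep : ∀ k < n, ∀ M', I k M' → b.eval M' 0 ≠ 0 ∧ Uses X inOp c M' u (I (k + 1)))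
    (hend : ∀ M', I n M' → b.eval M' 0 = 0) :
    Uses X inOp (.loop b c) M (n * (u + 1) + 1) (I n) := by
  have h1 : 0 < X.N * X.R := Nat.mul_pos hN hR
  refine Runs.mono (Runs.loop I n h0 hstep hend) ?_ ?_ fun _ h => h
  · nlinarith [Nat.zero_le n, mul_le_mul (le_refl n) hR (by simp) (by simp)]
  · nlinarith [Nat.zero_le n, mul_le_mul (le_refl n) h1 (by simp) (by simp)]

end Rules

/-! ### Parallel assignments -/

theorem writeAll_of_ne {M : Memory} {arr n : ℕ} {act : ℕ → Bool} {idx val : ℕ → ℕ} {a : ℕ}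
    (h : a ≠ arr) : writeAll M arr n act idx val a = M a := by
  funext k; simp [writeAll, h]

theorem writeAll_eq_of_forall {M : Memory} {arr n : ℕ} {act : ℕ → Bool} {idx val : ℕ → ℕ} {k : ℕ}
    (h : ∀ i < n, act i = true → idx i ≠ k) : writeAll M arr n act idx val arr k = M arr k := by
  have : (List.range n).find? (fun i => act i && idx i == k) = none := by
    rw [List.find?_eq_none]
    intro i hi
    have := h i (List.mem_range.1 hi)
    simpa using this
  simp [writeAll, this]

/-- Exclusive writing leaves a single matching processor, so the first one found is `i` itself. -/
theorem writeAll_eq_of_active {M : Memory} {arr n : ℕ} {act : ℕ → Bool} {idx val : ℕ → ℕ} {i : ℕ}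
    (hex : ∀ i < n, ∀ j < n, act i = true → act j = true → idx i = idx j → i = j)
    (hi : i < n) (ha : act i = true) : writeAll M arr n act idx val arr (idx i) = val i := by
  cases hf : (List.range n).find? (fun j => act j && idx j == idx i) with
  | none =>
    rw [List.find?_eq_none] at hf
    have := hf i (List.mem_range.2 hi)
    simp [ha] at this
  | some j =>
    have h1 := List.find?_some hf
    have h2 := List.mem_range.1 (List.mem_of_find?_eq_some hf)
    simp only [Bool.and_eq_true, beq_iff_eq] at h1
    have := hex j h2 i hi h1.1 ha h1.2
    subst this
    simp [writeAll, hf]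

/-- The memory after processors `0, …, n - 1` have filled the first `n` cells of an array. -/
def fill (M : Memory) (arr n : ℕ) (f : ℕ → ℕ) : Memory :=
  fun a k => if a = arr ∧ k < n then f k else M a k

theorem fill_ne {M : Memory} {arr n : ℕ} {f : ℕ → ℕ} {a : ℕ} (h : a ≠ arr) :
    fill M arr n f a = M a := by
  funext k; simp [fill, h]

theorem fill_lt {M : Memory} {arr n : ℕ} {f : ℕ → ℕ} {k : ℕ} (h : k < n) :
    fill M arr n f arr k = f k := by
  simp [fill, h]

theorem writeAll_pid (M : Memory) (arr n : ℕ) (f : ℕ → ℕ) :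
    writeAll M arr n (fun _ => true) (fun i => i) f = fill M arr n f := by
  funext a k
  by_cases ha : a = arr
  · subst ha
    by_cases hk : k < n
    · rw [fill_lt hk]
      exact writeAll_eq_of_active (act := fun _ => true) (idx := fun i => i) (by simp) hk rfl
    · rw [writeAll_eq_of_forall (by intros; omega)]
      simp [fill, hk]
  · rw [writeAll_of_ne ha, fill_ne ha]

/-- Processors `0, …, n - 1` fill the first `n` cells of an array. -/
def par (n : Expr) (arr : ℕ) (e : Expr) : Cmd := .step n (.const 1) arr .pid (.calc e)

section ParRules

variable {m : ℕ} {X : Machine m} {inOp : Bool}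

theorem exec_par (n : Expr) (arr : ℕ) (e : Expr) (s : State)
    (hw : ∀ i < n.eval s.mem 0, e.eval s.mem i < X.B) :
    Exec X.P X.flip X.B inOp (par n arr e) s
      { s.tick (n.eval s.mem 0) with
        mem := fill s.mem arr (n.eval s.mem 0) fun i => e.eval s.mem i } := by
  have h := Exec.step (P := X.P) (flip := X.flip) (B := X.B) inOp s n (.const 1) arr .pid (.calc e)
    (fun h => h.elim) (fun i _ j _ _ _ h => h) (fun i hi _ => hw i hi)
  rw [← writeAll_pid]
  exact h

theorem runs_par (n : Expr) (arr : ℕ) (e : Expr) {M : Memory}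
    (hw : ∀ i < n.eval M 0, e.eval M i < X.B) :
    Runs X inOp (par n arr e) M 1 (n.eval M 0)
      (· = fill M arr (n.eval M 0) fun i => e.eval M i) := by
  rintro s rfl -
  exact ⟨_, exec_par n arr e s hw, le_rfl, le_rfl, rfl, rfl⟩

theorem uses_par {n : Expr} {arr : ℕ} {e : Expr} {M : Memory} (hR : 0 < X.R) (k : ℕ)
    (f : ℕ → ℕ) (hk : n.eval M 0 = k) (hf : ∀ i < k, e.eval M i = f i)
    (hN : k ≤ X.N) (hw : ∀ i < k, f i < X.B) :
    Uses X inOp (par n arr e) M 1 (· = fill M arr k f) := by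
  subst hk
  refine Runs.mono (runs_par n arr e fun i hi => by rw [hf i hi]; exact hw i hi) (by omega) ?_ ?_
  · nlinarith
  · rintro _ rfl
    funext a j
    by_cases h : a = arr ∧ j < n.eval M 0
    · simp [fill, h, hf j h.2]
    · simp only [fill, h, if_false]

theorem uses_scatter {n g idx e : Expr} {arr : ℕ} {M : Memory} (hR : 0 < X.R)
    (hN : n.eval M 0 ≤ X.N)
    (hex : ∀ i < n.eval M 0, ∀ j < n.eval M 0, g.eval M i ≠ 0 → g.eval M j ≠ 0 →
      idx.eval M i = idx.eval M j → i = j)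
    (hw : ∀ i < n.eval M 0, g.eval M i ≠ 0 → e.eval M i < X.B) :
    Uses X inOp (.step n g arr idx (.calc e)) M 1 fun M' =>
      (∀ a ≠ arr, M' a = M a) ∧
      (∀ i < n.eval M 0, g.eval M i ≠ 0 → M' arr (idx.eval M i) = e.eval M i) ∧
      ∀ k, (∀ i < n.eval M 0, g.eval M i ≠ 0 → idx.eval M i ≠ k) → M' arr k = M arr k := by
  rintro s rfl -
  refine ⟨_, .step inOp s n g arr idx (.calc e) (fun h => h.elim) hex hw, ?_, ?_, rfl, ?_, ?_, ?_⟩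
  · simp [State.tick]; omega
  · simp only [State.tick]; nlinarith
  · intro a ha
    exact writeAll_of_ne ha
  · intro i hi hg
    exact writeAll_eq_of_active (act := fun i => g.eval s.mem i != 0)
      (idx := fun i => idx.eval s.mem i) (fun i hi j hj a b => by
        simp only [bne_iff_ne] at a b
        exact hex i hi j hj a b) hi (by simpa using hg)
  · intro k hk
    exact writeAll_eq_of_forall fun i hi a => hk i hi (by simpa using a)

end ParRules

/-! ### The arrays of the programs, and expressions -/

/-- The array whose cell 0 is the branching number. -/
notation "aQ" => 10
/-- Its binary logarithm. -/
notation "aLog" => 11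
notation "aWidth" => 12
notation "aRound" => 13
notation "aBlock" => 14
notation "aStride" => 15
/-- The number of active processors of the subroutines. -/
notation "aSize" => 16
notation "aLimit" => 17
/-- The three points of the orientation tests. -/
notation "aFst" => 20
notation "aSnd" => 21
notation "aTrd" => 22
notation "aAnswer" => 23
notation "aVotes" => 24
notation "aAcc" => 25
notation "aNext" => 28
notation "aVertex" => 29
notation "aPos" => 30
notation "aIdent" => 31
notation "aOut" => 32
notation "aCand" => 33

instance : Add Expr := ⟨.bin .add⟩
instance : Sub Expr := ⟨.bin .sub⟩
instance : Mul Expr := ⟨.bin .mul⟩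
instance : Div Expr := ⟨.bin .div⟩
instance : Mod Expr := ⟨.bin .mod⟩

/-- A word stored in cell 0 of an array of its own. -/
def scalar (a : ℕ) : Expr := .read a (.const 0)

section Eval

variable (M : Memory) (i : ℕ) (a b c : Expr)

@[simp] theorem eval_const (k : ℕ) : (Expr.const k).eval M i = k := rfl
@[simp] theorem eval_pid : Expr.pid.eval M i = i := rfl
@[simp] theorem eval_read (r : ℕ) : (Expr.read r a).eval M i = M r (a.eval M i) := rfl
@[simp] theorem eval_scalar (r : ℕ) : (scalar r).eval M i = M r 0 := rfl
@[simp] theorem eval_add : (a + b).eval M i = a.eval M i + b.eval M i := rfl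
@[simp] theorem eval_sub : (a - b).eval M i = a.eval M i - b.eval M i := rfl
@[simp] theorem eval_mul : (a * b).eval M i = a.eval M i * b.eval M i := rfl
@[simp] theorem eval_div : (a / b).eval M i = a.eval M i / b.eval M i := rfl
@[simp] theorem eval_mod : (a % b).eval M i = a.eval M i % b.eval M i := rfl
@[simp] theorem eval_lt : (Expr.bin .lt a b).eval M i =
    if a.eval M i < b.eval M i then 1 else 0 := rfl
@[simp] theorem eval_eq : (Expr.bin .eq a b).eval M i =
    if a.eval M i = b.eval M i then 1 else 0 := rfl
@[simp] theorem eval_ite : (Expr.ite c a b).eval M i =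
    if c.eval M i ≠ 0 then a.eval M i else b.eval M i := rfl

end Eval

/-- The larger of two values. -/
def Expr.max (a b : Expr) : Expr := .ite (.bin .lt a b) b a

/-- The smaller of two values. -/
def Expr.min (a b : Expr) : Expr := .ite (.bin .lt a b) a b

@[simp] theorem eval_max (M : Memory) (i : ℕ) (a b : Expr) :
    (Expr.max a b).eval M i = Max.max (a.eval M i) (b.eval M i) := by
  simp only [Expr.max, eval_ite, eval_lt]
  split_ifs <;> omega

@[simp] theorem eval_min (M : Memory) (i : ℕ) (a b : Expr) :
    (Expr.min a b).eval M i = Min.min (a.eval M i) (b.eval M i) := by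
  simp only [Expr.min, eval_ite, eval_lt]
  split_ifs <;> omega

/-! ### Prefix folds by doubling -/

/-- Combine every cell of the accumulator with the cells before it, over windows whose width is
doubled until it reaches the limit. -/
def doubling (cmb : Expr → Expr → Expr) : Cmd :=
  .seq (par (.const 1) aWidth (.const 1)) <|
  .loop (.bin .lt (scalar aWidth) (scalar aLimit)) <|
  .seq (par (scalar aSize) aAcc (.ite (.bin .lt .pid (scalar aWidth)) (.read aAcc .pid)
    (cmb (.read aAcc .pid) (.read aAcc (.pid - scalar aWidth)))))
  (par (.const 1) aWidth (scalar aWidth + scalar aWidth))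

/-- After `k` rounds, cell `x` holds the fold over the window of width `2 ^ k` that ends at `x`.
Additivity of `F` over disjoint unions is all that is used, which covers sums and maxima alike. With
`lim = m` the final windows are whole prefixes; with `lim = q`, a power of two, those that end a row
of length `q` are exactly that row. -/
theorem uses_doubling {m : ℕ} {X : Machine m} {inOp : Bool} (cmb : Expr → Expr → Expr)
    (f : ℕ → ℕ → ℕ) (hf : ∀ M i e₁ e₂, (cmb e₁ e₂).eval M i = f (e₁.eval M i) (e₂.eval M i))
    (M : Memory) (F : Finset ℕ → ℕ) (N lim : ℕ)
    (hR : 0 < X.R) (hN0 : 0 < N) (hN : N ≤ X.N) (hMN : M aSize 0 = N) (hMl : M aLimit 0 = lim)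
    (hlim : Nat.clog 2 lim ≤ 4 * X.R) (hlB : 2 * lim < X.B) (hB1 : 1 < X.B)
    (hF1 : ∀ x < N, F {x} = M aAcc x)
    (hF : ∀ s t, Disjoint s t → F (s ∪ t) = f (F s) (F t))
    (hw : ∀ x < N, ∀ l, F (Finset.Icc l x) < X.B) :
    Uses X inOp (doubling cmb) M 20 fun M' =>
      (∀ a ∉ [aWidth, aAcc], M' a = M a) ∧
      ∀ x < N, M' aAcc x = F (Finset.Icc (x + 1 - 2 ^ Nat.clog 2 lim) x) := by
  have hNR : 0 < X.N * X.R := Nat.mul_pos (by omega) hR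
  refine Runs.mono (Runs.seq (runs_par _ _ _ (by simpa using hB1))
    (T₂ := Nat.clog 2 lim * 3 + 1) (W₂ := Nat.clog 2 lim * (X.N + 2) + 1) ?_)
    (T' := 20 * X.R) (W' := 20 * (X.N * X.R)) ?_ ?_ (fun _ h => h)
  · rintro _ rfl
    refine Runs.mono (Runs.loop (T := 2) (W := X.N + 1)
      (fun k M' => (∀ a ∉ [aWidth, aAcc], M' a = M a) ∧ M' aWidth 0 = 2 ^ k ∧
        ∀ x < N, M' aAcc x = F (Finset.Icc (x + 1 - 2 ^ k) x)) (Nat.clog 2 lim) ?_ ?_ ?_)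
      le_rfl le_rfl fun M' h => ⟨h.1, h.2.2⟩
    · refine ⟨?_, by simp [fill], ?_⟩
      · intro a ha
        simp at ha
        exact fill_ne ha.1
      · intro x hx
        simp [fill_ne, hF1 x hx]
    · rintro k hk M' ⟨hfr, hwd, hacc⟩
      have hk2 : 2 ^ k < lim := (Nat.lt_clog_iff_pow_lt (by norm_num)).1 hk
      have hS : M' aSize 0 = N := by rw [hfr _ (by simp), hMN]
      have hL : M' aLimit 0 = lim := by rw [hfr _ (by simp), hMl]
      have hval : ∀ x < N, (if x < 2 ^ k then M' aAcc x else f (M' aAcc x) (M' aAcc (x - 2 ^ k))) =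
          F (Finset.Icc (x + 1 - 2 ^ (k + 1)) x) := by
        intro x hx
        have h2 : 2 ^ (k + 1) = 2 ^ k + 2 ^ k := by ring
        split_ifs with hlt
        -- The window already reaches cell 0, and truncated subtraction makes both left ends 0.
        · rw [hacc x hx]
          congr 2
          omega
        -- The two windows of width `2 ^ k` are adjacent, hence disjoint, and form the window of
        -- double width.
        · rw [hacc x hx, hacc _ (by omega), ← hF]
          · congr 1
            ext y
            have : 0 < 2 ^ k := by positivity
            simp only [Finset.mem_union, Finset.mem_Icc]
            omega
          · rw [Finset.disjoint_left]
            intro y hy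
            simp only [Finset.mem_Icc] at hy ⊢
            omega
      refine ⟨by simp [hwd, hL, hk2], ?_⟩
      refine Runs.mono (Runs.seq (runs_par _ _ _ ?_) (T₂ := 1) (W₂ := 1) ?_) le_rfl ?_
        (fun _ h => h)
      · intro i hi
        simp only [eval_scalar, hS] at hi
        have := hval i hi
        simp [hf, hwd] at this ⊢
        rw [this]
        exact hw i hi _
      · rintro _ rfl
        refine Runs.mono (runs_par _ _ _ ?_) le_rfl (by simp) ?_
        · simp [fill_ne, hwd]
          omega
        · rintro _ rfl
          refine ⟨?_, ?_, ?_⟩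
          · intro a ha
            have ha' := ha
            simp at ha
            rw [fill_ne ha.1, fill_ne ha.2, hfr a ha']
          · simp [fill, hwd]
            ring
          · intro x hx
            rw [fill_ne (by norm_num), fill_lt (by simpa [hS] using hx)]
            have := hval x hx
            simp [hf, hwd] at this ⊢
            exact this
      · simp [hS, hN]
    · rintro M' ⟨hfr, hwd, -⟩
      have hL : M' aLimit 0 = lim := by rw [hfr _ (by simp), hMl]
      simp [hwd, hL, Nat.le_pow_clog]
  · omega
  · simp
    have : Nat.clog 2 lim * (X.N + 2) ≤ 4 * X.R * (X.N + 2) := Nat.mul_le_mul_right _ hlim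
    nlinarith [mul_le_mul (le_refl X.R) (show 1 ≤ X.N by omega) (by simp) (by simp)]

theorem uses_prefixMax {m : ℕ} {X : Machine m} {inOp : Bool} (M : Memory) (N lim : ℕ)
    (hR : 0 < X.R) (hN0 : 0 < N) (hN : N ≤ X.N) (hMN : M aSize 0 = N) (hMl : M aLimit 0 = lim)
    (hlim : Nat.clog 2 lim ≤ 4 * X.R) (hlB : 2 * lim < X.B) (hB1 : 1 < X.B)
    (hw : ∀ x < N, M aAcc x < X.B) :
    Uses X inOp (doubling .max) M 20 fun M' =>
      (∀ a ∉ [aWidth, aAcc], M' a = M a) ∧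
      ∀ x < N, M' aAcc x = (Finset.Icc (x + 1 - 2 ^ Nat.clog 2 lim) x).sup (M aAcc) := by
  refine uses_doubling .max (fun a b => max a b) (fun M i a b => eval_max M i a b) M
    (fun s => s.sup (M aAcc)) N lim hR hN0 hN hMN hMl hlim hlB hB1 (by simp) ?_ ?_
  · intro s t _
    exact Finset.sup_union
  · intro x hx l
    rw [Finset.sup_lt_iff (by simp; omega)]
    intro y hy
    simp at hy
    exact hw y (by omega)

theorem uses_prefixSum {m : ℕ} {X : Machine m} {inOp : Bool} (M : Memory) (N lim : ℕ)
    (hR : 0 < X.R) (hN0 : 0 < N) (hN : N ≤ X.N) (hMN : M aSize 0 = N) (hMl : M aLimit 0 = lim)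
    (hlim : Nat.clog 2 lim ≤ 4 * X.R) (hlB : 2 * lim < X.B) (hB1 : 1 < X.B) (hNB : N < X.B)
    (hw : ∀ x < N, M aAcc x ≤ 1) :
    Uses X inOp (doubling (· + ·)) M 20 fun M' =>
      (∀ a ∉ [aWidth, aAcc], M' a = M a) ∧
      ∀ x < N, M' aAcc x = ∑ y ∈ Finset.Icc (x + 1 - 2 ^ Nat.clog 2 lim) x, M aAcc y := by
  refine uses_doubling (· + ·) (fun a b => a + b) (fun M i a b => eval_add M i a b) M
    (fun s => ∑ y ∈ s, M aAcc y) N lim hR hN0 hN hMN hMl hlim hlB hB1 (by simp) ?_ ?_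
  · intro s t h
    exact Finset.sum_union h
  · intro x hx l
    calc ∑ y ∈ Finset.Icc l x, M aAcc y ≤ ∑ _y ∈ Finset.Icc l x, 1 := by
          refine Finset.sum_le_sum fun y hy => hw y ?_
          simp at hy
          omega
      _ < X.B := by simp; omega

/-! ### Majority votes -/

/-- In any sequence of `R` evaluations by one processor at intervals of four steps, less than half
of the answers are wrong. -/
def Machine.Reliable {m : ℕ} (X : Machine m) : Prop :=
  ∀ t ≤ X.T, ∀ i < X.N,
    2 * ((Finset.range X.R).filter fun k => X.flip (t + 4 * k) i = true).card < X.R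

/-- Evaluate all stored orientation tests once and count the positive answers. -/
def voteRound : Cmd :=
  .seq (.step (scalar aSize) (.const 1) aAnswer .pid
    (.query .leftTurn (.read aFst .pid) (.read aSnd .pid) (.read aTrd .pid))) <|
  .seq (par (scalar aSize) aVotes (.read aVotes .pid + .read aAnswer .pid))
  (par (.const 1) aRound (scalar aRound + .const 1))

/-- Decide all stored orientation tests by majority votes. -/
def vote (K : ℕ) : Cmd :=
  .seq (par (.const 1) aRound (.const 0)) <|
  .seq (par (scalar aSize) aVotes (.const 0)) <|
  .seq (.loop (.bin .lt (scalar aRound) (.const K * scalar aLog)) voteRound)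
  (par (scalar aSize) aVotes
    (.ite (.bin .lt (.const K * scalar aLog) (.const 2 * .read aVotes .pid)) (.const 1) (.const 0)))

section

variable {m : ℕ} {X : Machine m}

/-- The answer to a stored orientation test that processor `i` gets in step `t`. -/
def answer (X : Machine m) (M : Memory) (t i : ℕ) : ℕ :=
  (Rhs.query .leftTurn (.read aFst .pid) (.read aSnd .pid) (.read aTrd .pid)).eval
    X.P X.flip M t i

theorem answer_le_one (M : Memory) (t i : ℕ) : answer X M t i ≤ 1 := by
  simp only [answer, Rhs.eval]
  split_ifs <;> simp

open Classical in
theorem answer_eq (M : Memory) (t i : ℕ) :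
    answer X M t i =
      if (decide (Prim.leftTurn.Holds X.P (M aFst i) (M aSnd i) (M aTrd i))) ^^ X.flip t i
      then 1 else 0 := by
  rfl

theorem answer_congr {M M' : Memory} (h1 : M' aFst = M aFst) (h2 : M' aSnd = M aSnd)
    (h3 : M' aTrd = M aTrd) (t i : ℕ) : answer X M' t i = answer X M t i := by
  rw [answer_eq, answer_eq, h1, h2, h3]

-- With `S` the set of flipped evaluations, the number of positive answers is `R - |S|` or `|S|`,
-- according to the truth; `2 |S| < R` separates the two cases.
open Classical in
theorem majority (hX : X.Reliable) (M : Memory) (t i : ℕ) (ht : t ≤ X.T) (hi : i < X.N) :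
    (if X.R < 2 * ∑ k ∈ Finset.range X.R, answer X M (t + 4 * k) i then 1 else 0) =
      if 0 < orient (pt X.P (M aFst i)) (pt X.P (M aSnd i)) (pt X.P (M aTrd i)) then 1 else 0 := by
  have hrel := hX t ht i hi
  set S := (Finset.range X.R).filter fun k => X.flip (t + 4 * k) i = true with hS
  have hsum : ∑ k ∈ Finset.range X.R, (if X.flip (t + 4 * k) i = true then 1 else 0) = S.card := by
    rw [hS, Finset.card_filter]
  by_cases h : 0 < orient (pt X.P (M aFst i)) (pt X.P (M aSnd i)) (pt X.P (M aTrd i))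
  · have h1 : ∑ k ∈ Finset.range X.R, answer X M (t + 4 * k) i + S.card = X.R := by
      rw [← hsum, ← Finset.sum_add_distrib]
      conv_rhs => rw [← Finset.card_range X.R, Finset.card_eq_sum_ones]
      refine Finset.sum_congr rfl fun k _ => ?_
      rw [answer_eq]
      cases X.flip (t + 4 * k) i <;> simp [Prim.Holds, h]
    rw [if_pos (by omega), if_pos h]
  · have h1 : ∑ k ∈ Finset.range X.R, answer X M (t + 4 * k) i = S.card := by
      rw [← hsum]
      refine Finset.sum_congr rfl fun k _ => ?_
      rw [answer_eq]
      cases X.flip (t + 4 * k) i <;> simp [Prim.Holds, h]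
    rw [if_neg (by omega), if_neg h]

/-- A round takes three steps and its loop test a fourth, which is the spacing in
`Machine.Reliable`. The query comes first, so its answer is that of step `s.span`. -/
theorem exec_voteRound (s : State) (hB : 1 < X.B)
    (hv : ∀ x < s.mem aSize 0, s.mem aVotes x + 1 < X.B) (hk : s.mem aRound 0 + 1 < X.B) :
    ∃ s', Exec X.P X.flip X.B true voteRound s s' ∧ s'.span = s.span + 3 ∧
      s'.work = s.work + (2 * s.mem aSize 0 + 1) ∧ s'.log = s.log ∧
      (∀ a ∉ [aAnswer, aVotes, aRound], s'.mem a = s.mem a) ∧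
      s'.mem aRound 0 = s.mem aRound 0 + 1 ∧
      ∀ x < s.mem aSize 0, s'.mem aVotes x = s.mem aVotes x + answer X s.mem s.span x := by
  have h1 := Exec.step (P := X.P) (flip := X.flip) (B := X.B) true s (scalar aSize) (.const 1)
    aAnswer .pid (.query .leftTurn (.read aFst .pid) (.read aSnd .pid) (.read aTrd .pid))
    (fun _ => rfl) (fun i _ j _ _ _ h => h)
    (fun i hi _ => (answer_le_one (X := X) s.mem s.span i).trans_lt hB)
  set s₁ : State := _ with hs₁
  change Exec X.P X.flip X.B true _ s s₁ at h1
  have hm : s₁.mem = fill s.mem aAnswer (s.mem aSize 0) fun i => answer X s.mem s.span i :=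
    writeAll_pid _ _ _ _
  have hsp : s₁.span = s.span + 1 := rfl
  have hwk : s₁.work = s.work + s.mem aSize 0 := rfl
  have hlg : s₁.log = s.log := rfl
  clear_value s₁
  have hsz : s₁.mem aSize 0 = s.mem aSize 0 := by simp [hm, fill_ne]
  have h2 := exec_par (X := X) (inOp := true) (scalar aSize) aVotes
    (.read aVotes .pid + .read aAnswer .pid) s₁ (by
      intro i hi
      rw [eval_scalar, hsz] at hi
      have := answer_le_one (X := X) s.mem s.span i
      have := hv i hi
      simp [hm, fill_ne, fill_lt hi]
      omega)
  have h3 := exec_par (X := X) (inOp := true) (.const 1) aRound (scalar aRound + .const 1)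
      (s := { s₁.tick ((scalar aSize).eval s₁.mem 0) with
        mem := fill s₁.mem aVotes ((scalar aSize).eval s₁.mem 0)
          fun i => (Expr.read aVotes .pid + .read aAnswer .pid).eval s₁.mem i }) (by
      simp [hm, fill_ne]
      exact hk)
  refine ⟨_, .seq _ _ _ _ _ _ h1 (.seq _ _ _ _ _ _ h2 h3), ?_, ?_, ?_, ?_, ?_, ?_⟩
  · simp [State.tick, hsp]
  · simp [State.tick, hwk, hsz]
    ring
  · simp [State.tick, hlg]
  · intro a ha
    simp at ha
    simp [fill_ne, ha, hm]
  · simp [fill_ne, fill_lt, hm]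
  · intro x hx
    simp [fill_ne, fill_lt hx, hm]

open Classical in
theorem uses_vote (hX : X.Reliable) (K N : ℕ) (M : Memory) (hR : X.R = K * M aLog 0)
    (hR0 : 0 < X.R) (hRB : X.R + 1 < X.B) (hMN : M aSize 0 = N) (hN0 : 0 < N) (hN : N ≤ X.N) :
    Uses X true (vote K) M 20 fun M' =>
      (∀ a ∉ [aAnswer, aVotes, aRound], M' a = M a) ∧
      ∀ x < N, M' aVotes x =
        if 0 < orient (pt X.P (M aFst x)) (pt X.P (M aSnd x)) (pt X.P (M aTrd x))
        then 1 else 0 := by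
  have hloop : ∀ M₀ : Memory, (∀ a ∉ [aAnswer, aVotes, aRound], M₀ a = M a) → M₀ aRound 0 = 0 →
      (∀ x < N, M₀ aVotes x = 0) →
      Runs X true (.loop (.bin .lt (scalar aRound) (.const K * scalar aLog)) voteRound) M₀
        (X.R * 4 + 1) (X.R * (2 * N + 2) + 1) fun M' =>
          (∀ a ∉ [aAnswer, aVotes, aRound], M' a = M a) ∧
          ∃ t ≤ X.T, ∀ x < N,
            M' aVotes x = ∑ k ∈ Finset.range X.R, answer X M (t + 4 * k) x := by
    rintro M₀ hfr hr hv s rfl hb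
    -- Exact step numbers are needed here, not only bounds: the first loop test takes step `s.span`,
    -- so round `j` queries in step `s.span + 1 + 4 * j`. The budget places this start within `X.T`.
    obtain ⟨s', h1, h2, h3, h4, h5, h6, h7⟩ := exec_loop (X := X) (inOp := true)
      (b := .bin .lt (scalar aRound) (.const K * scalar aLog)) (c := voteRound)
      (fun k s' => s'.span = s.span + 4 * k ∧ s'.work = s.work + k * (2 * N + 2) ∧
        s'.log = s.log ∧ (∀ a ∉ [aAnswer, aVotes, aRound], s'.mem a = M a) ∧
        s'.mem aRound 0 = k ∧ ∀ x < N, s'.mem aVotes x =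
          ∑ j ∈ Finset.range k, answer X M (s.span + 1 + 4 * j) x) X.R
      (by
        rintro k hk s' ⟨a1, a2, a3, a4, a5, a6⟩
        have hL : s'.mem aLog 0 = M aLog 0 := by rw [a4 _ (by simp)]
        have hS : s'.mem aSize 0 = N := by rw [a4 _ (by simp), hMN]
        refine ⟨by simp [hL, a5, ← hR, hk], ?_⟩
        obtain ⟨s'', b1, b2, b3, b4, b5, b6, b7⟩ := exec_voteRound (X := X) (s'.tick 1) (by omega)
          (by
            intro x hx
            simp only [State.tick, hS] at hx ⊢
            rw [a6 x hx]
            have : ∑ j ∈ Finset.range k, answer X M (s.span + 1 + 4 * j) x ≤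
                ∑ j ∈ Finset.range k, 1 := Finset.sum_le_sum fun j _ => answer_le_one _ _ _
            simp at this
            omega)
          (by simp only [State.tick, a5]; omega)
        simp only [State.tick, hS] at b2 b3 b4 b5 b6 b7
        refine ⟨s'', b1, by omega, ?_, b4.trans a3, ?_, by omega, ?_⟩
        · rw [b3, a2]; ring
        · intro a ha
          rw [b5 a ha, a4 a ha]
        · intro x hx
          rw [b7 x hx, a6 x hx, Finset.sum_range_succ]
          congr 1
          rw [answer_congr (a4 _ (by simp)) (a4 _ (by simp)) (a4 _ (by simp)), a1]
          congr 1
          ring)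
      (by
        rintro s' ⟨a1, a2, a3, a4, a5, a6⟩
        have hL : s'.mem aLog 0 = M aLog 0 := by rw [a4 _ (by simp)]
        simp [hL, a5, ← hR])
      s ⟨by simp, by simp, rfl, hfr, hr, by simpa using hv⟩
    refine ⟨_, h1, ?_, ?_, h4, h5, s.span + 1, by omega, h7⟩
    · simp only [State.tick]; omega
    · simp only [State.tick]; omega
  have hB2 : 1 < X.B := by omega
  refine Runs.mono (Runs.seq (runs_par _ _ _ (by simp; omega)) (T₂ := X.R * 4 + 3)
    (W₂ := X.R * (2 * N + 2) + 1 + 2 * N) ?_) ?_ ?_ fun _ h => h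
  · rintro _ rfl
    refine Runs.mono (Runs.seq (runs_par _ _ _ (by simp; omega)) (T₂ := X.R * 4 + 2)
      (W₂ := X.R * (2 * N + 2) + 1 + N) ?_) (by omega) ?_ fun _ h => h
    · rintro _ rfl
      refine Runs.mono (Runs.seq (hloop _ ?_ ?_ ?_) (T₂ := 1) (W₂ := N) ?_) le_rfl le_rfl
        fun _ h => h
      · intro a ha
        simp at ha
        simp [fill_ne, ha]
      · simp [fill]
      · intro x hx
        simp [fill, hMN, hx]
      · rintro M' ⟨hfr, t, ht, hv⟩
        have hL : M' aLog 0 = M aLog 0 := by rw [hfr _ (by simp)]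
        have hS : M' aSize 0 = N := by rw [hfr _ (by simp), hMN]
        refine Runs.mono (runs_par _ _ _ ?_) le_rfl (by simp [hS]) ?_
        · intro i hi
          simp only [eval_ite, eval_const]
          split_ifs <;> omega
        · rintro _ rfl
          refine ⟨fun a ha => ?_, fun x hx => ?_⟩
          · have ha' := ha
            simp at ha
            rw [fill_ne ha.2.1, hfr a ha']
          · rw [fill_lt (by simpa [hS] using hx), ← majority hX M t x ht (by omega), ← hv x hx]
            simp [hL, hR]
    · simp [fill_ne, hMN]
      omega
  · omega
  · simp
    nlinarith [mul_le_mul hR0 hN (by simp) (by simp), mul_le_mul (le_refl X.R) hN (by simp) (by simp),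
      mul_le_mul (le_refl X.R) (hN0.trans_le hN) (by simp) (by simp)]

end

/-! ### Slopes -/

/-- The slope of the line through points number `i` and `j`. -/
def slopeOf (p : ℕ → ℝ × ℝ) (i j : ℕ) : ℝ := ((p j).2 - (p i).2) / ((p j).1 - (p i).1)

/-- The first `m` points are sorted by their `x`-coordinates. -/
def SortedTo (p : ℕ → ℝ × ℝ) (m : ℕ) : Prop := ∀ i j, i < j → j < m → (p i).1 < (p j).1

theorem orient_pos_iff {p : ℕ → ℝ × ℝ} {a b c : ℕ} (hb : (p a).1 < (p b).1)
    (hc : (p a).1 < (p c).1) :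
    0 < orient (p a) (p b) (p c) ↔ slopeOf p a b < slopeOf p a c := by
  rw [slopeOf, slopeOf, div_lt_div_iff₀ (by linarith) (by linarith)]
  simp only [orient, cross, Prod.fst_sub, Prod.snd_sub]
  constructor <;> intro h <;> linarith

theorem orient_nonpos_iff {p : ℕ → ℝ × ℝ} {a b c : ℕ} (hb : (p a).1 < (p b).1)
    (hc : (p a).1 < (p c).1) :
    orient (p a) (p b) (p c) ≤ 0 ↔ slopeOf p a c ≤ slopeOf p a b := by
  rw [← not_lt, ← not_lt, orient_pos_iff hb hc]

/-- The slope of `ac` is a mean of the slopes of `ab` and `bc` with positive weights. The last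
inequality of each strict case follows from the other two and is there for `grind`. -/
theorem slope_mediant {p : ℕ → ℝ × ℝ} {m a b c : ℕ} (hp : SortedTo p m) (hab : a < b) (hbc : b < c)
    (hc : c < m) :
    slopeOf p a b < slopeOf p a c ∧ slopeOf p a c < slopeOf p b c ∧
        slopeOf p a b < slopeOf p b c ∨
      slopeOf p a b = slopeOf p a c ∧ slopeOf p a c = slopeOf p b c ∨
      slopeOf p b c < slopeOf p a c ∧ slopeOf p a c < slopeOf p a b ∧
        slopeOf p b c < slopeOf p a b := by
  have h1 : 0 < (p b).1 - (p a).1 := by linarith [hp a b hab (by omega)]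
  have h2 : 0 < (p c).1 - (p b).1 := by linarith [hp b c hbc hc]
  have h3 : 0 < (p c).1 - (p a).1 := by linarith
  have e1 : slopeOf p a b * ((p b).1 - (p a).1) = (p b).2 - (p a).2 := by
    rw [slopeOf]; field_simp
  have e2 : slopeOf p b c * ((p c).1 - (p b).1) = (p c).2 - (p b).2 := by
    rw [slopeOf]; field_simp
  have e3 : slopeOf p a c * ((p c).1 - (p a).1) = (p c).2 - (p a).2 := by
    rw [slopeOf]; field_simp
  have e4 : (slopeOf p a c - slopeOf p a b) * ((p b).1 - (p a).1) =
      (slopeOf p b c - slopeOf p a c) * ((p c).1 - (p b).1) := by linarith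
  rcases lt_trichotomy (slopeOf p a b) (slopeOf p a c) with h | h | h
  · have : 0 < slopeOf p b c - slopeOf p a c := by
      refine pos_of_mul_pos_left (b := (p c).1 - (p b).1) ?_ h2.le
      rw [← e4]
      exact mul_pos (by linarith) h1
    left
    refine ⟨h, ?_, ?_⟩ <;> linarith
  · right; left
    refine ⟨h, ?_⟩
    rw [h] at e4
    simp at e4
    rcases e4 with e | e <;> linarith
  · have : 0 < slopeOf p a c - slopeOf p b c := by
      refine pos_of_mul_pos_left (b := (p c).1 - (p b).1) ?_ h2.le
      have : 0 < (slopeOf p a b - slopeOf p a c) * ((p b).1 - (p a).1) := mul_pos (by linarith) h1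
      linarith
    right; right
    refine ⟨?_, h, ?_⟩ <;> linarith

/-! ### Tangents from a point -/

/-- Among the points number `s, …, e - 1`, the point `r` is the last one of those that are seen
from the point `i` under the largest slope. -/
def IsBest (p : ℕ → ℝ × ℝ) (i s e r : ℕ) : Prop :=
  s ≤ r ∧ r < e ∧ ∀ j, s ≤ j → j < e → slopeOf p i j ≤ slopeOf p i r ∧
    (r < j → slopeOf p i j < slopeOf p i r)

/-- A maximum in the lexicographic order of slope and index. Ties go to the right so that points
inside a hull edge are skipped: they are not extreme. -/
theorem exists_isBest (p : ℕ → ℝ × ℝ) (i : ℕ) {s e : ℕ} (h : s < e) : ∃ r, IsBest p i s e r := by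
  obtain ⟨r, hr, hmax⟩ := Finset.exists_max_image (Finset.Ico s e)
    (fun j => toLex (slopeOf p i j, j)) ⟨s, by simp [h]⟩
  simp only [Finset.mem_Ico] at hr hmax
  refine ⟨r, hr.1, hr.2, fun j h1 h2 => ?_⟩
  have := hmax j ⟨h1, h2⟩
  rw [Prod.Lex.toLex_le_toLex] at this
  rcases this with h | ⟨h, h'⟩
  · exact ⟨h.le, fun _ => h⟩
  · exact ⟨h.le, fun h3 => absurd h' (by simpa using h3)⟩

theorem IsBest.unique {p : ℕ → ℝ × ℝ} {i s e r r' : ℕ} (h : IsBest p i s e r)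
    (h' : IsBest p i s e r') : r = r' := by
  obtain ⟨a1, a2, a3⟩ := h
  obtain ⟨b1, b2, b3⟩ := h'
  by_contra hne
  rcases lt_or_gt_of_ne hne with h | h
  · have := (a3 r' b1 b2).2 h
    have := (b3 r a1 a2).1
    linarith
  · have := (b3 r a1 a2).2 h
    have := (a3 r' b1 b2).1
    linarith

theorem IsBest.restrict {p : ℕ → ℝ × ℝ} {i s e r s' e' : ℕ} (h : IsBest p i s e r) (hs : s ≤ s')
    (he : e' ≤ e) (h1 : s' ≤ r) (h2 : r < e') : IsBest p i s' e' r :=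
  ⟨h1, h2, fun j a b => h.2.2 j (by omega) (by omega)⟩

/-- The point `r` follows the point `i` on the upper hull of the points number `i, …, e - 1`;
`r = 0` if `i` is the last of them. -/
def IsNext (p : ℕ → ℝ × ℝ) (i e r : ℕ) : Prop := r = 0 ∧ e ≤ i + 1 ∨ IsBest p i (i + 1) e r

/-- The point `i` is strictly above all chords of the points number `s, …, e - 1`. -/
def AboveChords (p : ℕ → ℝ × ℝ) (s e i : ℕ) : Prop :=
  ∀ a b, s ≤ a → a < i → i < b → b < e → slopeOf p a b < slopeOf p a i

/-- A pointer that jumps over `i` is itself a chord that `i` is not above. Conversely, let `i` be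
not above the chord `ab`, and let `j` be the point before `i` with the least slope towards `i`. If
the pointer of `j` ends before `i`, its end has a smaller slope towards `i`. If it ends at `i`, then
`b` is seen from `j` strictly below `i`, so the slope from `i` to `b` is too small for the chord
`ab`. -/
theorem aboveChords_iff {p : ℕ → ℝ × ℝ} {m s e i : ℕ} (hp : SortedTo p m) (he : e ≤ m)
    {nx : ℕ → ℕ} (hnx : ∀ h, s ≤ h → h < e → IsNext p h e (nx h)) (hi : i < e) :
    (∀ j, s ≤ j → j < i → nx j ≤ i) ↔ AboveChords p s e i := by
  constructor
  · intro h a b hsa hai hib hbe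
    by_contra hcon
    rw [not_lt] at hcon
    obtain ⟨j, hj, hmin⟩ := Finset.exists_min_image (Finset.Ico s i) (fun j => slopeOf p j i)
      ⟨a, by simp [hsa, hai]⟩
    simp only [Finset.mem_Ico] at hj hmin
    have hk := h j hj.1 hj.2
    have hja := hmin a ⟨hsa, hai⟩
    rcases hnx j hj.1 (by omega) with ⟨-, h2⟩ | ⟨h1, h2, h3⟩
    · omega
    · rcases hk.eq_or_lt with hk | hk
      · have hb := (h3 b (by omega) hbe).2 (by omega)
        rw [hk] at hb
        have t1 := slope_mediant hp hai hib (by omega)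
        have t2 := slope_mediant hp hj.2 hib (by omega)
        grind
      · have hb := (h3 i (by omega) hi).2 hk
        have hjk := hmin (nx j) ⟨by omega, hk⟩
        have t1 := slope_mediant hp (show j < nx j by omega) hk (by omega)
        grind
  · intro h j hsj hji
    by_contra hcon
    rw [not_le] at hcon
    rcases hnx j hsj (by omega) with ⟨h1, -⟩ | ⟨h1, h2, h3⟩
    · omega
    · have t1 := h j (nx j) hsj hji hcon h2
      have t2 := (h3 i (by omega) hi).1
      linarith

/-- Seen from `i`, the slopes of the vertices of a block rise weakly up to the tangent point `b` and
fall strictly after it, so comparing `h` with its successor tells on which side of `b` it is. Since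
`b` is a vertex itself, `b ≤ j` forces `b ≤ h`, and nothing is lost by moving from `j` back to `h`.
-/
theorem lt_best_iff {p : ℕ → ℝ × ℝ} {m i s e b j h : ℕ} (hp : SortedTo p m) (he : e ≤ m)
    {nx : ℕ → ℕ} (hnx : ∀ h, s ≤ h → h < e → IsNext p h e (nx h)) (his : i < s)
    (hb : IsBest p i s e b) (hje : j < e) (hsh : s ≤ h) (hhj : h ≤ j)
    (hlab : AboveChords p s e h) (hlast : ∀ k, s ≤ k → k ≤ j → AboveChords p s e k → k ≤ h) :
    (nx h ≠ 0 ∧ ¬ slopeOf p i (nx h) < slopeOf p i h) ↔ j < b := by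
  obtain ⟨b1, b2, b3⟩ := hb
  constructor
  · rintro ⟨h0, hsl⟩
    by_contra hbj
    rw [not_lt] at hbj
    have hbl : AboveChords p s e b := by
      intro a c hsa hab hbc hce
      have t1 := (b3 a hsa (by omega)).1
      have t2 := (b3 c (by omega) hce).2 hbc
      have t3 := slope_mediant hp (show i < a by omega) hab (by omega)
      have t4 := slope_mediant hp (show i < b by omega) hbc (by omega)
      have t5 := slope_mediant hp hab hbc (by omega)
      grind
    have hbh := hlast b b1 hbj hbl
    rcases hnx h hsh (by omega) with ⟨h1, -⟩ | ⟨n1, n2, n3⟩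
    · exact h0 h1
    · rcases hbh.eq_or_lt with hbh | hbh
      · subst hbh
        exact hsl ((b3 _ (by omega) n2).2 (by omega))
      · have t1 := hlab b (nx h) b1 hbh (by omega) n2
        have t2 := (b3 h hsh (by omega)).2 hbh
        have t3 := slope_mediant hp hbh (show h < nx h by omega) (by omega)
        have t4 := slope_mediant hp (show i < b by omega) hbh (by omega)
        have t5 := slope_mediant hp (show i < h by omega) (show h < nx h by omega) (by omega)
        grind
  · intro hjb
    rcases hnx h hsh (by omega) with ⟨h1, h2⟩ | ⟨n1, n2, n3⟩
    · omega
    · refine ⟨by omega, ?_⟩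
      have t1 := (b3 h hsh (by omega)).1
      have t2 := (n3 b (by omega) b2).1
      have t3 := slope_mediant hp (show i < h by omega) (show h < b by omega) (by omega)
      have t4 := slope_mediant hp (show i < h by omega) (show h < nx h by omega) (by omega)
      grind

/-! ### The upper hull -/

theorem pt_sortedTo {m : ℕ} {P : Fin m → ℝ × ℝ} (hP : StrictMono fun i => (P i).1) :
    SortedTo (pt P) m := by
  intro i j hij hj
  have := hP (show (⟨i, by omega⟩ : Fin m) < ⟨j, hj⟩ from hij)
  simpa [pt, hj, hij.trans hj] using this

theorem pt_val {m : ℕ} (P : Fin m → ℝ × ℝ) (i : Fin m) : pt P i = P i := by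
  simp [pt]

/-- Every slope from `i` to the right is smaller than every slope from the left to `i`. These are
finite sets, so some `σ` separates them strictly, even if one of them is empty. -/
theorem exists_supporting_slope {p : ℕ → ℝ × ℝ} {m i : ℕ} (hp : SortedTo p m) (hi : i < m)
    (h : AboveChords p 0 m i) :
    ∃ σ : ℝ, ∀ j < m, j ≠ i → (p j).2 - (p i).2 < σ * ((p j).1 - (p i).1) := by
  obtain ⟨σ, h1, h2⟩ := Order.exists_between_finsets
    ((Finset.Ioo i m).image fun b => slopeOf p i b)
    ((Finset.range i).image fun a => slopeOf p a i) (by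
      simp only [Finset.mem_image, Finset.mem_Ioo, Finset.mem_range]
      rintro _ ⟨b, ⟨hb, hbm⟩, rfl⟩ _ ⟨a, ha, rfl⟩
      have := h a b (by omega) ha hb hbm
      have := slope_mediant hp ha hb hbm
      grind)
  simp only [Finset.mem_image, Finset.mem_Ioo, Finset.mem_range, forall_exists_index, and_imp,
    forall_apply_eq_imp_iff₂] at h1 h2
  refine ⟨σ, fun j hj hne => ?_⟩
  rcases lt_or_gt_of_ne hne with hlt | hgt
  · have t1 := h2 j hlt
    have t2 := hp j i hlt hi
    rw [slopeOf, lt_div_iff₀ (by linarith)] at t1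
    linarith
  · have t1 := h1 _ j hgt hj rfl
    have t2 := hp i j hgt hj
    rw [slopeOf, div_lt_iff₀ (by linarith)] at t1
    linarith

/-- If `i` is not strictly above a chord, the point of the chord with the same abscissa is at least
as high. As no point of the hull is higher than `P i`, the two coincide, and `P i` is not extreme.
Conversely, the open half-plane below a supporting line, together with `P i`, is a convex set that
contains all the points; `P i` is extreme and topmost in it. -/
theorem mem_upperHull_iff {m : ℕ} {P : Fin m → ℝ × ℝ} (hP : StrictMono fun i => (P i).1)
    (i : Fin m) : i ∈ upperHull P ↔ AboveChords (pt P) 0 m i := by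
  have hp := pt_sortedTo hP
  simp only [upperHull, Finset.mem_filter, Finset.mem_univ, true_and]
  constructor
  · rintro ⟨hext, htop⟩ a b - hai hib hbm
    by_contra hcon
    rw [not_lt] at hcon
    have xa := hp a i hai i.2
    have xb := hp i b hib hbm
    have ham : a < m := hai.trans i.2
    have hA : P ⟨a, ham⟩ = pt P a := by simp [pt, ham]
    have hB : P ⟨b, hbm⟩ = pt P b := by simp [pt, hbm]
    have hd : 0 < (pt P b).1 - (pt P a).1 := by linarith
    set t : ℝ := ((pt P i).1 - (pt P a).1) / ((pt P b).1 - (pt P a).1) with ht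
    have ht0 : 0 < t := div_pos (by linarith) hd
    have ht1 : t < 1 := by rw [ht, div_lt_one hd]; linarith
    have hseg : AffineMap.lineMap (P ⟨a, ham⟩) (P ⟨b, hbm⟩) t ∈
        openSegment ℝ (P ⟨a, ham⟩) (P ⟨b, hbm⟩) := by
      rw [openSegment_eq_image_lineMap]
      exact ⟨t, ⟨ht0, ht1⟩, rfl⟩
    have hmemA : P ⟨a, ham⟩ ∈ convexHull ℝ (Set.range P) := subset_convexHull _ _ ⟨_, rfl⟩
    have hmemB : P ⟨b, hbm⟩ ∈ convexHull ℝ (Set.range P) := subset_convexHull _ _ ⟨_, rfl⟩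
    have hmem := (convex_convexHull ℝ (Set.range P)).openSegment_subset hmemA hmemB hseg
    have h1 : (AffineMap.lineMap (P ⟨a, ham⟩) (P ⟨b, hbm⟩) t : ℝ × ℝ).1 = (P i).1 := by
      simp only [AffineMap.lineMap_apply, vsub_eq_sub, vadd_eq_add, Prod.fst_add, Prod.smul_fst,
        Prod.fst_sub, smul_eq_mul, hA, hB, ← pt_val P i]
      rw [ht, div_mul_cancel₀ _ hd.ne']
      ring
    have h2 : (AffineMap.lineMap (P ⟨a, ham⟩) (P ⟨b, hbm⟩) t : ℝ × ℝ).2 =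
        (pt P a).2 + slopeOf (pt P) a b * ((pt P i).1 - (pt P a).1) := by
      simp only [AffineMap.lineMap_apply, vsub_eq_sub, vadd_eq_add, Prod.snd_add, Prod.smul_snd,
        Prod.snd_sub, smul_eq_mul, hA, hB, slopeOf, ht]
      field_simp
      ring
    have h3 : (P i).2 = (pt P a).2 + slopeOf (pt P) a i * ((pt P i).1 - (pt P a).1) := by
      have : (pt P i).1 - (pt P a).1 ≠ 0 := by linarith
      rw [slopeOf, div_mul_cancel₀ _ this, pt_val]
      ring
    have h4 : (P i).2 = (AffineMap.lineMap (P ⟨a, ham⟩) (P ⟨b, hbm⟩) t : ℝ × ℝ).2 := by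
      refine le_antisymm ?_ (htop _ hmem h1)
      rw [h2, h3]
      have := mul_le_mul_of_nonneg_right hcon (show 0 ≤ (pt P i).1 - (pt P a).1 by linarith)
      linarith
    have h5 : AffineMap.lineMap (P ⟨a, ham⟩) (P ⟨b, hbm⟩) t = P i := Prod.ext h1 h4.symm
    rw [h5] at hseg
    have h6 := hext.2 hmemA hmemB hseg
    rw [hA] at h6
    rw [h6, pt_val] at xa
    exact lt_irrefl _ xa
  · intro h
    obtain ⟨σ, hσ⟩ := exists_supporting_slope hp i.2 h
    have hsub : convexHull ℝ (Set.range P) ⊆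
        {q | q = P i ∨ q.2 - (P i).2 < σ * (q.1 - (P i).1)} := by
      refine convexHull_min ?_ ?_
      · rintro _ ⟨j, rfl⟩
        by_cases hj : j = i
        · exact Or.inl (by rw [hj])
        · right
          have := hσ j j.2 (by simpa [Fin.ext_iff] using hj)
          simpa only [pt_val] using this
      · have hle : ∀ q : ℝ × ℝ, (q = P i ∨ q.2 - (P i).2 < σ * (q.1 - (P i).1)) →
            q.2 - (P i).2 ≤ σ * (q.1 - (P i).1) := by
          rintro q (rfl | h)
          · simp
          · exact h.le
        rw [convex_iff_forall_pos]
        intro u hu v hv a b ha hb hab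
        by_cases hboth : u = P i ∧ v = P i
        · left
          rw [hboth.1, hboth.2, ← add_smul, hab, one_smul]
        · right
          have ha' : b = 1 - a := by linarith
          simp only [Prod.snd_add, Prod.smul_snd, Prod.fst_add, Prod.smul_fst, smul_eq_mul]
          rw [not_and_or] at hboth
          have eu := hle u hu
          have ev := hle v hv
          have key : a * (u.2 - (P i).2) + b * (v.2 - (P i).2) <
              a * (σ * (u.1 - (P i).1)) + b * (σ * (v.1 - (P i).1)) := by
            rcases hboth with h' | h'
            · have := hu.resolve_left h'
              exact add_lt_add_of_lt_of_le (mul_lt_mul_of_pos_left this ha)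
                (mul_le_mul_of_nonneg_left ev hb.le)
            · have := hv.resolve_left h'
              exact add_lt_add_of_le_of_lt (mul_le_mul_of_nonneg_left eu ha.le)
                (mul_lt_mul_of_pos_left this hb)
          subst ha'
          linarith
    refine ⟨⟨subset_convexHull _ _ ⟨i, rfl⟩, ?_⟩, ?_⟩
    · rintro u hu v hv ⟨a, b, ha, hb, hab, huv⟩
      have e1 := hsub hu
      have e2 := hsub hv
      rcases e1 with e1 | e1
      · exact e1
      · exfalso
        have e2' : v.2 - (P i).2 ≤ σ * (v.1 - (P i).1) := by
          rcases e2 with rfl | h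
          · simp
          · exact h.le
        have h1 : a * u.1 + b * v.1 = (P i).1 := by rw [← huv]; simp
        have h2 : a * u.2 + b * v.2 = (P i).2 := by rw [← huv]; simp
        have h3 := mul_lt_mul_of_pos_left e1 ha
        have h4 := mul_le_mul_of_nonneg_left e2' hb.le
        have hb' : b = 1 - a := by linarith
        subst hb'
        have h5 : σ * (a * u.1 + (1 - a) * v.1) = σ * (P i).1 := by rw [h1]
        linarith
    · intro q hq hq1
      rcases hsub hq with rfl | h
      · exact le_rfl
      · rw [hq1] at h
        simp at h
        exact h.le

/-! ### Local verification of the upper hull -/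

/-- For `u` to the left of `v`, `orient u v ·` is a positive multiple of the height above the line
`uv`. Being above the chord `ab` then means exceeding the interpolation of these heights between `a`
and `b`, so extremal choices relative to `uv` can be tested on other chords. -/
theorem orient_affine (u v a b k : ℝ × ℝ) :
    orient a b k * (v.1 - u.1) = orient u v k * (b.1 - a.1) - orient u v a * (b.1 - k.1) -
      orient u v b * (k.1 - a.1) := by
  simp only [orient, cross, Prod.fst_sub, Prod.snd_sub]
  ring

theorem orient_self_left (u v : ℝ × ℝ) : orient u v u = 0 := by
  simp [orient, cross]

theorem orient_self_right (u v : ℝ × ℝ) : orient u v v = 0 := by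
  simp only [orient, cross]
  ring

theorem exists_pred {S : ℕ → Prop} {l i : ℕ} (hl : S l) (hli : l < i) :
    ∃ a < i, l ≤ a ∧ S a ∧ ∀ j, a < j → j < i → ¬ S j := by
  classical
  refine ⟨Nat.findGreatest S (i - 1), ?_, Nat.le_findGreatest (by omega) hl,
    Nat.findGreatest_spec (P := S) (show l ≤ i - 1 by omega) hl,
    fun j h1 h2 => Nat.findGreatest_is_greatest h1 (by omega)⟩
  have := Nat.findGreatest_le (P := S) (i - 1)
  omega

theorem exists_succ {S : ℕ → Prop} {i l : ℕ} (hl : S l) (hil : i < l) :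
    ∃ b, i < b ∧ b ≤ l ∧ S b ∧ ∀ j, i < j → j < b → ¬ S j := by
  classical
  have h : ∃ b, i < b ∧ S b := ⟨l, hil, hl⟩
  exact ⟨Nat.find h, (Nat.find_spec h).1, Nat.find_min' h ⟨hil, hl⟩, (Nat.find_spec h).2,
    fun j h1 h2 h3 => Nat.find_min h h2 ⟨h1, h3⟩⟩

/-- Otherwise the last of the points between `u` and `v` that are highest above the line `uv` would
be a vertex. It is above the chords within `[u, v]` by its choice; longer chords are compared with
these because `u` and `v` are above every chord that passes over them. -/
theorem orient_nonpos_of_consecutive {p : ℕ → ℝ × ℝ} {m u v : ℕ} (hp : SortedTo p m) (hv : v < m)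
    (hU : AboveChords p 0 m u) (hV : AboveChords p 0 m v)
    (hno : ∀ k, u < k → k < v → ¬ AboveChords p 0 m k) {i : ℕ} (hui : u < i) (hiv : i < v) :
    orient (p u) (p v) (p i) ≤ 0 := by
  by_contra hcon
  rw [not_le] at hcon
  obtain ⟨k, hk, hmax⟩ := Finset.exists_max_image (Finset.Ioo u v)
    (fun k => toLex (orient (p u) (p v) (p k), k)) ⟨i, by simp [hui, hiv]⟩
  simp only [Finset.mem_Ioo] at hk hmax
  have hmax' : ∀ j, u < j → j < v → orient (p u) (p v) (p j) ≤ orient (p u) (p v) (p k) ∧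
      (k < j → orient (p u) (p v) (p j) < orient (p u) (p v) (p k)) := by
    intro j h1 h2
    have := hmax j ⟨h1, h2⟩
    rw [Prod.Lex.toLex_le_toLex] at this
    rcases this with h | ⟨h, h'⟩
    · exact ⟨h.le, fun _ => h⟩
    · exact ⟨h.le, fun h3 => absurd h' (by simpa using h3)⟩
  have hkpos : 0 < orient (p u) (p v) (p k) := hcon.trans_le (hmax' i hui hiv).1
  have inner : ∀ a b, u ≤ a → a < k → k < b → b ≤ v → slopeOf p a b < slopeOf p a k := by
    intro a b hua hak hkb hbv
    have xak := hp a k hak (by omega)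
    have xkb := hp k b hkb (by omega)
    have xuv := hp u v (by omega) hv
    rw [← orient_pos_iff (by linarith) xak]
    have fa : orient (p u) (p v) (p a) ≤ orient (p u) (p v) (p k) := by
      rcases hua.eq_or_lt with rfl | h
      · rw [orient_self_left]; exact hkpos.le
      · exact (hmax' a h (by omega)).1
    have fb : orient (p u) (p v) (p b) < orient (p u) (p v) (p k) := by
      rcases hbv.eq_or_lt with rfl | h
      · rw [orient_self_right]; exact hkpos
      · exact (hmax' b (by omega) h).2 hkb
    have key := orient_affine (p u) (p v) (p a) (p b) (p k)
    refine pos_of_mul_pos_left (b := (p v).1 - (p u).1) ?_ (by linarith)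
    rw [key]
    have t1 := mul_le_mul_of_nonneg_right fa (show 0 ≤ (p b).1 - (p k).1 by linarith)
    have t2 := mul_lt_mul_of_pos_right fb (show 0 < (p k).1 - (p a).1 by linarith)
    linarith
  have right : ∀ a b, u ≤ a → a < k → k < b → b < m → slopeOf p a b < slopeOf p a k := by
    intro a b hua hak hkb hbm
    rcases le_or_gt b v with h | h
    · exact inner a b hua hak hkb h
    · exact (hV a b (by omega) (by omega) h hbm).trans (inner a v hua hak hk.2 le_rfl)
  refine hno k hk.1 hk.2 fun a b _ hak hkb hbm => ?_
  rcases le_or_gt u a with h | h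
  · exact right a b h hak hkb hbm
  · have t1 := hU a b (by omega) h (by omega) hbm
    have t2 := right u b le_rfl hk.1 hkb hbm
    have t3 := slope_mediant hp h (show u < b by omega) hbm
    have t4 := slope_mediant hp hk.1 hkb hbm
    have t5 := slope_mediant hp hak hkb hbm
    grind

theorem aboveChords_first {p : ℕ → ℝ × ℝ} {m : ℕ} : AboveChords p 0 m 0 :=
  fun _ _ _ h => absurd h (by omega)

theorem aboveChords_last {p : ℕ → ℝ × ℝ} {m : ℕ} : AboveChords p 0 m (m - 1) :=
  fun _ _ _ _ _ _ => by omega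

/-- A set of points is the vertex set of the upper hull iff it contains the two outermost points,
and every other point is in it iff it is strictly above the chord of its two neighbours in it. -/
theorem forall_iff_aboveChords {p : ℕ → ℝ × ℝ} {m : ℕ} (hp : SortedTo p m) (hm : 2 ≤ m)
    (S : ℕ → Prop) :
    (∀ i < m, S i ↔ AboveChords p 0 m i) ↔ S 0 ∧ S (m - 1) ∧
      ∀ i a b, a < i → i < b → b < m → S a → S b → (∀ j, a < j → j < i → ¬ S j) →
        (∀ j, i < j → j < b → ¬ S j) → (S i ↔ 0 < orient (p a) (p b) (p i)) := by
  constructor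
  · intro h
    refine ⟨(h 0 (by omega)).2 aboveChords_first, (h _ (by omega)).2 aboveChords_last, ?_⟩
    intro i a b hai hib hbm hSa hSb hno1 hno2
    have xai := hp a i hai (by omega)
    have xib := hp i b hib hbm
    constructor
    · intro hSi
      rw [orient_pos_iff (by linarith) xai]
      exact (h i (by omega)).1 hSi a b (by omega) hai hib hbm
    · intro hpos
      by_contra hSi
      refine absurd hpos (not_lt.2 (orient_nonpos_of_consecutive hp hbm
        ((h a (by omega)).1 hSa) ((h b hbm).1 hSb) (fun k h1 h2 h3 => ?_) hai hib))
      have hSk := (h k (by omega)).2 h3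
      rcases lt_trichotomy k i with hk | rfl | hk
      · exact hno1 k h1 hk hSk
      · exact hSi hSk
      · exact hno2 k hk h2 hSk
  · rintro ⟨h0, hl, hloc⟩
    -- The outermost points provide neighbours in `S`, and a true vertex is above every chord, so it
    -- passes its test.
    have hUS : ∀ i < m, AboveChords p 0 m i → S i := by
      intro i hi hU
      rcases Nat.eq_zero_or_pos i with rfl | hi0
      · exact h0
      rcases (show i ≤ m - 1 by omega).eq_or_lt with rfl | hi1
      · exact hl
      obtain ⟨a, hai, -, hSa, ha⟩ := exists_pred h0 hi0
      obtain ⟨b, hib, hbl, hSb, hb⟩ := exists_succ hl hi1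
      have xai := hp a i hai (by omega)
      have xib := hp i b hib (by omega)
      rw [hloc i a b hai hib (by omega) hSa hSb ha hb, orient_pos_iff (by linarith) xai]
      exact hU a b (by omega) hai hib (by omega)
    intro i hi
    refine ⟨fun hSi => ?_, hUS i hi⟩
    by_contra hU
    have hi0 : 0 < i := by
      rcases Nat.eq_zero_or_pos i with rfl | h
      · exact absurd aboveChords_first hU
      · exact h
    have hi1 : i < m - 1 := by
      rcases (show i ≤ m - 1 by omega).eq_or_lt with rfl | h
      · exact absurd aboveChords_last hU
      · exact h
    obtain ⟨u, hui, -, hUu, hu⟩ := exists_pred (S := AboveChords p 0 m) aboveChords_first hi0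
    obtain ⟨v, hiv, hvl, hUv, hv⟩ := exists_succ (S := AboveChords p 0 m) aboveChords_last hi1
    have hvm : v < m := by omega
    have hno : ∀ k, u < k → k < v → ¬ AboveChords p 0 m k := by
      intro k h1 h2
      rcases lt_trichotomy k i with hk | rfl | hk
      · exact hu k h1 hk
      · exact hU
      · exact hv k hk h2
    classical
    -- The lowest element of `S` relative to `uv`. Its neighbours in `S` stay within `[u, v]`
    -- because `u` and `v` belong to `S`, and neither is lower, so the test of `k` must fail.
    obtain ⟨k, hk, hmin⟩ := Finset.exists_min_image ((Finset.Ioo u v).filter S)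
      (fun k => orient (p u) (p v) (p k)) ⟨i, by simp [hui, hiv, hSi]⟩
    simp only [Finset.mem_filter, Finset.mem_Ioo] at hk hmin
    obtain ⟨⟨huk, hkv⟩, hSk⟩ := hk
    obtain ⟨a, hak, hua, hSa, ha⟩ := exists_pred (hUS u (by omega) hUu) huk
    obtain ⟨b, hkb, hbv, hSb, hb⟩ := exists_succ (hUS v hvm hUv) hkv
    have hpos := (hloc k a b hak hkb (by omega) hSa hSb ha hb).1 hSk
    have hk0 := orient_nonpos_of_consecutive hp hvm hUu hUv hno huk hkv
    have fa : orient (p u) (p v) (p k) ≤ orient (p u) (p v) (p a) := by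
      rcases hua.eq_or_lt with rfl | h
      · rwa [orient_self_left]
      · exact hmin a ⟨⟨h, by omega⟩, hSa⟩
    have fb : orient (p u) (p v) (p k) ≤ orient (p u) (p v) (p b) := by
      rcases hbv.eq_or_lt with rfl | h
      · rwa [orient_self_right]
      · exact hmin b ⟨⟨by omega, h⟩, hSb⟩
    have xak := hp a k hak (by omega)
    have xkb := hp k b hkb (by omega)
    have xuv := hp u v (by omega) hvm
    have key := orient_affine (p u) (p v) (p a) (p b) (p k)
    have t0 := mul_pos hpos (show 0 < (p v).1 - (p u).1 by linarith)
    have t1 := mul_le_mul_of_nonneg_right fa (show 0 ≤ (p b).1 - (p k).1 by linarith)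
    have t2 := mul_le_mul_of_nonneg_right fb (show 0 ≤ (p k).1 - (p a).1 by linarith)
    linarith

/-! ### Merging blocks -/

/-- The pointers `nx` lead from every point to the next one on the upper hull of the rest of its
block of `B` points. -/
def IsNextTable (p : ℕ → ℝ × ℝ) (m B : ℕ) (nx : ℕ → ℕ) : Prop :=
  ∀ i < m, IsNext p i (min m ((i / B + 1) * B)) (nx i)

/-- The last vertex, not after `j`, of the upper hulls of the blocks. -/
def lastVertex (nx : ℕ → ℕ) (j : ℕ) : ℕ :=
  (Finset.Icc 0 j).sup fun y => if y < (Finset.Icc 0 (y - 1)).sup nx then 0 else y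

section

variable {p : ℕ → ℝ × ℝ} {m B : ℕ} {nx : ℕ → ℕ}

theorem IsNextTable.lt (h : IsNextTable p m B nx) {i : ℕ} (hi : i < m) : nx i < m := by
  rcases h i hi with ⟨h1, -⟩ | ⟨-, h1, -⟩ <;> omega

/-- No pointer leaves its block, hence none jumps over the start of a later one. This is why prefix
maxima over all points serve all blocks at once. -/
theorem IsNextTable.le_of_lt (h : IsNextTable p m B nx) {k s : ℕ} (hk : k < s * B)
    (hs : s * B < m) : nx k ≤ s * B := by
  have h1 : (k / B + 1) * B ≤ s * B :=
    Nat.mul_le_mul_right _ (Nat.div_lt_of_lt_mul (by rwa [mul_comm]))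
  rcases h k (by omega) with ⟨h2, -⟩ | ⟨-, h2, -⟩ <;> omega

theorem IsNextTable.isNext (h : IsNextTable p m B nx) (hB : 0 < B) {s : ℕ} {k : ℕ}
    (h1 : s * B ≤ k) (h2 : k < min m (s * B + B)) : IsNext p k (min m (s * B + B)) (nx k) := by
  have hk : k / B = s := by
    rw [Nat.div_eq_iff hB]
    constructor
    · omega
    · have : (s + 1) * B = s * B + B := by ring
      omega
  have := h k (by omega)
  rwa [hk, add_mul, one_mul] at this

/-- By `aboveChords_iff`, a block vertex is a point that no earlier pointer jumps over; pointers
from earlier blocks do not interfere. The start of the block is always such a point, so the maximum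
does not fall back into an earlier block. -/
theorem lastVertex_spec (hp : SortedTo p m) (h : IsNextTable p m B nx) (hB : 0 < B) {s j : ℕ}
    (h1 : s * B ≤ j) (h2 : j < min m (s * B + B)) :
    s * B ≤ lastVertex nx j ∧ lastVertex nx j ≤ j ∧
      AboveChords p (s * B) (min m (s * B + B)) (lastVertex nx j) ∧
      ∀ k, s * B ≤ k → k ≤ j → AboveChords p (s * B) (min m (s * B + B)) k →
        k ≤ lastVertex nx j := by
  have habove : ∀ k, s * B ≤ k → k ≤ j →
      (AboveChords p (s * B) (min m (s * B + B)) k ↔ ∀ l < k, nx l ≤ k) := by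
    intro k hk1 hk2
    rw [← aboveChords_iff hp (min_le_left _ _) (fun l a b => h.isNext hB a b)
      (show k < min m (s * B + B) by omega)]
    refine ⟨fun H l hl => ?_, fun H l _ hl => H l hl⟩
    rcases le_or_gt (s * B) l with hl' | hl'
    · exact H l hl' hl
    · exact (h.le_of_lt hl' (by omega)).trans hk1
  set f : ℕ → ℕ := fun y => if y < (Finset.Icc 0 (y - 1)).sup nx then 0 else y with hf
  have hfk : ∀ k, (∀ l < k, nx l ≤ k) → f k = k := by
    intro k hk
    rcases Nat.eq_zero_or_pos k with rfl | hk0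
    · simp [hf]
    · simp only [hf]
      rw [if_neg]
      rw [not_lt, Finset.sup_le_iff]
      intro l hl
      simp at hl
      exact hk l (by omega)
  have hle : ∀ k ≤ j, (∀ l < k, nx l ≤ k) → k ≤ lastVertex nx j := by
    intro k hk hl
    conv_lhs => rw [← hfk k hl]
    exact Finset.le_sup (f := f) (by simpa using hk)
  have hs : s * B ≤ lastVertex nx j :=
    hle _ h1 fun l hl => h.le_of_lt hl (by omega)
  obtain ⟨y, hy, hyf⟩ := Finset.exists_mem_eq_sup (Finset.Icc 0 j) ⟨0, by simp⟩ f
  change lastVertex nx j = f y at hyf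
  simp at hy
  have hlast : lastVertex nx j ≤ j ∧ ∀ l < lastVertex nx j, nx l ≤ lastVertex nx j := by
    -- Points that are jumped over contribute 0, which is harmless: no pointer comes before point 0.
    by_cases hc : y < (Finset.Icc 0 (y - 1)).sup nx
    · have : lastVertex nx j = 0 := by rw [hyf]; simp only [hf, hc, if_true]
      rw [this]
      exact ⟨by omega, fun l hl => absurd hl (by omega)⟩
    · have : lastVertex nx j = y := by rw [hyf]; simp only [hf, hc, if_false]
      rw [this]
      refine ⟨hy, fun l hl => ?_⟩
      rw [not_lt, Finset.sup_le_iff] at hc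
      exact hc l (by simp; omega)
  refine ⟨hs, hlast.1, ?_, fun k a b c => hle k b ((habove k a b).1 c)⟩
  rw [habove _ hs hlast.1]
  exact hlast.2

end

/-- The first point of the block number `g` of the superblock of `q` blocks that contains `i`. -/
def blockStart (B q i g : ℕ) : ℕ := (i / (B * q) * q + g) * B

open Classical in
/-- The tangent point from `i` to block number `g` of its superblock if this block is to the right
of `i` and not empty; the start of the block otherwise. -/
def target (p : ℕ → ℝ × ℝ) (m B q i g : ℕ) : ℕ :=
  if h : i / B % q < g ∧ ∃ r, IsBest p i (blockStart B q i g)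
    (min m (blockStart B q i g + B)) r then h.2.choose else blockStart B q i g

open Classical in
/-- The outcome of one test of the search for the tangent point. -/
def searchBit (p : ℕ → ℝ × ℝ) (m B q : ℕ) (nx : ℕ → ℕ) (i g j : ℕ) : ℕ :=
  if i / B % q < g ∧ j < m ∧ nx (lastVertex nx j) ≠ 0 ∧
    ¬ 0 < orient (p i) (p (nx (lastVertex nx j))) (p (lastVertex nx j)) then 1 else 0

section

variable {p : ℕ → ℝ × ℝ} {m B q : ℕ} {nx : ℕ → ℕ}

theorem lt_blockStart (hB : 0 < B) {i g : ℕ} (hg : i / B % q < g) : i < blockStart B q i g := by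
  have h1 : i / B = i / (B * q) * q + i / B % q := by
    rw [← Nat.div_div_eq_div_mul, mul_comm]
    exact (Nat.div_add_mod _ _).symm
  rw [blockStart]
  have h2 : i / B < i / (B * q) * q + g := by omega
  have := Nat.lt_mul_div_succ i hB
  calc i < B * (i / B + 1) := this
    _ ≤ (i / (B * q) * q + g) * B := by rw [mul_comm]; exact Nat.mul_le_mul_right _ h2

theorem target_of_lt {i g : ℕ} (hg : i / B % q < g) (hm : blockStart B q i g < m) (hB : 0 < B) :
    IsBest p i (blockStart B q i g) (min m (blockStart B q i g + B)) (target p m B q i g) := by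
  have h : i / B % q < g ∧ ∃ r, IsBest p i (blockStart B q i g)
      (min m (blockStart B q i g + B)) r := ⟨hg, exists_isBest p i (by omega)⟩
  rw [target, dif_pos h]
  exact h.2.choose_spec

theorem target_mem (hB : 0 < B) (i g : ℕ) : blockStart B q i g ≤ target p m B q i g ∧
    target p m B q i g < blockStart B q i g + B := by
  rw [target]
  split_ifs with h
  · have := h.2.choose_spec
    exact ⟨this.1, by have := this.2.1; omega⟩
  · omega

theorem target_of_not {i g : ℕ} (h : ¬ (i / B % q < g ∧ blockStart B q i g < m)) :
    target p m B q i g = blockStart B q i g := by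
  rw [target, dif_neg]
  rintro ⟨h1, r, h2, h3, -⟩
  exact h ⟨h1, by omega⟩

/-- This is `lt_best_iff` for a single probe. Where there is nothing to test both sides vanish: an
absent tangent is placed at the start of the block, and an actual one is smaller than `m`. -/
theorem searchBit_eq (hp : SortedTo p m) (h : IsNextTable p m B nx) (hB : 0 < B) {i g j : ℕ}
    (h1 : blockStart B q i g ≤ j) (h2 : j < blockStart B q i g + B) :
    searchBit p m B q nx i g j = if j < target p m B q i g then 1 else 0 := by
  by_cases hv : i / B % q < g ∧ j < m
  · obtain ⟨hg, hj⟩ := hv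
    have hbest := target_of_lt (p := p) hg (h1.trans_lt hj) hB
    have hi := lt_blockStart hB hg
    simp only [blockStart] at h1 h2 hbest hi
    set s := i / (B * q) * q + g
    have hje : j < min m (s * B + B) := by omega
    obtain ⟨l1, l2, l3, l4⟩ := lastVertex_spec hp h hB h1 hje
    have key := lt_best_iff hp (min_le_left m (s * B + B)) (fun k a b => h.isNext hB a b) hi hbest
      hje l1 l2 l3 l4
    rw [searchBit]
    congr 1
    rw [← key]
    simp only [hg, hj, true_and]
    refine propext (and_congr_right fun h0 => not_congr ?_)
    have hn : lastVertex nx j < nx (lastVertex nx j) ∧ nx (lastVertex nx j) < m := by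
      rcases h.isNext hB l1 (by omega) with ⟨a, -⟩ | ⟨a, b, -⟩
      · exact absurd a h0
      · omega
    exact orient_pos_iff (hp _ _ (by omega) hn.2) (hp _ _ (by omega) (by omega))
  · rw [searchBit, if_neg (by tauto), if_neg]
    intro hlt
    by_cases hg : i / B % q < g ∧ blockStart B q i g < m
    · have := (target_of_lt (p := p) hg.1 hg.2 hB).2.1
      exact hv ⟨hg.1, by omega⟩
    · rw [target_of_not hg] at hlt
      omega

/-- One round of the search refines the position of the tangent point by a factor of `q`. -/
theorem search_round (hp : SortedTo p m) (h : IsNextTable p m B nx) (hB : 0 < B)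
    {i g pos st : ℕ} (hst : 0 < st)
    (h1 : blockStart B q i g ≤ pos) (h2 : pos + q * st ≤ blockStart B q i g + B)
    (h3 : pos ≤ target p m B q i g) (h4 : target p m B q i g < pos + q * st) (pos' : ℕ)
    (hpos : pos' = pos + st * ∑ c ∈ Finset.range q,
      searchBit p m B q nx i g (pos + (c + 1) * st - 1)) :
    blockStart B q i g ≤ pos' ∧ pos' + st ≤ blockStart B q i g + B ∧
      pos' ≤ target p m B q i g ∧ target p m B q i g < pos' + st := by
  set t := target p m B q i g with ht
  -- The probes are the last positions of `q` consecutive intervals of length `st`. Those before the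
  -- target are as many as the intervals that lie entirely before it.
  have hsum : ∑ c ∈ Finset.range q, searchBit p m B q nx i g (pos + (c + 1) * st - 1) =
      (t - pos) / st := by
    have hq : (t - pos) / st ≤ q := by
      refine Nat.div_le_of_le_mul ?_
      rw [mul_comm]; omega
    calc ∑ c ∈ Finset.range q, searchBit p m B q nx i g (pos + (c + 1) * st - 1)
        = ∑ c ∈ Finset.range q, if c < (t - pos) / st then 1 else 0 := by
          refine Finset.sum_congr rfl fun c hc => ?_
          have hc' : (c + 1) * st ≤ q * st := Nat.mul_le_mul_right _ (by simpa using hc)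
          have hc0 : st ≤ (c + 1) * st := Nat.le_mul_of_pos_left _ (by omega)
          rw [searchBit_eq hp h hB (by omega) (by omega), ← ht]
          congr 1
          rw [eq_iff_iff, ← Nat.succ_le_iff (m := c), Nat.le_div_iff_mul_le hst]
          simp only [Nat.succ_eq_add_one]
          omega
      _ = (t - pos) / st := by
          rw [← Finset.card_filter]
          have : (Finset.range q).filter (fun c => c < (t - pos) / st) =
              Finset.range ((t - pos) / st) := by
            ext c
            simp only [Finset.mem_filter, Finset.mem_range]
            omega
          rw [this, Finset.card_range]
  rw [hsum] at hpos
  have e := Nat.div_add_mod (t - pos) st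
  have e' := Nat.mod_lt (t - pos) hst
  have hq : (t - pos) / st < q := Nat.div_lt_of_lt_mul (by rw [mul_comm]; omega)
  have hq' : st * ((t - pos) / st + 1) ≤ q * st := by
    rw [mul_comm]; exact Nat.mul_le_mul_right _ hq
  rw [mul_add, mul_one] at hq'
  omega

end

/-! ### The best candidate -/

/-- The candidate of block number `g` for the successor of `i`; `0` if there is none. -/
def candidate (p : ℕ → ℝ × ℝ) (m B q : ℕ) (nx : ℕ → ℕ) (i g : ℕ) : ℕ :=
  if i / B % q < g then if target p m B q i g < m then target p m B q i g else 0
  else if i / B % q = g then nx i else 0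

open Classical in
/-- Whether the candidate of block `g` loses against that of block `g'`. -/
def beaten (p : ℕ → ℝ × ℝ) (w : ℕ → ℕ) (i g g' : ℕ) : ℕ :=
  if w g ≠ 0 ∧ w g' ≠ 0 ∧ g ≠ g' ∧
    (0 < orient (p i) (p (max (w g) (w g'))) (p (min (w g) (w g'))) ↔ g' < g) then 1 else 0

/-- The candidate that is not beaten. -/
def winner (p : ℕ → ℝ × ℝ) (q : ℕ) (w : ℕ → ℕ) (i : ℕ) : ℕ :=
  (Finset.range q).sup fun g =>
    if w g ≠ 0 ∧ ∑ g' ∈ Finset.range q, beaten p w i g g' = 0 then w g else 0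

section

variable {p : ℕ → ℝ × ℝ} {m B q : ℕ} {nx : ℕ → ℕ}

theorem div_eq_superblock (B q i : ℕ) : i / B = i / (B * q) * q + i / B % q := by
  rw [← Nat.div_div_eq_div_mul, mul_comm]
  exact (Nat.div_add_mod _ _).symm

/-- Candidates come from a search in a later block or from the old pointer within the block of `i`.
The `max` in the lower bound treats both alike. -/
theorem candidate_spec (h : IsNextTable p m B nx) (hB : 0 < B) {i g : ℕ} (hi : i < m)
    (h0 : candidate p m B q nx i g ≠ 0) :
    i < candidate p m B q nx i g ∧ candidate p m B q nx i g < m ∧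
      candidate p m B q nx i g / B = i / (B * q) * q + g ∧
      IsBest p i (max (i + 1) (blockStart B q i g)) (min m (blockStart B q i g + B))
        (candidate p m B q nx i g) := by
  by_cases hg : i / B % q < g
  · have hbi := lt_blockStart hB hg
    by_cases ht : target p m B q i g < m
    · have e : candidate p m B q nx i g = target p m B q i g := by simp [candidate, hg, ht]
      rw [e]
      have hmem := target_mem (p := p) (m := m) (q := q) hB i g
      have hb := target_of_lt (p := p) (m := m) hg (by omega) hB
      refine ⟨by omega, ht, ?_, hb.restrict (by omega) le_rfl (by omega) hb.2.1⟩
      rw [Nat.div_eq_iff hB]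
      simp only [blockStart] at hmem
      omega
    · exact absurd (by simp [candidate, hg, ht]) h0
  · by_cases hg' : i / B % q = g
    · have e : candidate p m B q nx i g = nx i := by simp [candidate, hg']
      rw [e] at h0 ⊢
      have hs : blockStart B q i g = i / B * B := by
        rw [blockStart, ← hg', ← div_eq_superblock]
      have hle : i / B * B ≤ i := Nat.div_mul_le_self i B
      rcases h i hi with ⟨a, -⟩ | hb
      · exact absurd a h0
      · rw [add_mul, one_mul] at hb
        have := hb.1
        have := hb.2.1
        refine ⟨by omega, by omega, ?_, ?_⟩
        · rw [← hg', ← div_eq_superblock, Nat.div_eq_iff hB]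
          omega
        · rw [hs]
          exact hb.restrict (by omega) le_rfl (by omega) (by omega)
    · exact absurd (by simp [candidate, hg, hg']) h0

theorem candidate_lt (h : IsNextTable p m B nx) (hB : 0 < B) {i g : ℕ} (hi : i < m) :
    candidate p m B q nx i g < m := by
  by_cases h0 : candidate p m B q nx i g = 0
  · omega
  · exact (candidate_spec h hB hi h0).2.1

theorem beaten_le_one (w : ℕ → ℕ) (i g g' : ℕ) : beaten p w i g g' ≤ 1 := by
  rw [beaten]
  split_ifs <;> simp

/-- The best point `b` in the rest of the superblock is also best within its own block, hence a
candidate by uniqueness. It beats all other candidates and none beats it; how the others compare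
among themselves is irrelevant. -/
theorem winner_spec (hp : SortedTo p m) (h : IsNextTable p m B nx) (hB : 0 < B) (hq : 0 < q)
    {i : ℕ} (hi : i < m) :
    IsNext p i (min m ((i / (B * q) + 1) * (B * q)))
      (winner p q (candidate p m B q nx i) i) := by
  set w := candidate p m B q nx i with hw
  set E := min m ((i / (B * q) + 1) * (B * q)) with hE
  have hwE : ∀ g < q, w g ≠ 0 → i < w g ∧ w g < E := by
    intro g hg h0
    obtain ⟨a, b, c, -⟩ := candidate_spec h hB hi h0
    refine ⟨a, lt_min b ?_⟩
    have h1 : w g / B < (i / (B * q) + 1) * q := by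
      rw [c, add_mul, one_mul]; omega
    have h2 := Nat.lt_mul_div_succ (w g) hB
    calc w g < B * (w g / B + 1) := h2
      _ ≤ B * ((i / (B * q) + 1) * q) := Nat.mul_le_mul_left _ h1
      _ = (i / (B * q) + 1) * (B * q) := by ring
  by_cases hlast : E ≤ i + 1
  · left
    refine ⟨?_, hlast⟩
    rw [winner, ← Nat.bot_eq_zero, Finset.sup_eq_bot_iff]
    intro g hg
    rw [Finset.mem_range] at hg
    have : w g = 0 := by
      by_contra h0
      have := hwE g hg h0
      omega
    simp [this]
  · right
    obtain ⟨b, hb⟩ := exists_isBest p i (show i + 1 < E by omega)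
    have hbE := hb.2.1
    have hib := hb.1
    have hsup : b / (B * q) = i / (B * q) := by
      refine le_antisymm ?_ (Nat.div_le_div_right (by omega))
      rw [← Nat.lt_succ_iff]
      exact Nat.div_lt_of_lt_mul (by rw [mul_comm]; exact hbE.trans_le (min_le_right _ _))
    set g₀ := b / B % q with hg₀
    have hbB : b / B = i / (B * q) * q + g₀ := by rw [← hsup]; exact div_eq_superblock B q b
    have hg₀q : g₀ < q := Nat.mod_lt _ hq
    have hge : i / B % q ≤ g₀ := by
      have h1 : i / B ≤ b / B := Nat.div_le_div_right (by omega)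
      rw [div_eq_superblock B q i] at h1
      omega
    have hbs : blockStart B q i g₀ ≤ b ∧ b < blockStart B q i g₀ + B := by
      rw [blockStart, ← hbB]
      have := Nat.div_mul_le_self b B
      have := Nat.lt_mul_div_succ b hB
      rw [mul_add, mul_one, mul_comm] at this
      omega
    have hEb : min m (blockStart B q i g₀ + B) ≤ E := by
      refine min_le_min le_rfl ?_
      calc blockStart B q i g₀ + B = (i / (B * q) * q + (g₀ + 1)) * B := by
            rw [blockStart]; ring
        _ ≤ (i / (B * q) * q + q) * B := Nat.mul_le_mul_right _ (by omega)
        _ = (i / (B * q) + 1) * (B * q) := by ring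
    have hbm : b < m := hbE.trans_le (min_le_left _ _)
    have hwb : w g₀ = b := by
      rcases hge.eq_or_lt with heq | hlt
      · have e : w g₀ = nx i := by simp [hw, candidate, heq]
        have hs : blockStart B q i g₀ = i / B * B := by
          rw [blockStart, ← heq, ← div_eq_superblock]
        rw [e]
        rw [hs] at hbs hEb
        rcases h i hi with ⟨-, a⟩ | a
        · rw [add_mul, one_mul] at a
          omega
        · rw [add_mul, one_mul] at a
          exact a.unique (hb.restrict le_rfl hEb (by omega) (by omega))
      · have hbest := target_of_lt (p := p) (m := m) hlt (by omega) hB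
        have hbi := lt_blockStart hB hlt
        have e := hbest.unique (hb.restrict (by omega) hEb (by omega) (by omega))
        simp [hw, candidate, hlt, e, hbm]
    have hb0 : b ≠ 0 := by omega
    have hord : ∀ g < q, w g ≠ 0 → (g < g₀ → w g < b) ∧ (g₀ < g → b < w g) := by
      intro g hg h0
      have hc : w g / B = i / (B * q) * q + g := (candidate_spec h hB hi h0).2.2.1
      constructor
      · intro hlt
        by_contra hcon
        have := Nat.div_le_div_right (c := B) (not_lt.1 hcon)
        rw [hbB] at this
        omega
      · intro hlt
        by_contra hcon
        have := Nat.div_le_div_right (c := B) (not_lt.1 hcon)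
        rw [hbB] at this
        omega
    -- Candidates are ordered like their blocks. Asking whether the earlier one is strictly steeper,
    -- in both directions of the comparison, gives ties to the later one, as `IsBest` requires.
    have hcmp : ∀ g < q, g ≠ g₀ → w g ≠ 0 →
        (0 < orient (p i) (p (max b (w g))) (p (min b (w g))) ↔ g₀ < g) := by
      intro g hg hne h0
      obtain ⟨a1, a2⟩ := hwE g hg h0
      obtain ⟨o1, o2⟩ := hord g hg h0
      obtain ⟨c1, c2⟩ := hb.2.2 (w g) (by omega) a2
      have x1 := hp i b (by omega) hbm
      have x2 := hp i (w g) a1 (a2.trans_le (min_le_left _ _))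
      rcases lt_or_gt_of_ne hne with hlt | hgt
      · rw [max_eq_left (o1 hlt).le, min_eq_right (o1 hlt).le, orient_pos_iff x1 x2]
        constructor
        · intro; linarith
        · intro; omega
      · rw [max_eq_right (o2 hgt).le, min_eq_left (o2 hgt).le, orient_pos_iff x2 x1]
        exact ⟨fun _ => hgt, fun _ => c2 (o2 hgt)⟩
    have hwin : winner p q w i = b := by
      rw [winner]
      refine le_antisymm (Finset.sup_le fun g hg => ?_) ?_
      · rw [Finset.mem_range] at hg
        by_cases hgg : g = g₀
        · subst hgg
          rw [hwb]
          split_ifs <;> simp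
        · rw [if_neg]
          · simp
          · rintro ⟨h0, hsum⟩
            have h1 := Finset.sum_eq_zero_iff.1 hsum g₀ (by simpa using hg₀q)
            rw [beaten, if_pos] at h1
            · omega
            · refine ⟨h0, by rwa [hwb], hgg, ?_⟩
              rw [hwb, max_comm, min_comm]
              exact hcmp g hg hgg h0
      · have hz : ∑ g' ∈ Finset.range q, beaten p w i g₀ g' = 0 := by
          refine Finset.sum_eq_zero fun g hg => ?_
          rw [Finset.mem_range] at hg
          rw [beaten, if_neg]
          rintro ⟨-, h0, hne, hiff⟩
          rw [hwb, hcmp g hg hne.symm h0] at hiff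
          omega
        have := Finset.le_sup (f := fun g => if w g ≠ 0 ∧
          ∑ g' ∈ Finset.range q, beaten p w i g g' = 0 then w g else 0)
          (Finset.mem_range.2 hg₀q)
        simpa [hz, hwb, hb0] using this
    rw [hwin]
    exact hb

end

/-! ### Chaining rules -/

section

variable {m : ℕ} {X : Machine m} {inOp : Bool}

theorem Uses.next {c₁ c₂ : Cmd} {M : Memory} {u₁ u : ℕ} {Q₁ Q : Memory → Prop}
    (h₁ : Uses X inOp c₁ M u₁ Q₁) (hu : u₁ ≤ u)
    (h₂ : ∀ M', Q₁ M' → Uses X inOp c₂ M' (u - u₁) Q) : Uses X inOp (.seq c₁ c₂) M u Q :=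
  (h₁.seq h₂).mono (by omega) fun _ h => h

theorem uses_fill {n : Expr} {arr : ℕ} {e : Expr} {M : Memory} {u : ℕ} {Q : Memory → Prop}
    (hR : 0 < X.R) (k : ℕ) (f : ℕ → ℕ) (hk : n.eval M 0 = k)
    (hf : ∀ i < k, e.eval M i = f i) (hN : k ≤ X.N) (hw : ∀ i < k, f i < X.B) (hu : 1 ≤ u)
    (h : ∀ M', (∀ a, a ≠ arr → M' a = M a) → (∀ x < k, M' arr x = f x) → Q M') :
    Uses X inOp (par n arr e) M u Q := by
  refine (uses_par hR k f hk hf hN hw).mono hu ?_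
  rintro _ rfl
  exact h _ (fun a ha => fill_ne ha) fun x hx => fill_lt hx

theorem uses_fill_seq {n : Expr} {arr : ℕ} {e : Expr} {c : Cmd} {M : Memory} {u : ℕ}
    {Q : Memory → Prop} (hR : 0 < X.R) (k : ℕ) (f : ℕ → ℕ) (hk : n.eval M 0 = k)
    (hf : ∀ i < k, e.eval M i = f i) (hN : k ≤ X.N) (hw : ∀ i < k, f i < X.B) (hu : 1 ≤ u)
    (h : ∀ M', (∀ a, a ≠ arr → M' a = M a) → (∀ x < k, M' arr x = f x) →
      Uses X inOp c M' (u - 1) Q) :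
    Uses X inOp (.seq (par n arr e) c) M u Q := by
  refine (uses_par hR k f hk hf hN hw).next hu ?_
  rintro _ rfl
  exact h _ (fun a ha => fill_ne ha) fun x hx => fill_lt hx

end

/-- The numerical assumptions about a machine that runs the brute-force program with branching
number `q` and votes of `K * a` evaluations. -/
structure Machine.Fits {m : ℕ} (X : Machine m) (K q a : ℕ) : Prop where
  two_le : 2 ≤ m
  q_eq : q = 2 ^ a
  two_le_q : 2 ≤ q
  m_le : m ≤ q ^ 4
  procs : X.N = m * q * q
  votes : X.R = K * a
  a_le : a ≤ X.R
  votes_pos : 0 < X.R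
  votes_lt : X.R + 1 < X.B
  words : 8 * (m * q ^ 4) < X.B
  reliable : X.Reliable
  sorted : SortedTo (pt X.P) m

namespace Machine.Fits

variable {m : ℕ} {X : Machine m} {K q a : ℕ}

theorem pow_le (h : X.Fits K q a) : q ^ 4 ≤ m * q ^ 4 :=
  Nat.le_mul_of_pos_left _ (by have := h.two_le; omega)

theorem le_pow (h : X.Fits K q a) : m * q * q ≤ m * q ^ 4 := by
  have h1 : 1 ≤ q * q := Nat.mul_pos (by have := h.two_le_q; omega) (by have := h.two_le_q; omega)
  calc m * q * q = m * (q * q) * 1 := by ring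
    _ ≤ m * (q * q) * (q * q) := Nat.mul_le_mul_left _ h1
    _ = m * q ^ 4 := by ring

theorem mq_le (h : X.Fits K q a) : m * q ≤ m * q * q :=
  Nat.le_mul_of_pos_right _ (by have := h.two_le_q; omega)

theorem two_mul_le (h : X.Fits K q a) : 2 * m ≤ m * q := by
  rw [mul_comm]; exact Nat.mul_le_mul_left _ h.two_le_q

theorem clog_m (h : X.Fits K q a) : Nat.clog 2 m ≤ 4 * X.R := by
  refine (Nat.clog_le_of_le_pow (b := 2) (y := 4 * a) ?_).trans (by have := h.a_le; omega)
  calc m ≤ q ^ 4 := h.m_le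
    _ = 2 ^ (4 * a) := by rw [h.q_eq, ← pow_mul, mul_comm]

theorem clog_q (h : X.Fits K q a) : Nat.clog 2 q = a := by
  rw [h.q_eq, Nat.clog_pow _ _ (by norm_num)]

end Machine.Fits

/-! ### The table of hull vertices -/

/-- Compute the last hull vertex before every point from the table of successors. -/
def vertices : Cmd :=
  .seq (par (.const 1) aSize (scalar 0)) <|
  .seq (par (.const 1) aLimit (scalar 0)) <|
  .seq (par (scalar 0) aAcc (.read aNext .pid)) <|
  .seq (doubling .max) <|
  .seq (par (scalar 0) aAcc
    (.ite (.bin .lt .pid (.read aAcc (.pid - .const 1))) (.const 0) .pid)) <|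
  .seq (doubling .max)
  (par (scalar 0) aVertex (.read aAcc .pid))

theorem window_eq {m x : ℕ} (hx : x < m) :
    Finset.Icc (x + 1 - 2 ^ Nat.clog 2 m) x = Finset.Icc 0 x := by
  have := Nat.le_pow_clog (b := 2) (by norm_num) m
  congr 1
  omega

theorem sup_congr_Icc {f g : ℕ → ℕ} {x m : ℕ} (hx : x < m) (h : ∀ y < m, f y = g y) :
    (Finset.Icc 0 x).sup f = (Finset.Icc 0 x).sup g :=
  Finset.sup_congr rfl fun y hy => h y (by simp at hy; omega)

theorem uses_vertices {m : ℕ} {X : Machine m} {K q a B : ℕ} (hX : X.Fits K q a) (M : Memory)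
    (h0 : M 0 0 = m) (hnx : IsNextTable (pt X.P) m B (M aNext)) :
    Uses X true vertices M 50 fun M' =>
      (∀ a ∉ [aSize, aLimit, aWidth, aAcc, aVertex], M' a = M a) ∧
      ∀ j < m, M' aVertex j = lastVertex (M aNext) j := by
  have hR := hX.votes_pos
  have hm := hX.two_le
  have e1 := hX.two_mul_le
  have e2 := hX.mq_le
  have e3 := hX.le_pow
  have e4 := hX.words
  have hN := hX.procs
  have hcl := hX.clog_m
  refine uses_fill_seq hR 1 (fun _ => m) (by simp) (by simp [h0]) (by omega)
    (by intros; omega) (by norm_num) ?_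
  intro M1 f1 v1
  refine uses_fill_seq hR 1 (fun _ => m) (by simp) (by simp [f1, h0]) (by omega)
    (by intros; omega) (by norm_num) ?_
  intro M2 f2 v2
  refine uses_fill_seq hR m (M aNext) (by simp [f2, f1, h0]) (by simp [f2, f1]) (by omega)
    (fun i hi => (hnx.lt hi).trans (by omega)) (by norm_num) ?_
  intro M3 f3 v3
  refine (uses_prefixMax M3 m m hR (by omega) (by omega) (by simp [f3, f2, v1]) (by simp [f3, v2])
    hcl (by omega) (by omega) (fun x hx => ?_)).next (by norm_num) ?_
  · rw [v3 x hx]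
    exact (hnx.lt hx).trans (by omega)
  rintro M4 ⟨f4, v4⟩
  have v4' : ∀ x < m, M4 aAcc x = (Finset.Icc 0 x).sup (M aNext) := by
    intro x hx
    rw [v4 x hx, window_eq hx, sup_congr_Icc hx v3]
  -- The preceding cell holds the largest pointer from before `y`. Processor 0 reads its own cell by
  -- truncation and writes 0 in either case.
  refine uses_fill_seq hR m (fun y => if y < (Finset.Icc 0 (y - 1)).sup (M aNext) then 0 else y)
    (by simp [f4, f3, f2, f1, h0]) ?_ (by omega) ?_ (by norm_num) ?_
  · intro i hi
    simp [v4' (i - 1) (by omega)]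
  · intro i hi
    split_ifs <;> omega
  intro M5 f5 v5
  refine (uses_prefixMax M5 m m hR (by omega) (by omega) (by simp [f5, f4, f3, f2, v1])
    (by simp [f5, f4, f3, v2]) hcl (by omega) (by omega) (fun x hx => ?_)).next (by norm_num) ?_
  · rw [v5 x hx]
    split_ifs <;> omega
  rintro M6 ⟨f6, v6⟩
  have v6' : ∀ x < m, M6 aAcc x = lastVertex (M aNext) x := by
    intro x hx
    rw [v6 x hx, window_eq hx, sup_congr_Icc hx v5, lastVertex]
  refine uses_fill hR m (lastVertex (M aNext)) (by simp [f6, f5, f4, f3, f2, f1, h0])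
    (by simpa using v6') (by omega) ?_ (by norm_num) ?_
  · intro i hi
    have : lastVertex (M aNext) i ≤ i := by
      rw [lastVertex, Finset.sup_le_iff]
      intro y hy
      simp only [Finset.mem_Icc] at hy
      split_ifs <;> omega
    omega
  intro M7 f7 v7
  refine ⟨fun a ha => ?_, v7⟩
  simp at ha
  simp [f7, f6, f5, f4, f3, f2, f1, ha]

/-! ### The search for tangent points -/

/-- The position tested by processor `pid`. -/
def probe : Expr :=
  .read aPos (.pid / scalar aQ) + (.pid % scalar aQ + .const 1) * scalar aStride - .const 1

/-- One round of the search for all tangent points. -/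
def searchRound (K : ℕ) : Cmd :=
  .seq (par (.const 1) aStride (scalar aStride / scalar aQ)) <|
  .seq (par (scalar aSize) aTrd
    (.ite (.bin .lt probe (scalar 0)) (.read aVertex probe) (.const 0))) <|
  .seq (par (scalar aSize) aSnd (.read aNext (.read aTrd .pid))) <|
  .seq (par (scalar aSize) aFst (.pid / (scalar aQ * scalar aQ))) <|
  .seq (vote K) <|
  .seq (par (scalar aSize) aAcc
    (.ite (.bin .lt (.read aFst .pid / scalar aBlock % scalar aQ) (.pid / scalar aQ % scalar aQ))
      (.ite (.bin .lt probe (scalar 0))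
        (.ite (.read aSnd .pid) (.ite (.read aVotes .pid) (.const 0) (.const 1)) (.const 0))
        (.const 0))
      (.const 0))) <|
  .seq (doubling (· + ·))
  (par (scalar 0 * scalar aQ) aPos (.read aPos .pid +
    scalar aStride * .read aAcc (.pid * scalar aQ + (scalar aQ - .const 1))))

/-- As `q` is a power of two, the doubling windows have width exactly `q`, so the last cell of a row
ends up with the fold of that row. -/
theorem window_row {q a : ℕ} (hq : q = 2 ^ a) (x : ℕ) :
    Finset.Icc (x * q + (q - 1) + 1 - 2 ^ Nat.clog 2 q) (x * q + (q - 1)) =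
      (Finset.range q).image fun c => x * q + c := by
  have h1 : 2 ^ Nat.clog 2 q = q := by rw [hq, Nat.clog_pow _ _ (by norm_num)]
  have h2 : 0 < q := by rw [hq]; positivity
  rw [h1]
  ext y
  simp only [Finset.mem_Icc, Finset.mem_image, Finset.mem_range]
  constructor
  · rintro ⟨h3, h4⟩
    exact ⟨y - x * q, by omega, by omega⟩
  · rintro ⟨c, hc, rfl⟩
    omega

theorem sum_row {q a : ℕ} (hq : q = 2 ^ a) (x : ℕ) (f : ℕ → ℕ) :
    ∑ y ∈ Finset.Icc (x * q + (q - 1) + 1 - 2 ^ Nat.clog 2 q) (x * q + (q - 1)), f y =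
      ∑ c ∈ Finset.range q, f (x * q + c) := by
  rw [window_row hq, Finset.sum_image]
  intro c _ d _ h
  simpa using h

theorem sup_row {q a : ℕ} (hq : q = 2 ^ a) (x : ℕ) (f : ℕ → ℕ) :
    (Finset.Icc (x * q + (q - 1) + 1 - 2 ^ Nat.clog 2 q) (x * q + (q - 1))).sup f =
      (Finset.range q).sup fun c => f (x * q + c) := by
  rw [window_row hq, Finset.sup_image]
  rfl

theorem row_lt {q x n c : ℕ} (hx : x < n) (hc : c < q) : x * q + c < n * q := by
  calc x * q + c < x * q + q := by omega
    _ = (x + 1) * q := by ring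
    _ ≤ n * q := Nat.mul_le_mul_right _ hx

theorem row_div {q x c : ℕ} (hc : c < q) : (x * q + c) / q = x := by
  rw [mul_comm, Nat.mul_add_div (by omega), Nat.div_eq_of_lt hc, add_zero]

theorem row_mod {q x c : ℕ} (hc : c < q) : (x * q + c) % q = c := by
  rw [mul_comm, Nat.mul_add_mod, Nat.mod_eq_of_lt hc]

/-- The memory in which the search takes place. -/
structure SearchMem {m : ℕ} (X : Machine m) (q a B : ℕ) (nx : ℕ → ℕ) (M : Memory) : Prop where
  pts : M 0 0 = m
  branching : M aQ 0 = q
  log : M aLog 0 = a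
  block : M aBlock 0 = B
  size : M aSize 0 = m * q * q
  limit : M aLimit 0 = q
  next : ∀ i < m, M aNext i = nx i
  vertex : ∀ i < m, M aVertex i = lastVertex nx i

/-- Processor `y` makes probe `y % q` in block `y / q % q` for point `y / (q * q)`. Probes beyond
the last point are directed to point 0, and meaningless votes are masked afterwards, so all
processors can vote together. -/
theorem uses_searchRound {m : ℕ} {X : Machine m} {K q a B st : ℕ} {nx pos : ℕ → ℕ}
    (hX : X.Fits K q a) (hnx : IsNextTable (pt X.P) m B nx) (M : Memory)
    (hM : SearchMem X q a B nx M) (hst : M aStride 0 = q * st) (hstB : st ≤ q ^ 4)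
    (hpos : ∀ x < m * q, M aPos x = pos x)
    (hposB : ∀ x < m * q, pos x + st * ∑ c ∈ Finset.range q, searchBit (pt X.P) m B q nx (x / q)
      (x % q) (pos x + (c + 1) * st - 1) < X.B) :
    Uses X true (searchRound K) M 50 fun M' =>
      (∀ a ∉ [aStride, aTrd, aSnd, aFst, aAnswer, aVotes, aRound, aAcc, aWidth, aPos],
        M' a = M a) ∧ M' aStride 0 = st ∧
      ∀ x < m * q, M' aPos x = pos x + st * ∑ c ∈ Finset.range q,
        searchBit (pt X.P) m B q nx (x / q) (x % q) (pos x + (c + 1) * st - 1) := by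
  have hR := hX.votes_pos
  have hm := hX.two_le
  have hq := hX.two_le_q
  have e1 := hX.two_mul_le
  have e2 := hX.mq_le
  have e3 := hX.le_pow
  have e4 := hX.words
  have e5 := hX.pow_le
  have e6 : q ≤ q ^ 4 := Nat.le_self_pow (by norm_num) q
  have hN := hX.procs
  obtain ⟨m0, mq, ma, mB, mS, mL, mN, mV⟩ := hM
  have hdiv : ∀ y < m * q * q, y / q < m * q := fun y hy =>
    Nat.div_lt_of_lt_mul (by rwa [mul_comm q])
  have hdiv2 : ∀ y < m * q * q, y / (q * q) < m := fun y hy =>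
    Nat.div_lt_of_lt_mul (by rw [mul_comm (q * q), ← mul_assoc]; exact hy)
  have hlv : ∀ j, lastVertex nx j ≤ j := by
    intro j
    rw [lastVertex, Finset.sup_le_iff]
    intro y hy
    simp only [Finset.mem_Icc] at hy
    split_ifs <;> omega
  set pr : ℕ → ℕ := fun y => pos (y / q) + (y % q + 1) * st - 1 with hpr
  set lv : ℕ → ℕ := fun y => if pr y < m then lastVertex nx (pr y) else 0 with hlvd
  have hlvm : ∀ y, lv y < m := by
    intro y
    have := hlv (pr y)
    simp only [hlvd]
    split_ifs <;> omega
  refine uses_fill_seq hR 1 (fun _ => st) (by simp)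
    (by simp [hst, mq, Nat.mul_div_cancel_left st (show 0 < q by omega)]) (by omega)
    (by intros; omega) (by norm_num) ?_
  intro M1 f1 v1
  have v1' := v1 0 (by norm_num)
  refine uses_fill_seq hR (m * q * q) lv (by simp [f1, mS]) ?_ hN.ge
    (fun i _ => (hlvm i).trans (by omega)) (by norm_num) ?_
  · intro y hy
    have h1 : probe.eval M1 y = pr y := by
      simp [probe, hpr, f1, v1', mq, hpos _ (hdiv y hy)]
    simp only [eval_ite, eval_lt, eval_read, h1, hlvd, eval_scalar, f1 0 (by norm_num), m0,
      eval_const, f1 29 (by norm_num)]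
    by_cases h : pr y < m
    · simp [h, mV _ h]
    · simp [h]
  intro M2 f2 v2
  refine uses_fill_seq hR (m * q * q) (fun y => nx (lv y)) (by simp [f2, f1, mS]) ?_ hN.ge
    (fun i _ => (hnx.lt (hlvm i)).trans (by omega)) (by norm_num) ?_
  · intro y hy
    simp [v2 y hy, f2, f1, mN _ (hlvm y)]
  intro M3 f3 v3
  refine uses_fill_seq hR (m * q * q) (fun y => y / (q * q)) (by simp [f3, f2, f1, mS])
    (by simp [f3, f2, f1, mq]) hN.ge (fun i hi => (hdiv2 i hi).trans (by omega)) (by norm_num) ?_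
  intro M4 f4 v4
  refine (uses_vote hX.reliable K (m * q * q) M4 (by simp [f4, f3, f2, f1, ma, hX.votes]) hR
    hX.votes_lt (by simp [f4, f3, f2, f1, mS]) (by omega) hN.ge).next (by norm_num) ?_
  rintro M5 ⟨f5, v5⟩
  have hbit : ∀ y < m * q * q, (if y / (q * q) / B % q < y / q % q then
      if pr y < m then if nx (lv y) ≠ 0 then
        if M5 aVotes y ≠ 0 then 0 else 1 else 0 else 0 else 0) =
      searchBit (pt X.P) m B q nx (y / q / q) (y / q % q) (pr y) := by
    intro y hy
    rw [v5 y hy, f4 aSnd (by norm_num), f4 aTrd (by norm_num), f3 aTrd (by norm_num), v4 y hy,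
      v3 y hy, v2 y hy, searchBit, Nat.div_div_eq_div_mul y q q]
    by_cases h1 : y / (q * q) / B % q < y / q % q
    · by_cases h2 : pr y < m
      · have h3 : lv y = lastVertex nx (pr y) := if_pos h2
        rw [h3, if_pos h1, if_pos h2]
        simp only [h1, h2, true_and]
        by_cases h4 : nx (lastVertex nx (pr y)) = 0
        · simp [h4]
        · by_cases h5 : 0 < orient (pt X.P (y / (q * q))) (pt X.P (nx (lastVertex nx (pr y))))
            (pt X.P (lastVertex nx (pr y)))
          · simp [h4, h5]
          · simp [h4, h5]
      · simp [h2]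
    · simp [h1]
  refine uses_fill_seq hR (m * q * q) (fun y => searchBit (pt X.P) m B q nx (y / q / q)
    (y / q % q) (pr y)) (by simp [f5, f4, f3, f2, f1, mS]) ?_ hN.ge ?_ (by norm_num) ?_
  · intro y hy
    have h1 : probe.eval M5 y = pr y := by
      simp [probe, hpr, f5, f4, f3, f2, f1, v1', mq, hpos _ (hdiv y hy)]
    rw [← hbit y hy]
    simp only [eval_ite, eval_lt, eval_read, h1, eval_scalar, eval_mod, eval_div, eval_pid,
      eval_const]
    simp [f5, f4, f3, f2, f1, v4 y hy, v3 y hy, mB, mq, m0]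
    by_cases h : M5 aVotes y = 0 <;> simp [h]
  · intro y _
    dsimp only [searchBit]
    split_ifs <;> omega
  intro M6 f6 v6
  refine (uses_prefixSum M6 (m * q * q) q hR (by omega) hN.ge
    (by simp [f6, f5, f4, f3, f2, f1, mS]) (by simp [f6, f5, f4, f3, f2, f1, mL])
    (by rw [hX.clog_q]; have := hX.a_le; omega) (by omega) (by omega) (by omega) ?_).next
    (by norm_num) ?_
  · intro x hx
    rw [v6 x hx, searchBit]
    split_ifs <;> omega
  rintro M7 ⟨f7, v7⟩
  have v7' : ∀ x < m * q, M7 aAcc (x * q + (q - 1)) = ∑ c ∈ Finset.range q,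
      searchBit (pt X.P) m B q nx (x / q) (x % q) (pos x + (c + 1) * st - 1) := by
    intro x hx
    rw [v7 _ (row_lt hx (by omega)), sum_row hX.q_eq]
    refine Finset.sum_congr rfl fun c hc => ?_
    rw [Finset.mem_range] at hc
    rw [v6 _ (row_lt hx hc)]
    simp only [hpr, row_div hc, row_mod hc]
  refine uses_fill hR (m * q) (fun x => pos x + st * ∑ c ∈ Finset.range q,
      searchBit (pt X.P) m B q nx (x / q) (x % q) (pos x + (c + 1) * st - 1))
    (by simp [f7, f6, f5, f4, f3, f2, f1, m0, mq]) ?_ (by omega) hposB (by norm_num) ?_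
  · intro x hx
    rw [← v7' x hx, ← hpos x hx]
    simp [f7, f6, f5, f4, f3, f2, f1, mq, v1']
  intro M8 f8 v8
  refine ⟨fun a ha => ?_, by simp [f8, f7, f6, f5, f4, f3, f2, v1'], v8⟩
  simp at ha
  simp [f8, f7, f6, f5, f4, f3, f2, f1, ha]

/-- The search for the tangent points from all points to all blocks of their superblocks. -/
def search (K : ℕ) : Cmd :=
  .seq (par (scalar 0 * scalar aQ) aPos
    ((.pid / scalar aQ / (scalar aBlock * scalar aQ) * scalar aQ + .pid % scalar aQ) *
      scalar aBlock)) <|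
  .seq (par (.const 1) aSize (scalar 0 * scalar aQ * scalar aQ)) <|
  .seq (par (.const 1) aLimit (scalar aQ)) <|
  .seq (par (.const 1) aStride (scalar aBlock))
  (.loop (.bin .lt (.const 1) (scalar aStride)) (searchRound K))

/-- Empty blocks beyond the last point are searched as well; this bound keeps their positions below
the word limit. -/
theorem blockStart_le {B q i g : ℕ} (hg : g ≤ q) : blockStart B q i g ≤ i + q * B := by
  have := Nat.div_mul_le_self i (B * q)
  calc blockStart B q i g = i / (B * q) * (B * q) + g * B := by rw [blockStart]; ring
    _ ≤ i + q * B := add_le_add this (Nat.mul_le_mul_right _ hg)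

/-- After `r` rounds the target lies in the interval of length `q ^ (k - r)` that begins at the
stored position and stays within the block. For `k = 0` no round is needed, as a block is a single
point. -/
theorem uses_search {m : ℕ} {X : Machine m} {K q a k : ℕ} {nx : ℕ → ℕ}
    (hX : X.Fits K q a) (hk : k ≤ 3) (hnx : IsNextTable (pt X.P) m (q ^ k) nx) (M : Memory)
    (m0 : M 0 0 = m) (mq : M aQ 0 = q) (ma : M aLog 0 = a) (mB : M aBlock 0 = q ^ k)
    (mN : ∀ i < m, M aNext i = nx i) (mV : ∀ i < m, M aVertex i = lastVertex nx i) :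
    Uses X true (search K) M 160 fun M' =>
      (∀ a ∉ [aSize, aLimit, aStride, aTrd, aSnd, aFst, aAnswer, aVotes, aRound, aAcc, aWidth,
        aPos], M' a = M a) ∧ M' aSize 0 = m * q * q ∧ M' aLimit 0 = q ∧
      ∀ x < m * q, M' aPos x = target (pt X.P) m (q ^ k) q (x / q) (x % q) := by
  have hR := hX.votes_pos
  have hm := hX.two_le
  have hq := hX.two_le_q
  have e1 := hX.two_mul_le
  have e2 := hX.mq_le
  have e3 := hX.le_pow
  have e4 := hX.words
  have e5 := hX.pow_le
  have e6 : q ≤ q ^ 4 := Nat.le_self_pow (by norm_num) q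
  have hN := hX.procs
  have hq0 : 0 < q := by omega
  have hqk : ∀ j ≤ 4, q ^ j ≤ q ^ 4 := fun j hj => Nat.pow_le_pow_right hq0 hj
  have hB0 : 0 < q ^ k := by positivity
  have hdiv : ∀ x < m * q, x / q < m := fun x hx => Nat.div_lt_of_lt_mul (by rwa [mul_comm])
  have hqB : q * q ^ k ≤ q ^ 4 := by rw [← pow_succ']; exact hqk _ (by omega)
  have hm4 : m ≤ m * q ^ 4 := by omega
  have hbs : ∀ x < m * q, blockStart (q ^ k) q (x / q) (x % q) + q ^ k < X.B := by
    intro x hx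
    have h1 := blockStart_le (B := q ^ k) (i := x / q) (Nat.mod_lt x hq0).le
    have h2 := hdiv x hx
    have h3 := hqk k (by omega)
    omega
  refine uses_fill_seq hR (m * q) (fun x => blockStart (q ^ k) q (x / q) (x % q))
    (by simp [m0, mq]) (by simp [blockStart, mq, mB]) (by omega)
    (fun x hx => by have := hbs x hx; omega) (by norm_num) ?_
  intro M1 f1 v1
  refine uses_fill_seq hR 1 (fun _ => m * q * q) (by simp) (by simp [f1, m0, mq]) (by omega)
    (fun x hx => by omega) (by norm_num) ?_
  intro M2 f2 v2
  refine uses_fill_seq hR 1 (fun _ => q) (by simp) (by simp [f2, f1, mq]) (by omega)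
    (fun x hx => by omega) (by norm_num) ?_
  intro M3 f3 v3
  refine uses_fill_seq hR 1 (fun _ => q ^ k) (by simp) (by simp [f3, f2, f1, mB]) (by omega)
    (fun x hx => by have := hqk k (by omega); omega) (by norm_num) ?_
  intro M4 f4 v4
  have hloop := Uses.loop (X := X) (inOp := true) (b := .bin .lt (.const 1) (scalar aStride))
    (c := searchRound K) (M := M4) (u := 50) (by omega) hR
    (fun r M' => r ≤ k ∧ (∀ a ∉ [aStride, aTrd, aSnd, aFst, aAnswer, aVotes, aRound, aAcc, aWidth,
        aPos], M' a = M4 a) ∧ M' aStride 0 = q ^ (k - r) ∧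
      ∀ x < m * q, blockStart (q ^ k) q (x / q) (x % q) ≤ M' aPos x ∧
        M' aPos x + q ^ (k - r) ≤ blockStart (q ^ k) q (x / q) (x % q) + q ^ k ∧
        M' aPos x ≤ target (pt X.P) m (q ^ k) q (x / q) (x % q) ∧
        target (pt X.P) m (q ^ k) q (x / q) (x % q) < M' aPos x + q ^ (k - r)) k
    ⟨by omega, fun _ _ => rfl, by simp [v4], fun x hx => by
      have h1 : M4 aPos x = blockStart (q ^ k) q (x / q) (x % q) := by
        simp [f4, f3, f2, v1 x hx]
      have := target_mem (p := pt X.P) (m := m) (q := q) hB0 (x / q) (x % q)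
      rw [h1]
      simpa using this⟩
    (by
      rintro r hr M' ⟨-, hf, hs, hpos⟩
      have hkr : k - r = (k - (r + 1)) + 1 := by omega
      refine ⟨?_, ?_⟩
      · have : 1 < q ^ (k - r) := Nat.one_lt_pow (by omega) (by omega)
        simp [hs, this]
      · rw [hkr, pow_succ'] at hs hpos
        set st := q ^ (k - (r + 1)) with hst
        have hst0 : 0 < st := by positivity
        have hround : ∀ x < m * q, _ := fun x hx =>
          search_round hX.sorted hnx hB0 (i := x / q) (g := x % q) (pos := M' aPos x) hst0
            (hpos x hx).1 (hpos x hx).2.1 (hpos x hx).2.2.1 (hpos x hx).2.2.2 _ rfl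
        refine (uses_searchRound hX hnx M' (pos := M' aPos) (st := st) ?_ hs
          (hqk _ (by omega)) (fun _ _ => rfl) ?_).mono le_rfl ?_
        · refine ⟨?_, ?_, ?_, ?_, ?_, ?_, ?_, ?_⟩
          · simp [hf, f4, f3, f2, f1, m0]
          · simp [hf, f4, f3, f2, f1, mq]
          · simp [hf, f4, f3, f2, f1, ma]
          · simp [hf, f4, f3, f2, f1, mB]
          · simp [hf, f4, f3, v2]
          · simp [hf, f4, v3]
          · simpa [hf, f4, f3, f2, f1] using mN
          · simpa [hf, f4, f3, f2, f1] using mV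
        · intro x hx
          have := hround x hx
          have := hbs x hx
          omega
        · rintro M'' ⟨g1, g2, g3⟩
          refine ⟨hr, fun a ha => by rw [g1 a ha, hf a ha], g2, fun x hx => ?_⟩
          rw [g3 x hx]
          exact hround x hx)
    (by
      rintro M' ⟨-, -, hs, -⟩
      simp [hs])
  refine hloop.mono (by omega) ?_
  rintro M' ⟨-, hf, hs, hpos⟩
  refine ⟨fun a ha => ?_, by simp [hf, f4, f3, v2], by simp [hf, f4, v3], fun x hx => ?_⟩
  · simp at ha
    simp [hf, f4, f3, f2, f1, ha]
  · have := hpos x hx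
    simp at this
    omega

/-! ### The choice among the candidates -/

/-- The candidate of the other block that processor `pid` considers. -/
def rival : Expr :=
  .read aCand (.pid / (scalar aQ * scalar aQ) * scalar aQ + .pid % scalar aQ)

/-- The choice of the best candidate for the successor of every point. -/
def select (K : ℕ) : Cmd :=
  .seq (par (scalar 0 * scalar aQ) aCand
    (.ite (.bin .lt (.pid / scalar aQ / scalar aBlock % scalar aQ) (.pid % scalar aQ))
      (.ite (.bin .lt (.read aPos .pid) (scalar 0)) (.read aPos .pid) (.const 0))
      (.ite (.bin .eq (.pid / scalar aQ / scalar aBlock % scalar aQ) (.pid % scalar aQ))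
        (.read aNext (.pid / scalar aQ)) (.const 0)))) <|
  .seq (par (scalar aSize) aFst (.pid / (scalar aQ * scalar aQ))) <|
  .seq (par (scalar aSize) aSnd (.max (.read aCand (.pid / scalar aQ)) rival)) <|
  .seq (par (scalar aSize) aTrd (.min (.read aCand (.pid / scalar aQ)) rival)) <|
  .seq (vote K) <|
  .seq (par (scalar aSize) aAcc
    (.ite (.read aCand (.pid / scalar aQ))
      (.ite rival
        (.ite (.bin .eq (.pid / scalar aQ % scalar aQ) (.pid % scalar aQ)) (.const 0)
          (.bin .eq (.read aVotes .pid)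
            (.bin .lt (.pid % scalar aQ) (.pid / scalar aQ % scalar aQ))))
        (.const 0))
      (.const 0))) <|
  .seq (doubling (· + ·)) <|
  .seq (par (.const 1) aSize (scalar 0 * scalar aQ)) <|
  .seq (par (scalar aSize) aAcc
    (.ite (.read aAcc (.pid * scalar aQ + (scalar aQ - .const 1))) (.const 0)
      (.read aCand .pid))) <|
  .seq (doubling .max) <|
  .seq (par (scalar 0) aNext (.read aAcc (.pid * scalar aQ + (scalar aQ - .const 1))))
  (par (.const 1) aBlock (scalar aBlock * scalar aQ))

/-- The form that the program computes: an absent candidate contributes 0 with or without the test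
`w g ≠ 0`. -/
theorem winner_eq (p : ℕ → ℝ × ℝ) (q : ℕ) (w : ℕ → ℕ) (i : ℕ) :
    winner p q w i = (Finset.range q).sup fun g =>
      if ∑ g' ∈ Finset.range q, beaten p w i g g' ≠ 0 then 0 else w g := by
  rw [winner]
  refine Finset.sup_congr rfl fun g _ => ?_
  by_cases h : ∑ g' ∈ Finset.range q, beaten p w i g g' = 0
  · by_cases h0 : w g = 0 <;> simp [h, h0]
  · simp only [h, and_false, if_false, ne_eq, not_false_eq_true, if_true]

/-- All `q * q` ordered pairs of candidates of a point are compared at once. Sums over rows count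
the defeats, and a maximum over the candidates, with the beaten ones set to 0, leaves the winner. -/
theorem uses_select {m : ℕ} {X : Machine m} {K q a B : ℕ} {nx : ℕ → ℕ}
    (hX : X.Fits K q a) (hB0 : 0 < B) (hB4 : B * q ≤ q ^ 4)
    (hnx : IsNextTable (pt X.P) m B nx) (M : Memory)
    (m0 : M 0 0 = m) (mq : M aQ 0 = q) (ma : M aLog 0 = a) (mB : M aBlock 0 = B)
    (mS : M aSize 0 = m * q * q) (mL : M aLimit 0 = q)
    (mN : ∀ i < m, M aNext i = nx i)
    (mP : ∀ x < m * q, M aPos x = target (pt X.P) m B q (x / q) (x % q)) :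
    Uses X true (select K) M 80 fun M' =>
      (∀ a ∉ [aCand, aFst, aSnd, aTrd, aAnswer, aVotes, aRound, aAcc, aWidth, aSize, aNext,
        aBlock], M' a = M a) ∧ M' aBlock 0 = B * q ∧
      ∀ i < m, M' aNext i = winner (pt X.P) q (candidate (pt X.P) m B q nx i) i := by
  have hR := hX.votes_pos
  have hm := hX.two_le
  have hq := hX.two_le_q
  have e1 := hX.two_mul_le
  have e2 := hX.mq_le
  have e3 := hX.le_pow
  have e4 := hX.words
  have e5 := hX.pow_le
  have e6 : q ≤ q ^ 4 := Nat.le_self_pow (by norm_num) q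
  have hN := hX.procs
  have hq0 : 0 < q := by omega
  have hdiv : ∀ x < m * q, x / q < m := fun x hx => Nat.div_lt_of_lt_mul (by rwa [mul_comm])
  have hdiv1 : ∀ y < m * q * q, y / q < m * q := fun y hy =>
    Nat.div_lt_of_lt_mul (by rwa [mul_comm q])
  have hdiv2 : ∀ y < m * q * q, y / (q * q) < m := fun y hy =>
    Nat.div_lt_of_lt_mul (by rw [mul_comm (q * q), ← mul_assoc]; exact hy)
  set p := pt X.P with hp
  set cd : ℕ → ℕ → ℕ := candidate p m B q nx with hcd
  have hcdm : ∀ i < m, ∀ g, cd i g < m := fun i hi g => candidate_lt hnx hB0 hi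
  refine uses_fill_seq hR (m * q) (fun x => cd (x / q) (x % q)) (by simp [m0, mq]) ?_ (by omega)
    (fun x hx => (hcdm _ (hdiv x hx) _).trans (by omega)) (by norm_num) ?_
  · intro x hx
    simp only [hcd, candidate, eval_ite, eval_lt, eval_eq, eval_mod, eval_div, eval_pid,
      eval_scalar, eval_read, eval_const, m0, mq, mB, mP x hx, mN _ (hdiv x hx)]
    split_ifs <;> simp_all
  intro M1 f1 v1
  refine uses_fill_seq hR (m * q * q) (fun y => y / (q * q)) (by simp [f1, mS])
    (by simp [f1, mq]) hN.ge (fun i hi => (hdiv2 i hi).trans (by omega)) (by norm_num) ?_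
  intro M2 f2 v2
  have hown : ∀ y < m * q * q, M1 aCand (y / q) = cd (y / (q * q)) (y / q % q) := by
    intro y hy
    rw [v1 _ (hdiv1 y hy), Nat.div_div_eq_div_mul]
  have hriv : ∀ y < m * q * q, M1 aCand (y / (q * q) * q + y % q) =
      cd (y / (q * q)) (y % q) := by
    intro y hy
    have h1 := Nat.mod_lt y hq0
    rw [v1 _ (row_lt (hdiv2 y hy) h1), row_div h1, row_mod h1]
  refine uses_fill_seq hR (m * q * q)
    (fun y => max (cd (y / (q * q)) (y / q % q)) (cd (y / (q * q)) (y % q)))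
    (by simp [f2, f1, mS]) ?_ hN.ge ?_ (by norm_num) ?_
  · intro y hy
    simp [rival, f2, f1, mq, hown y hy, hriv y hy]
  · intro y hy
    have h1 := hcdm _ (hdiv2 y hy) (y / q % q)
    have h2 := hcdm _ (hdiv2 y hy) (y % q)
    omega
  intro M3 f3 v3
  refine uses_fill_seq hR (m * q * q)
    (fun y => min (cd (y / (q * q)) (y / q % q)) (cd (y / (q * q)) (y % q)))
    (by simp [f3, f2, f1, mS]) ?_ hN.ge ?_ (by norm_num) ?_
  · intro y hy
    simp [rival, f3, f2, f1, mq, hown y hy, hriv y hy]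
  · intro y hy
    have h1 := hcdm _ (hdiv2 y hy) (y / q % q)
    have h2 := hcdm _ (hdiv2 y hy) (y % q)
    omega
  intro M4 f4 v4
  refine (uses_vote hX.reliable K (m * q * q) M4 (by simp [f4, f3, f2, f1, ma, hX.votes]) hR
    hX.votes_lt (by simp [f4, f3, f2, f1, mS]) (by omega) hN.ge).next (by norm_num) ?_
  rintro M5 ⟨f5, v5⟩
  have v5' : ∀ y < m * q * q, M5 aVotes y = if 0 < orient (p (y / (q * q)))
      (p (max (cd (y / (q * q)) (y / q % q)) (cd (y / (q * q)) (y % q))))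
      (p (min (cd (y / (q * q)) (y / q % q)) (cd (y / (q * q)) (y % q)))) then 1 else 0 := by
    intro y hy
    rw [v5 y hy, v4 y hy, f4 aSnd (by norm_num), v3 y hy, f4 aFst (by norm_num),
      f3 aFst (by norm_num), v2 y hy]
  refine uses_fill_seq hR (m * q * q)
    (fun y => beaten p (cd (y / (q * q))) (y / (q * q)) (y / q % q) (y % q))
    (by simp [f5, f4, f3, f2, f1, mS]) ?_ hN.ge ?_ (by norm_num) ?_
  · intro y hy
    have h1 : M5 aCand (y / q) = cd (y / (q * q)) (y / q % q) := by
      simp [f5, f4, f3, f2, hown y hy]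
    have h2 : rival.eval M5 y = cd (y / (q * q)) (y % q) := by
      simp [rival, f5, f4, f3, f2, f1, mq, hriv y hy]
    have h3 : M5 aQ 0 = q := by simp [f5, f4, f3, f2, f1, mq]
    simp only [eval_ite, eval_eq, eval_lt, eval_read, eval_div, eval_mod, eval_pid, eval_scalar,
      eval_const, h2, h3, h1, v5' y hy, beaten]
    by_cases c1 : cd (y / (q * q)) (y / q % q) = 0
    · simp [c1]
    by_cases c2 : cd (y / (q * q)) (y % q) = 0
    · simp [c2]
    by_cases c3 : y / q % q = y % q
    · simp [c3]
    by_cases c4 : y % q < y / q % q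
    · by_cases c5 : 0 < orient (p (y / (q * q)))
        (p (max (cd (y / (q * q)) (y / q % q)) (cd (y / (q * q)) (y % q))))
        (p (min (cd (y / (q * q)) (y / q % q)) (cd (y / (q * q)) (y % q))))
      · simp [c1, c2, c3, c4, c5]
      · simp [c1, c2, c3, c4, c5]
    · by_cases c5 : 0 < orient (p (y / (q * q)))
        (p (max (cd (y / (q * q)) (y / q % q)) (cd (y / (q * q)) (y % q))))
        (p (min (cd (y / (q * q)) (y / q % q)) (cd (y / (q * q)) (y % q))))
      · simp [c1, c2, c3, c4, c5]
      · simp [c1, c2, c3, c4, c5]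
  · intro y _
    exact (beaten_le_one _ _ _ _).trans_lt (by omega)
  intro M6 f6 v6
  refine (uses_prefixSum M6 (m * q * q) q hR (by omega) hN.ge
    (by simp [f6, f5, f4, f3, f2, f1, mS]) (by simp [f6, f5, f4, f3, f2, f1, mL])
    (by rw [hX.clog_q]; have := hX.a_le; omega) (by omega) (by omega) (by omega) ?_).next
    (by norm_num) ?_
  · intro x hx
    rw [v6 x hx]
    exact beaten_le_one _ _ _ _
  rintro M7 ⟨f7, v7⟩
  have v7' : ∀ x < m * q, M7 aAcc (x * q + (q - 1)) = ∑ g' ∈ Finset.range q,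
      beaten p (cd (x / q)) (x / q) (x % q) g' := by
    intro x hx
    rw [v7 _ (row_lt hx (by omega)), sum_row hX.q_eq]
    refine Finset.sum_congr rfl fun c hc => ?_
    rw [Finset.mem_range] at hc
    rw [v6 _ (row_lt hx hc), ← Nat.div_div_eq_div_mul, row_div hc, row_mod hc]
  refine uses_fill_seq hR 1 (fun _ => m * q) (by simp)
    (by simp [f7, f6, f5, f4, f3, f2, f1, m0, mq]) (by omega) (fun x hx => by omega)
    (by norm_num) ?_
  intro M8 f8 v8
  refine uses_fill_seq hR (m * q) (fun x => if ∑ g' ∈ Finset.range q,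
      beaten p (cd (x / q)) (x / q) (x % q) g' ≠ 0 then 0 else cd (x / q) (x % q))
    (by simp [v8]) ?_ (by omega) ?_ (by norm_num) ?_
  · intro x hx
    have h1 : M8 aCand x = cd (x / q) (x % q) := by
      simp [f8, f7, f6, f5, f4, f3, f2, v1 x hx]
    have h3 : M8 aQ 0 = q := by simp [f8, f7, f6, f5, f4, f3, f2, f1, mq]
    rw [← v7' x hx]
    simp only [eval_ite, eval_read, eval_add, eval_mul, eval_pid, eval_scalar, eval_sub,
      eval_const, h1, h3, f8 aAcc (by norm_num)]
  · intro x hx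
    have := hcdm _ (hdiv x hx) (x % q)
    split_ifs <;> omega
  intro M9 f9 v9
  refine (uses_prefixMax M9 (m * q) q hR (by omega) (by omega) (by simp [f9, v8])
    (by simp [f9, f8, f7, f6, f5, f4, f3, f2, f1, mL])
    (by rw [hX.clog_q]; have := hX.a_le; omega) (by omega) (by omega) ?_).next
    (by norm_num) ?_
  · intro x hx
    have := hcdm _ (hdiv x hx) (x % q)
    rw [v9 x hx]
    split_ifs <;> omega
  rintro M10 ⟨f10, v10⟩
  have v10' : ∀ i < m, M10 aAcc (i * q + (q - 1)) = winner p q (cd i) i := by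
    intro i hi
    rw [v10 _ (row_lt hi (by omega)), sup_row hX.q_eq, winner_eq]
    refine Finset.sup_congr rfl fun g hg => ?_
    rw [Finset.mem_range] at hg
    rw [v9 _ (row_lt hi hg), row_div hg, row_mod hg]
  have h10q : M10 aQ 0 = q := by simp [f10, f9, f8, f7, f6, f5, f4, f3, f2, f1, mq]
  refine uses_fill_seq hR m (fun i => winner p q (cd i) i)
    (by simp [f10, f9, f8, f7, f6, f5, f4, f3, f2, f1, m0]) ?_ (by omega) ?_ (by norm_num) ?_
  · intro i hi
    simp [h10q, v10' i hi]
  · intro i hi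
    have h1 : winner p q (cd i) i ≤ m := by
      rw [winner, Finset.sup_le_iff]
      intro g _
      have := hcdm i hi g
      split_ifs <;> omega
    omega
  intro M11 f11 v11
  refine uses_fill hR 1 (fun _ => B * q) (by simp)
    (by simp [f11, h10q, f10, f9, f8, f7, f6, f5, f4, f3, f2, f1, mB]) (by omega)
    (fun x hx => by omega) (by norm_num) ?_
  intro M12 f12 v12
  refine ⟨fun a ha => ?_, v12 0 (by norm_num), fun i hi => by rw [f12 _ (by norm_num), v11 i hi]⟩
  simp at ha
  simp [f12, f11, f10, f9, f8, f7, f6, f5, f4, f3, f2, f1, ha]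

/-! ### The branching number -/

/-- Compute the least power of two whose fourth power is at least `m`, and its logarithm. -/
def setup : Cmd :=
  .seq (par (.const 1) aQ (.const 1)) <|
  .seq (par (.const 1) aLog (.const 0)) <|
  .loop (.bin .lt (scalar aQ * scalar aQ * scalar aQ * scalar aQ) (scalar 0)) <|
  .seq (par (.const 1) aQ (scalar aQ + scalar aQ))
  (par (.const 1) aLog (scalar aLog + .const 1))

/-- For `q = 2 ^ k` the test `q ^ 4 < m` reads `16 ^ k < m`, so the loop runs `clog 16 m` times. -/
theorem uses_setup {m : ℕ} {X : Machine m} {inOp : Bool} {a : ℕ} (ha : a = Nat.clog 16 m)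
    (hR : 0 < X.R) (haR : a ≤ X.R) (hN : 0 < X.N) (hB : 2 * 2 ^ a < X.B)
    (M : Memory) (m0 : M 0 0 = m) :
    Uses X inOp setup M 6 fun M' =>
      (∀ a ∉ [aQ, aLog], M' a = M a) ∧ M' aQ 0 = 2 ^ a ∧ M' aLog 0 = a := by
  have h1 : 0 < 2 ^ a := by positivity
  have h2 : a < 2 ^ a := Nat.lt_two_pow_self
  refine Runs.mono (Runs.seq (runs_par _ _ _ (by simp; omega)) (T₂ := 3 * a + 2)
    (W₂ := 3 * a + 2) ?_) (by omega) ?_ fun _ h => h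
  · rintro _ rfl
    refine Runs.mono (Runs.seq (runs_par _ _ _ (by simp; omega)) (T₂ := 3 * a + 1)
      (W₂ := 3 * a + 1) ?_) (by omega) (by simp; omega) fun _ h => h
    rintro _ rfl
    refine Runs.mono (Runs.loop (T := 2) (W := 2)
      (fun k M' => (∀ a ∉ [aQ, aLog], M' a = M a) ∧ M' aQ 0 = 2 ^ k ∧ M' aLog 0 = k) a
      ?_ ?_ ?_) (by omega) (by omega) fun _ h => h
    · refine ⟨fun b hb => ?_, by simp [fill], by simp [fill]⟩
      simp at hb
      simp [fill_ne, hb]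
    · rintro k hk M' ⟨hf, hq, hl⟩
      have hk2 : 2 ^ (k + 1) ≤ 2 ^ a := Nat.pow_le_pow_right (by norm_num) hk
      have h16 : 16 ^ k < m := (Nat.lt_clog_iff_pow_lt (by norm_num)).1 (ha ▸ hk)
      have hM0 : M' 0 0 = m := by rw [hf 0 (by simp), m0]
      refine ⟨?_, ?_⟩
      · have : 2 ^ k * 2 ^ k * 2 ^ k * 2 ^ k < m := by
          rw [← mul_pow, ← mul_pow, ← mul_pow]
          exact h16
        simp [hq, hM0, this]
      · rw [pow_succ] at hk2
        refine Runs.mono (Runs.seq (runs_par _ _ _ (by simp [hq]; omega)) (T₂ := 1)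
          (W₂ := 1) ?_) le_rfl (by simp) fun _ h => h
        rintro _ rfl
        refine Runs.mono (runs_par _ _ _ (by simp [fill_ne, hl]; omega)) le_rfl (by simp) ?_
        rintro _ rfl
        refine ⟨fun b hb => ?_, ?_, by simp [fill, hl]⟩
        · have hb' := hb
          simp at hb
          simp [fill_ne, hb, hf b hb']
        · simp [fill, hq]
          ring
    · rintro M' ⟨hf, hq, hl⟩
      have hM0 : M' 0 0 = m := by rw [hf 0 (by simp), m0]
      have : m ≤ 2 ^ a * 2 ^ a * 2 ^ a * 2 ^ a := by
        rw [← mul_pow, ← mul_pow, ← mul_pow, ha]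
        exact Nat.le_pow_clog (by norm_num) m
      simp [hq, hM0, this]
  · have : X.R ≤ X.N * X.R := Nat.le_mul_of_pos_left _ hN
    simp
    omega

/-! ### The routine that finds all tangents -/

/-- Merge the blocks into blocks that are `q` times as large. -/
def level (K : ℕ) : Cmd := .seq vertices (.seq (search K) (select K))

theorem IsNextTable.congr {p : ℕ → ℝ × ℝ} {m B : ℕ} {nx nx' : ℕ → ℕ} (h : IsNextTable p m B nx)
    (he : ∀ i < m, nx' i = nx i) : IsNextTable p m B nx' := by
  intro i hi
  rw [he i hi]
  exact h i hi

theorem uses_level {m : ℕ} {X : Machine m} {K q a k : ℕ} (hX : X.Fits K q a) (hk : k ≤ 3)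
    (M : Memory) (m0 : M 0 0 = m) (mq : M aQ 0 = q) (ma : M aLog 0 = a)
    (mB : M aBlock 0 = q ^ k) (hnx : IsNextTable (pt X.P) m (q ^ k) (M aNext)) :
    Uses X true (level K) M 290 fun M' =>
      M' 0 0 = m ∧ M' aQ 0 = q ∧ M' aLog 0 = a ∧ M' aBlock 0 = q ^ (k + 1) ∧
        IsNextTable (pt X.P) m (q ^ (k + 1)) (M' aNext) := by
  have hq := hX.two_le_q
  have hB0 : 0 < q ^ k := by positivity
  refine (uses_vertices hX M m0 hnx).next (by norm_num) ?_
  rintro M1 ⟨f1, v1⟩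
  refine (uses_search hX hk hnx M1 (by simp [f1, m0]) (by simp [f1, mq]) (by simp [f1, ma])
    (by simp [f1, mB]) (by simp [f1]) v1).next (by norm_num) ?_
  rintro M2 ⟨f2, s2, l2, v2⟩
  refine (uses_select hX hB0 ?_ hnx M2 (by simp [f2, f1, m0]) (by simp [f2, f1, mq])
    (by simp [f2, f1, ma]) (by simp [f2, f1, mB]) s2 l2 (by simp [f2, f1]) v2).mono
    (by norm_num) ?_
  · rw [← pow_succ]
    exact Nat.pow_le_pow_right (by omega) (by omega)
  rintro M3 ⟨f3, b3, v3⟩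
  refine ⟨by simp [f3, f2, f1, m0], by simp [f3, f2, f1, mq], by simp [f3, f2, f1, ma],
    by rw [b3, pow_succ], IsNextTable.congr (nx := fun i => winner (pt X.P) q
      (candidate (pt X.P) m (q ^ k) q (M aNext) i) i) (fun i hi => ?_) v3⟩
  have := winner_spec (q := q) hX.sorted hnx hB0 (by omega) hi
  rwa [← pow_succ] at this

/-- Find the upper tangents from all points to the sets of the points to the right of them. -/
def findTangents (K : ℕ) : Cmd :=
  .seq setup <|
  .seq (par (.const 1) aBlock (.const 1)) <|
  .seq (.loop (.bin .lt (scalar aBlock) (scalar aQ * scalar aQ * scalar aQ * scalar aQ))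
    (level K))
  (par (.const 2 * scalar 0) aOut (.ite (.pid % .const 2)
    (.read aNext (.pid / .const 2) - (.pid / .const 2 + .const 1)) (.const 0)))

theorem uses_findTangents {m : ℕ} {X : Machine m} {K q a : ℕ} (hX : X.Fits K q a)
    (ha : a = Nat.clog 16 m) (M : Memory) (m0 : M 0 0 = m) (mN : ∀ i < m, M aNext i = 0) :
    Uses X true (findTangents K) M 1200 fun M' => ∃ nx : ℕ → ℕ,
      (∀ i < m, IsNext (pt X.P) i m (nx i)) ∧
      ∀ i < m, M' aOut (2 * i) = 0 ∧ M' aOut (2 * i + 1) = nx i - (i + 1) := by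
  have hR := hX.votes_pos
  have hm := hX.two_le
  have hq := hX.two_le_q
  have e1 := hX.two_mul_le
  have e2 := hX.mq_le
  have e3 := hX.le_pow
  have e4 := hX.words
  have e5 := hX.pow_le
  have e6 : q ≤ q ^ 4 := Nat.le_self_pow (by norm_num) q
  have hN := hX.procs
  refine (uses_setup ha hR hX.a_le (by omega) (by rw [← hX.q_eq]; omega) M m0).next
    (by norm_num) ?_
  rintro M1 ⟨f1, q1, l1⟩
  refine uses_fill_seq hR 1 (fun _ => 1) (by simp) (by simp) (by omega) (fun x hx => by omega)
    (by norm_num) ?_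
  intro M2 f2 v2
  -- Blocks of a single point have no successors, so zeros are a correct table for `q ^ 0`. Four
  -- levels reach `q ^ 4 ≥ m`, a single block.
  have hloop := Uses.loop (X := X) (inOp := true)
    (b := .bin .lt (scalar aBlock) (scalar aQ * scalar aQ * scalar aQ * scalar aQ))
    (c := level K) (M := M2) (u := 290) (by omega) hR
    (fun k M' => k ≤ 4 ∧ M' 0 0 = m ∧ M' aQ 0 = q ∧ M' aLog 0 = a ∧ M' aBlock 0 = q ^ k ∧
        IsNextTable (pt X.P) m (q ^ k) (M' aNext)) 4
    ⟨by norm_num, by simp [f2, f1, m0], by simp [f2, q1, hX.q_eq], by simp [f2, l1],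
      by simp [v2], by
        intro i hi
        left
        refine ⟨by simp [f2, f1, mN i hi], ?_⟩
        simp⟩
    (by
      rintro k hk M' ⟨-, a1, a2, a3, a4, a5⟩
      refine ⟨?_, (uses_level hX (by omega) M' a1 a2 a3 a4 a5).mono le_rfl
        fun M'' h => ⟨by omega, h⟩⟩
      have : q ^ k < q * q * q * q := by
        calc q ^ k < q ^ 4 := Nat.pow_lt_pow_right (by omega) hk
          _ = q * q * q * q := by ring
      simp [a2, a4, this])
    (by
      rintro M' ⟨-, a1, a2, a3, a4, a5⟩
      have : q * q * q * q = q ^ 4 := by ring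
      simp [a2, a4, this])
  refine hloop.next (by norm_num) ?_
  rintro M3 ⟨-, a1, a2, a3, a4, a5⟩
  -- Odd cells hold positions in the right chain, which starts at the point after `i`. For the last
  -- point, truncation turns the pointer 0 into the prescribed result of a search among nothing.
  refine uses_fill hR (2 * m) (fun y => if y % 2 ≠ 0 then M3 aNext (y / 2) - (y / 2 + 1) else 0)
    (by simp [a1]) (by simp) (by omega) ?_ (by norm_num) ?_
  · intro y hy
    have := a5.lt (show y / 2 < m by omega)
    split_ifs <;> omega
  intro M4 f4 v4
  refine ⟨M3 aNext, fun i hi => ?_, fun i hi => ⟨?_, ?_⟩⟩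
  · have := a5 i hi
    rwa [min_eq_left] at this
    calc m ≤ 1 * q ^ 4 := by rw [one_mul]; exact hX.m_le
      _ ≤ _ := Nat.mul_le_mul_right _ (Nat.le_add_left 1 _)
  · rw [v4 _ (by omega)]
    simp
  · rw [v4 _ (by omega), if_pos (by omega), show (2 * i + 1) / 2 = i by omega]

/-! ### Ranks in a sorted array -/

section

variable {m : ℕ} (H : Finset (Fin m))

theorem sum_labels {lab : ℕ → ℕ} (hlab : ∀ i : Fin m, lab i = if i ∈ H then 1 else 0) {x : ℕ}
    (hx : x < m) :
    ∑ y ∈ Finset.Icc 0 x, lab y = (H.filter fun j : Fin m => (j : ℕ) ≤ x).card := by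
  have h1 : ∀ y ∈ Finset.Icc 0 x, lab y = if lab y = 1 then 1 else 0 := by
    intro y hy
    have := hlab ⟨y, by simp at hy; omega⟩
    simp only at this
    rw [this]
    split_ifs <;> simp_all
  rw [Finset.sum_congr rfl h1, ← Finset.card_filter, ← Finset.card_map Fin.valEmbedding]
  congr 1
  ext y
  simp only [Finset.mem_filter, Finset.mem_Icc, Finset.mem_map, Fin.valEmbedding_apply]
  constructor
  · rintro ⟨⟨-, h2⟩, h3⟩
    have := hlab ⟨y, by omega⟩
    simp only at this
    rw [h3] at this
    refine ⟨⟨y, by omega⟩, ⟨?_, h2⟩, rfl⟩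
    by_contra hc
    simp [hc] at this
  · rintro ⟨j, ⟨h2, h3⟩, rfl⟩
    exact ⟨⟨by omega, h3⟩, by rw [hlab]; simp [h2]⟩

theorem card_filter_le_orderEmb (k : Fin H.card) :
    (H.filter fun j : Fin m => (j : ℕ) ≤ H.orderEmbOfFin rfl k).card = k + 1 := by
  have : (H.filter fun j : Fin m => (j : ℕ) ≤ H.orderEmbOfFin rfl k) =
      (Finset.Iic k).map (H.orderEmbOfFin rfl).toEmbedding := by
    ext j
    simp only [Finset.mem_filter, Finset.mem_map, Finset.mem_Iic, RelEmbedding.coe_toEmbedding]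
    constructor
    · rintro ⟨h1, h2⟩
      have : j ∈ Set.range (H.orderEmbOfFin rfl) := by
        rw [Finset.range_orderEmbOfFin]; exact h1
      obtain ⟨l, rfl⟩ := this
      exact ⟨l, (H.orderEmbOfFin rfl).le_iff_le.1 h2, rfl⟩
    · rintro ⟨l, h1, rfl⟩
      exact ⟨Finset.orderEmbOfFin_mem _ _ _, (H.orderEmbOfFin rfl).le_iff_le.2 h1⟩
  rw [this, Finset.card_map, Fin.card_Iic]

theorem exists_orderEmb_eq {i : Fin m} (hi : i ∈ H) : ∃ k, H.orderEmbOfFin rfl k = i := by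
  have : i ∈ Set.range (H.orderEmbOfFin rfl) := by
    rw [Finset.range_orderEmbOfFin]; exact hi
  exact this

end

/-! ### The output of the upper hull -/

/-- Compute the upper hull from the tangents, and store it. -/
def report : Cmd :=
  .seq (par (.const 1) aSize (scalar 0)) <|
  .seq (par (.const 1) aLimit (scalar 0)) <|
  .seq (par (scalar 0) aAcc (.pid + .const 1 + .read aOut (.const 2 * .pid + .const 1))) <|
  .seq (doubling .max) <|
  .seq (par (scalar 0) 2 (.ite .pid
    (.ite (.bin .lt .pid (.read aAcc (.pid - .const 1))) (.const 0) (.const 1)) (.const 1))) <|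
  .seq (par (scalar 0) aAcc (.read 2 .pid)) <|
  .seq (doubling (· + ·)) <|
  .seq (.step (scalar 0) (.read 2 .pid) 1 (.read aAcc .pid - .const 1) (.calc .pid))
  (.step (.const 1) (.const 1) 0 (.const 1) (.calc (.read aAcc (scalar 0 - .const 1))))

/-- With all points as one block, `aboveChords_iff` makes the hull vertices the points that no
pointer jumps over. Prefix sums of the labels are their ranks; a vertex goes to the cell given by
its rank minus one. -/
theorem uses_report {m : ℕ} {X : Machine m} {K q a : ℕ} (hX : X.Fits K q a)
    (hP : StrictMono fun i => (X.P i).1) (M : Memory) (m0 : M 0 0 = m) {nx : ℕ → ℕ}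
    (hnx : ∀ i < m, IsNext (pt X.P) i m (nx i))
    (mO : ∀ i < m, M aOut (2 * i + 1) = nx i - (i + 1)) :
    Uses X false report M 50 (StoresHull (upperHull X.P)) := by
  have hR := hX.votes_pos
  have hm := hX.two_le
  have e1 := hX.two_mul_le
  have e2 := hX.mq_le
  have e3 := hX.le_pow
  have e4 := hX.words
  have hN := hX.procs
  have hcl := hX.clog_m
  have hnxm : ∀ i < m, nx i < m := by
    intro i hi
    rcases hnx i hi with ⟨h, -⟩ | ⟨-, h, -⟩ <;> omega
  refine uses_fill_seq hR 1 (fun _ => m) (by simp) (by simp [m0]) (by omega)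
    (by intros; omega) (by norm_num) ?_
  intro M1 f1 v1
  refine uses_fill_seq hR 1 (fun _ => m) (by simp) (by simp [f1, m0]) (by omega)
    (by intros; omega) (by norm_num) ?_
  intro M2 f2 v2
  -- This restores the pointers from the results of the tangent operations, the only thing those
  -- leave behind. The last point gets `m` in place of 0, but this enters only the last prefix
  -- maximum, which no label uses.
  refine uses_fill_seq hR m (fun i => i + 1 + (nx i - (i + 1))) (by simp [f2, f1, m0]) ?_
    (by omega) (fun i hi => by have := hnxm i hi; omega) (by norm_num) ?_
  · intro i hi
    simp [f2, f1, mO i hi]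
  intro M3 f3 v3
  refine (uses_prefixMax M3 m m hR (by omega) (by omega) (by simp [f3, f2, v1]) (by simp [f3, v2])
    hcl (by omega) (by omega) (fun x hx => ?_)).next (by norm_num) ?_
  · rw [v3 x hx]
    have := hnxm x hx
    omega
  rintro M4 ⟨f4, v4⟩
  set H := upperHull X.P with hH
  set lab : ℕ → ℕ := fun i => if i ≠ 0 then if i < M4 aAcc (i - 1) then 0 else 1 else 1 with hlabd
  have hlab : ∀ i : Fin m, lab i = if i ∈ H then 1 else 0 := by
    intro i
    have hi := i.2
    have h1 : i ∈ H ↔ ∀ j < (i : ℕ), nx j ≤ i := by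
      rw [hH, mem_upperHull_iff hP, ← aboveChords_iff hX.sorted le_rfl
        (fun h _ hh => hnx h hh) hi]
      exact ⟨fun h j hj => h j (by omega) hj, fun h j _ hj => h j hj⟩
    by_cases hi0 : (i : ℕ) = 0
    · have : i ∈ H := h1.2 fun j hj => by omega
      simp [hlabd, hi0, this]
    · have h2 : (i : ℕ) < M4 aAcc (i - 1) ↔ ¬ i ∈ H := by
        rw [v4 _ (by omega), window_eq (by omega), sup_congr_Icc (m := m) (by omega) v3, h1,
          Finset.lt_sup_iff]
        push Not
        constructor
        · rintro ⟨j, hj, hlt⟩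
          simp at hj
          refine ⟨j, by omega, ?_⟩
          rcases hnx j (by omega) with ⟨-, h⟩ | ⟨h, -⟩ <;> omega
        · rintro ⟨j, hj, hlt⟩
          exact ⟨j, by simp; omega, by omega⟩
      simp only [hlabd, ne_eq, hi0, not_false_eq_true, if_true, h2]
      by_cases hc : i ∈ H <;> simp [hc]
  have hlab1 : ∀ i, lab i ≤ 1 := by
    intro i
    simp only [hlabd]
    split_ifs <;> simp
  refine uses_fill_seq hR m lab (by simp [f4, f3, f2, f1, m0]) ?_ (by omega)
    (fun i _ => (hlab1 i).trans_lt (by omega)) (by norm_num) ?_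
  · intro i _
    simp only [hlabd, eval_ite, eval_pid, eval_lt, eval_read, eval_sub, eval_const]
    by_cases h1 : i = 0
    · simp [h1]
    · by_cases h2 : i < M4 aAcc (i - 1) <;> simp [h1, h2]
  intro M5 f5 v5
  refine uses_fill_seq hR m lab (by simp [f5, f4, f3, f2, f1, m0]) (by simpa using v5) (by omega)
    (fun i _ => (hlab1 i).trans_lt (by omega)) (by norm_num) ?_
  intro M6 f6 v6
  refine (uses_prefixSum M6 m m hR (by omega) (by omega) (by simp [f6, f5, f4, f3, f2, v1])
    (by simp [f6, f5, f4, f3, v2]) hcl (by omega) (by omega) (by omega)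
    (fun x hx => ?_)).next (by norm_num) ?_
  · rw [v6 x hx]
    exact hlab1 x
  rintro M7 ⟨f7, v7⟩
  have v7' : ∀ x < m, M7 aAcc x = (H.filter fun j : Fin m => (j : ℕ) ≤ x).card := by
    intro x hx
    rw [v7 x hx, window_eq hx, ← sum_labels H hlab hx]
    refine Finset.sum_congr rfl fun y hy => v6 y ?_
    simp at hy
    omega
  have hrank : ∀ k : Fin H.card, M7 aAcc (H.orderEmbOfFin rfl k) - 1 = k := by
    intro k
    rw [v7' _ (Fin.is_lt _), card_filter_le_orderEmb]
    omega
  have h70 : M7 0 0 = m := by simp [f7, f6, f5, f4, f3, f2, f1, m0]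
  have h72 : ∀ i < m, M7 2 i = lab i := by
    intro i hi
    simp [f7, f6, v5 i hi]
  have hact : ∀ i < m, M7 2 i ≠ 0 → ∃ k : Fin H.card, (H.orderEmbOfFin rfl k : ℕ) = i := by
    intro i hi hne
    rw [h72 i hi] at hne
    have h1 := hlab ⟨i, hi⟩
    simp only at h1
    have h2 : (⟨i, hi⟩ : Fin m) ∈ H := by
      by_contra hc
      simp [hc] at h1
      exact hne h1
    obtain ⟨k, hk⟩ := exists_orderEmb_eq H h2
    exact ⟨k, by rw [hk]⟩
  refine (uses_scatter hR ?_ ?_ ?_).next (by norm_num) ?_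
  · simp [h70]; omega
  · simp only [eval_scalar, h70, eval_read, eval_pid, eval_sub, eval_const]
    intro i hi j hj gi gj hij
    obtain ⟨k, rfl⟩ := hact i hi gi
    obtain ⟨l, rfl⟩ := hact j hj gj
    rw [hrank, hrank] at hij
    rw [Fin.ext hij]
  · simp only [eval_scalar, h70, eval_pid]
    intros
    omega
  simp only [eval_scalar, h70, eval_read, eval_pid, eval_sub, eval_const]
  rintro M8 ⟨f8, s8, -⟩
  have h80 : M8 0 0 = m := by simp [f8, h70]
  have h8a : M8 aAcc = M7 aAcc := f8 _ (by norm_num)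
  refine (uses_scatter hR ?_ ?_ ?_).mono (by norm_num) ?_
  · simp; omega
  · simp
  · have hc : (H.filter fun j : Fin m => (j : ℕ) ≤ m - 1).card ≤ m :=
      (Finset.card_le_univ _).trans (by simp)
    simp only [eval_const, eval_read, eval_sub, eval_scalar, h80, h8a, v7' _ (show m - 1 < m by omega)]
    intros
    omega
  simp only [eval_scalar, h80, eval_read, eval_sub, eval_const, h8a]
  rintro M9 ⟨f9, s9, -⟩
  refine ⟨?_, fun k => ?_, fun i => ?_⟩
  · rw [s9 0 (by norm_num) (by norm_num), v7' _ (by omega)]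
    congr 1
    rw [Finset.filter_true_of_mem]
    intro j _
    have := j.2
    omega
  · have hk := hrank k
    have h1 : M7 2 (H.orderEmbOfFin rfl k) ≠ 0 := by
      rw [h72 _ (Fin.is_lt _), hlab]
      simp
    have := s8 _ (Fin.is_lt _) h1
    rw [hk] at this
    rw [f9 1 (by norm_num), this]
  · rw [f9 2 (by norm_num), f8 2 (by norm_num), h72 _ i.2, hlab]

/-! ### The brute-force program -/

/-- The brute-force computation of the upper hull. -/
def bruteForce (K : ℕ) : Cmd :=
  .seq (par (scalar 0) aIdent .pid) <|
  .seq (.op (scalar 0) (.tangent aIdent .pid (.const 1) (.pid + .const 1)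
    (scalar 0 - (.pid + .const 1))) aOut (findTangents K))
  report

/-- The extra unit pays for starting the invocations. `M'` is the memory left by the body; only its
result cells survive. -/
theorem exec_op {m : ℕ} {X : Machine m} {n : Expr} {call : OpExpr} {out : ℕ} {body : Cmd}
    {s : State} {u : ℕ} {Q : Memory → Prop} (hR : 0 < X.R) (hn : n.eval s.mem 0 ≤ X.N)
    (h : Uses X true body s.mem u Q) (hT : s.span + (u + 1) * X.R ≤ X.T) :
    ∃ s' M', Exec X.P X.flip X.B false (.op n call out body) s s' ∧
      s'.span ≤ s.span + (u + 1) * X.R ∧ s'.work ≤ s.work + (u + 1) * (X.N * X.R) ∧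
      s'.log = s.log ++ (List.range (n.eval s.mem 0)).map (fun j =>
        (call.inst s.mem j, (M' out (2 * j), M' out (2 * j + 1)))) ∧ Q M' ∧
      s'.mem = returnResults s.mem M' out (n.eval s.mem 0) := by
  rw [add_mul, one_mul] at hT
  obtain ⟨s', h1, h2, h3, -, h5⟩ := h (s.tick (n.eval s.mem 0)) rfl
    (by simp only [State.tick]; omega)
  refine ⟨_, s'.mem, .op n call out body s s' h1, ?_, ?_, rfl, h5, rfl⟩
  · simp only [State.tick] at h2
    rw [add_mul, one_mul]
    dsimp only
    omega
  · simp only [State.tick] at h3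
    have : X.N ≤ X.N * X.R := Nat.le_mul_of_pos_right _ hR
    rw [add_mul, one_mul]
    dsimp only
    omega

/-- The left chain is the point `j` alone, and the right one consists of all later points. The line
of largest slope from `j` has none of them above it, and its end `r` is at position `r - (j + 1)`.
-/
theorem correct_tangent {m : ℕ} {P : Fin m → ℝ × ℝ} (hp : SortedTo (pt P) m) {M : Memory}
    (hM : ∀ k < m, M aIdent k = k) {j r : ℕ} (hj : j < m) (hr : IsNext (pt P) j m r) :
    OpInst.Correct P (.tangent (segment M aIdent j 1) (segment M aIdent (j + 1) (m - (j + 1))))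
      (0, r - (j + 1)) := by
  have hL : segment M aIdent j 1 = [j] := by simp [segment, hM j hj]
  have hRt : segment M aIdent (j + 1) (m - (j + 1)) =
      (List.range (m - (j + 1))).map fun k => j + 1 + k := by
    rw [segment]
    refine List.map_congr_left fun k hk => hM _ ?_
    rw [List.mem_range] at hk
    omega
  rw [hL, hRt]
  refine ⟨?_, ?_⟩
  · rw [List.singleton_append, List.pairwise_cons]
    refine ⟨?_, ?_⟩
    · intro y hy
      simp at hy
      omega
    · rw [List.pairwise_map]
      exact List.pairwise_lt_range.imp fun h => by omega
  · rcases hr with ⟨h1, h2⟩ | ⟨h1, h2, h3⟩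
    · left
      subst h1
      refine ⟨Or.inr ?_, by simp⟩
      rw [show m - (j + 1) = 0 by omega]
      rfl
    · right
      refine ⟨j, r, by simp, ?_, ?_⟩
      · dsimp only
        rw [List.getElem?_map, List.getElem?_range (by omega)]
        simp
        omega
      · intro w hw
        have xr := hp j r (by omega) h2
        simp only [List.singleton_append, List.mem_cons, List.mem_map, List.mem_range] at hw
        rcases hw with rfl | ⟨k, hk, rfl⟩
        · rw [orient_self_left]
        · rw [orient_nonpos_iff xr (hp _ _ (by omega) (by omega))]
          exact (h3 _ (by omega) (by omega)).1

theorem exec_bruteForce {m : ℕ} {X : Machine m} {K q a : ℕ} (hX : X.Fits K q a)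
    (ha : a = Nat.clog 16 m) (hP : StrictMono fun i => (X.P i).1) (hT : X.T = 1300 * X.R) :
    ∃ s, Exec X.P X.flip X.B false (bruteForce K) (start (inputMem (∅ : Finset (Fin m)))) s ∧
      s.span ≤ 1300 * X.R ∧ s.work ≤ 1300 * (X.N * X.R) ∧ s.log.length = m ∧
      (∀ e ∈ s.log, e.1.Correct X.P e.2) ∧ StoresHull (upperHull X.P) s.mem := by
  have hR := hX.votes_pos
  have hm := hX.two_le
  have e1 := hX.two_mul_le
  have e2 := hX.mq_le
  have e3 := hX.le_pow
  have e4 := hX.words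
  have hN := hX.procs
  set M := inputMem (∅ : Finset (Fin m)) with hM
  have m0 : M 0 0 = m := rfl
  have hid : Uses X false (par (scalar 0) aIdent .pid) M 1 fun M' =>
      (∀ a, a ≠ aIdent → M' a = M a) ∧ ∀ x < m, M' aIdent x = x :=
    uses_fill hR m (fun x => x) (by simp [m0]) (by simp) (by omega) (fun i _ => by omega)
      le_rfl fun M' h1 h2 => ⟨h1, h2⟩
  obtain ⟨s₁, x1, x2, x3, x4, x5, x6⟩ := hid (start M) rfl (by simp only [start]; omega)
  simp only [start] at x2 x3 x4
  have m01 : s₁.mem 0 0 = m := by rw [x5 0 (by norm_num), m0]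
  obtain ⟨s₂, M', y1, y2, y3, y4, ⟨nx, hnx, hout⟩, y6⟩ := exec_op (X := X) (n := scalar 0)
    (call := .tangent aIdent .pid (.const 1) (.pid + .const 1) (scalar 0 - (.pid + .const 1)))
    (out := aOut) (body := findTangents K) (s := s₁) hR (by simp [m01]; omega)
    (uses_findTangents hX ha s₁.mem m01 (fun i _ => by rw [x5 _ (by norm_num)]; rfl)) (by omega)
  simp only [eval_scalar, m01] at y4 y6
  have m02 : s₂.mem 0 0 = m := by rw [y6]; simp [returnResults, m01]
  obtain ⟨s₃, z1, z2, z3, z4, z5⟩ := uses_report hX hP s₂.mem m02 hnx (fun i hi => by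
    rw [y6, returnResults, if_pos ⟨rfl, by omega⟩]
    exact (hout i hi).2) s₂ rfl (by omega)
  refine ⟨s₃, .seq _ _ _ _ _ _ x1 (.seq _ _ _ _ _ _ y1 z1), by omega, by omega, ?_, ?_, z5⟩
  · rw [z4, y4, x4]
    simp
  · intro e he
    rw [z4, y4, x4] at he
    simp only [List.nil_append, List.mem_map, List.mem_range] at he
    obtain ⟨j, hj, rfl⟩ := he
    have := correct_tangent hX.sorted x6 hj (hnx j hj)
    simpa [OpExpr.inst, m01, hout j hj] using this

/-! ### Neighbours in a sorted array -/

section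

variable {m : ℕ} (H : Finset (Fin m))

theorem inputMem_orderEmb (k : Fin H.card) : inputMem H 1 k = H.orderEmbOfFin rfl k := by
  simp [inputMem]

theorem inputMem_vertex_lt (hm : 0 < m) (k : ℕ) : inputMem H 1 k < m := by
  simp only [inputMem]
  split_ifs with h
  · exact Fin.is_lt _
  · exact hm

theorem inputMem_label (i : Fin m) : inputMem H 2 i = if i ∈ H then 1 else 0 := by
  simp [inputMem]

/-- The number of points of `H` that are not after `x`. -/
def rankIn (x : ℕ) : ℕ := (H.filter fun j : Fin m => (j : ℕ) ≤ x).card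

/-- Cells are numbered from 0, so the last element before `i` is in cell `rankIn H (i - 1) - 1` and
the first one after `i` in cell `rankIn H i`. Neither counts `i` itself as its neighbour, whether or
not `i` is in `H`. -/
theorem inputMem_pred {a : Fin m} (ha : a ∈ H) {i : ℕ} (hai : a < i)
    (hno : ∀ j : Fin m, (a : ℕ) < j → (j : ℕ) < i → j ∉ H) :
    inputMem H 1 (rankIn H (i - 1) - 1) = a := by
  obtain ⟨k, rfl⟩ := exists_orderEmb_eq H ha
  have h1 : rankIn H (i - 1) = k + 1 := by
    rw [← card_filter_le_orderEmb, rankIn]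
    congr 1
    ext j
    simp only [Finset.mem_filter]
    refine and_congr_right fun hj => ⟨fun h => ?_, fun h => by omega⟩
    by_contra hc
    exact hno j (by omega) (by omega) hj
  rw [h1, Nat.add_sub_cancel, inputMem_orderEmb]

theorem inputMem_succ {b : Fin m} (hb : b ∈ H) {i : ℕ} (hib : i < b)
    (hno : ∀ j : Fin m, i < (j : ℕ) → j < b → j ∉ H) :
    inputMem H 1 (rankIn H i) = b := by
  obtain ⟨k, rfl⟩ := exists_orderEmb_eq H hb
  have h1 : rankIn H i + 1 = k + 1 := by
    rw [← card_filter_le_orderEmb, rankIn, ← Finset.card_insert_of_notMem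
      (a := H.orderEmbOfFin rfl k) (by simp [hib])]
    congr 1
    ext j
    simp only [Finset.mem_filter, Finset.mem_insert]
    constructor
    · rintro (rfl | ⟨h2, h3⟩)
      · exact ⟨hb, le_rfl⟩
      · exact ⟨h2, by omega⟩
    · rintro ⟨h2, h3⟩
      by_cases h4 : (j : ℕ) ≤ i
      · exact Or.inr ⟨h2, h4⟩
      · left
        by_contra h5
        exact hno j (by omega) (lt_of_le_of_ne h3 h5) h2
  rw [show rankIn H i = k by omega, inputMem_orderEmb]

open Classical in
/-- The label that point `i` should have, by the test against its neighbours. -/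
def expectedLabel (P : Fin m → ℝ × ℝ) (i : ℕ) : ℕ :=
  if i = 0 then 1 else if i + 1 = m then 1 else
    if 0 < orient (pt P (inputMem H 1 (rankIn H (i - 1) - 1))) (pt P (inputMem H 1 (rankIn H i)))
      (pt P i) then 1 else 0

/-- A missing outermost point is betrayed by its own label. If both are present, every inner point
has neighbours on both sides, and the test is that of `forall_iff_aboveChords`. The meaningless
chords that arise from missing neighbours therefore cannot cause a wrong verdict. -/
theorem labels_expected_iff {P : Fin m → ℝ × ℝ} (hm : 2 ≤ m) (hP : StrictMono fun i => (P i).1) :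
    (∀ i < m, inputMem H 2 i = expectedLabel H P i) ↔ H = upperHull P := by
  have hp := pt_sortedTo hP
  set S : ℕ → Prop := fun i => ∃ h : i < m, (⟨i, h⟩ : Fin m) ∈ H with hS
  have hSl : ∀ i < m, (inputMem H 2 i = 1 ↔ S i) ∧ (inputMem H 2 i = 0 ↔ ¬ S i) := by
    intro i hi
    have h1 := inputMem_label H ⟨i, hi⟩
    simp only at h1
    have h2 : S i ↔ (⟨i, hi⟩ : Fin m) ∈ H := ⟨fun ⟨_, h⟩ => h, fun h => ⟨hi, h⟩⟩
    rw [h1, h2]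
    by_cases h3 : (⟨i, hi⟩ : Fin m) ∈ H <;> simp [h3]
  have hU : H = upperHull P ↔ ∀ i < m, S i ↔ AboveChords (pt P) 0 m i := by
    rw [Finset.ext_iff]
    constructor
    · intro h i hi
      rw [← mem_upperHull_iff hP ⟨i, hi⟩, ← h]
      exact ⟨fun ⟨_, h⟩ => h, fun h => ⟨hi, h⟩⟩
    · intro h i
      rw [mem_upperHull_iff hP i, ← h i i.2]
      exact ⟨fun h => ⟨i.2, h⟩, fun ⟨_, h⟩ => h⟩
  have hnb : ∀ i a b, a < i → i < b → b < m → S a → S b → (∀ j, a < j → j < i → ¬ S j) →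
      (∀ j, i < j → j < b → ¬ S j) →
      inputMem H 1 (rankIn H (i - 1) - 1) = a ∧ inputMem H 1 (rankIn H i) = b := by
    rintro i a b hai hib hbm ⟨ha, hSa⟩ ⟨hb, hSb⟩ h1 h2
    exact ⟨inputMem_pred H hSa hai fun j x y z => h1 j x y ⟨j.2, z⟩,
      inputMem_succ H hSb hib fun j x y z => h2 j x y ⟨j.2, z⟩⟩
  rw [hU, forall_iff_aboveChords hp hm]
  constructor
  · intro h
    refine ⟨?_, ?_, ?_⟩
    · rw [← (hSl 0 (by omega)).1, h 0 (by omega)]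
      simp [expectedLabel]
    · rw [← (hSl _ (by omega)).1, h (m - 1) (by omega), expectedLabel,
        if_neg (by omega), if_pos (by omega)]
    · intro i a b hai hib hbm hSa hSb h1 h2
      obtain ⟨n1, n2⟩ := hnb i a b hai hib hbm hSa hSb h1 h2
      rw [← (hSl i (by omega)).1, h i (by omega), expectedLabel, if_neg (by omega),
        if_neg (by omega), n1, n2]
      simp
  · rintro ⟨h0, hl, h⟩ i hi
    by_cases hi0 : i = 0
    · subst hi0
      rw [(hSl 0 hi).1.2 h0]
      simp [expectedLabel]
    by_cases hi1 : i + 1 = m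
    · have : i = m - 1 := by omega
      rw [(hSl i hi).1.2 (this ▸ hl), expectedLabel, if_neg hi0, if_pos hi1]
    obtain ⟨a, hai, -, hSa, ha⟩ := exists_pred h0 (show 0 < i by omega)
    obtain ⟨b, hib, hbl, hSb, hb⟩ := exists_succ hl (show i < m - 1 by omega)
    obtain ⟨n1, n2⟩ := hnb i a b hai hib (by omega) hSa hSb ha hb
    have := h i a b hai hib (by omega) hSa hSb ha hb
    rw [expectedLabel, if_neg hi0, if_neg hi1, n1, n2]
    by_cases hc : 0 < orient (pt P a) (pt P b) (pt P i)
    · rw [if_pos hc, (hSl i hi).1, this]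
      exact hc
    · rw [if_neg hc, (hSl i hi).2, this]
      exact hc

end

/-! ### The failure sweep -/

/-- Find the neighbours of all points in the purported hull. -/
def neighbours : Cmd :=
  .seq (par (.const 1) aSize (scalar 0)) <|
  .seq (par (.const 1) aLimit (scalar 0)) <|
  .seq (par (scalar 0) aAcc (.read 2 .pid)) <|
  .seq (doubling (· + ·)) <|
  .seq (par (scalar 0) aFst (.read 1 (.read aAcc (.pid - .const 1) - .const 1)))
  (par (scalar 0) aSnd (.read 1 (.read aAcc .pid)))

/-- Decide for all points whether they are above the chords of their neighbours. -/
def testChords (K : ℕ) : Cmd :=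
  .seq setup <|
  .seq (par (scalar 0) aTrd .pid) <|
  .seq (vote K)
  (par (.const 2 * scalar 0) aOut
    (.ite (.pid % .const 2) (.const 0) (.read aVotes (.pid / .const 2))))

/-- Compare the labels with the results of the tests. -/
def verdict : Cmd :=
  .seq (par (scalar 0) aAcc (.ite (.bin .eq (.read 2 .pid)
    (.ite (.bin .eq .pid (.const 0)) (.const 1)
      (.ite (.bin .eq (.pid + .const 1) (scalar 0)) (.const 1) (.read aOut (.const 2 * .pid)))))
    (.const 0) (.const 1))) <|
  .seq (doubling (· + ·))
  (par (.const 1) 3 (.ite (.read aAcc (scalar 0 - .const 1)) (.const 0) (.const 1)))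

/-- The failure sweep. -/
def failureSweep (K : ℕ) : Cmd :=
  .seq neighbours <|
  .seq (.op (scalar 0) (.decide .leftTurn (.read aFst .pid) (.read aSnd .pid) .pid) aOut
    (testChords K))
  verdict

/-- The numerical assumptions about a machine that runs the failure sweep with votes of `K * a`
evaluations. -/
structure Machine.Sweeps {m : ℕ} (X : Machine m) (K a : ℕ) : Prop where
  two_le : 2 ≤ m
  log : a = Nat.clog 16 m
  procs : X.N = 2 * m
  votes : X.R = K * a
  a_le : a ≤ X.R
  votes_pos : 0 < X.R
  votes_lt : X.R + 1 < X.B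
  words : 8 * m < X.B
  pow_words : 2 * 2 ^ a < X.B
  time : X.T = 200 * X.R
  reliable : X.Reliable

theorem Machine.Sweeps.clog_m {m : ℕ} {X : Machine m} {K a : ℕ} (h : X.Sweeps K a) :
    Nat.clog 2 m ≤ 4 * X.R := by
  refine (Nat.clog_le_of_le_pow (b := 2) (y := 4 * a) ?_).trans (by have := h.a_le; omega)
  calc m ≤ 16 ^ Nat.clog 16 m := Nat.le_pow_clog (by norm_num) m
    _ = 2 ^ (4 * a) := by rw [← h.log, pow_mul]; norm_num

theorem uses_neighbours {m : ℕ} {X : Machine m} {K a : ℕ} (hX : X.Sweeps K a)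
    (H : Finset (Fin m)) :
    Uses X false neighbours (inputMem H) 30 fun M' =>
      (∀ a ∉ [aSize, aLimit, aAcc, aWidth, aFst, aSnd], M' a = inputMem H a) ∧
      M' aSize 0 = m ∧ M' aLimit 0 = m ∧
      (∀ i < m, M' aFst i = inputMem H 1 (rankIn H (i - 1) - 1)) ∧
      ∀ i < m, M' aSnd i = inputMem H 1 (rankIn H i) := by
  have hR := hX.votes_pos
  have hm := hX.two_le
  have e4 := hX.words
  have hN := hX.procs
  have hcl := hX.clog_m
  have m0 : inputMem H 0 0 = m := rfl
  have hlab : ∀ i < m, inputMem H 2 i ≤ 1 := by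
    intro i hi
    have := inputMem_label H ⟨i, hi⟩
    simp only at this
    rw [this]
    split_ifs <;> simp
  have hV : ∀ k, inputMem H 1 k < X.B := fun k =>
    (inputMem_vertex_lt H (by omega) k).trans (by omega)
  refine uses_fill_seq hR 1 (fun _ => m) (by simp) (by simp [m0]) (by omega)
    (by intros; omega) (by norm_num) ?_
  intro M1 f1 v1
  refine uses_fill_seq hR 1 (fun _ => m) (by simp) (by simp [f1, m0]) (by omega)
    (by intros; omega) (by norm_num) ?_
  intro M2 f2 v2
  refine uses_fill_seq hR m (inputMem H 2) (by simp [f2, f1, m0]) (by simp [f2, f1]) (by omega)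
    (fun i hi => (hlab i hi).trans_lt (by omega)) (by norm_num) ?_
  intro M3 f3 v3
  refine (uses_prefixSum M3 m m hR (by omega) (by omega) (by simp [f3, f2, v1]) (by simp [f3, v2])
    hcl (by omega) (by omega) (by omega) (fun x hx => by rw [v3 x hx]; exact hlab x hx)).next
    (by norm_num) ?_
  rintro M4 ⟨f4, v4⟩
  have v4' : ∀ x < m, M4 aAcc x = rankIn H x := by
    intro x hx
    rw [v4 x hx, window_eq hx, rankIn, ← sum_labels H (inputMem_label H) hx]
    refine Finset.sum_congr rfl fun y hy => v3 y ?_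
    simp at hy
    omega
  refine uses_fill_seq hR m (fun i => inputMem H 1 (rankIn H (i - 1) - 1))
    (by simp [f4, f3, f2, f1, m0]) ?_ (by omega) (fun i _ => hV _) (by norm_num) ?_
  · intro i hi
    simp [v4' (i - 1) (by omega), f4, f3, f2, f1]
  intro M5 f5 v5
  refine uses_fill hR m (fun i => inputMem H 1 (rankIn H i))
    (by simp [f5, f4, f3, f2, f1, m0]) ?_ (by omega) (fun i _ => hV _) (by norm_num) ?_
  · intro i hi
    simp [v4' i hi, f5, f4, f3, f2, f1]
  intro M6 f6 v6
  refine ⟨fun a ha => ?_, by simp [f6, f5, f4, f3, f2, v1], by simp [f6, f5, f4, f3, v2],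
    fun i hi => by rw [f6 _ (by norm_num), v5 i hi], v6⟩
  simp at ha
  simp [f6, f5, f4, f3, f2, f1, ha]

theorem uses_testChords {m : ℕ} {X : Machine m} {K a : ℕ} (hX : X.Sweeps K a) (M : Memory)
    (m0 : M 0 0 = m) (mS : M aSize 0 = m) :
    Uses X true (testChords K) M 30 fun M' => ∀ i < m, M' aOut (2 * i + 1) = 0 ∧
      M' aOut (2 * i) = open Classical in
        if 0 < orient (pt X.P (M aFst i)) (pt X.P (M aSnd i)) (pt X.P i) then 1 else 0 := by
  have hR := hX.votes_pos
  have hm := hX.two_le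
  have e4 := hX.words
  have hN := hX.procs
  refine (uses_setup hX.log hR hX.a_le (by omega) hX.pow_words M m0).next (by norm_num) ?_
  rintro M1 ⟨f1, q1, l1⟩
  refine uses_fill_seq hR m (fun i => i) (by simp [f1, m0]) (by simp) (by omega)
    (fun i _ => by omega) (by norm_num) ?_
  intro M2 f2 v2
  refine (uses_vote hX.reliable K m M2 (by simp [f2, l1, hX.votes]) hR hX.votes_lt
    (by simp [f2, f1, mS]) (by omega) (by omega)).next (by norm_num) ?_
  rintro M3 ⟨f3, v3⟩
  refine uses_fill hR (2 * m) (fun y => if y % 2 ≠ 0 then 0 else M3 aVotes (y / 2))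
    (by simp [f3, f2, f1, m0]) (by simp) (by omega) ?_ (by norm_num) ?_
  · intro y hy
    have h1 : M3 aVotes (y / 2) ≤ 1 := by
      rw [v3 _ (by omega)]
      split_ifs <;> simp
    split_ifs <;> omega
  intro M4 f4 v4 i hi
  refine ⟨by rw [v4 _ (by omega), if_pos (by omega)], ?_⟩
  rw [v4 _ (by omega), if_neg (by omega), show 2 * i / 2 = i by omega, v3 i hi, v2 i hi]
  simp [f2, f1]

theorem uses_verdict {m : ℕ} {X : Machine m} {K a : ℕ} (hX : X.Sweeps K a)
    (hP : StrictMono fun i => (X.P i).1) (H : Finset (Fin m)) (M : Memory)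
    (m0 : M 0 0 = m) (mS : M aSize 0 = m) (mL : M aLimit 0 = m) (mH : M 2 = inputMem H 2)
    (mO : ∀ i < m, M aOut (2 * i) = open Classical in
        if 0 < orient (pt X.P (inputMem H 1 (rankIn H (i - 1) - 1)))
          (pt X.P (inputMem H 1 (rankIn H i))) (pt X.P i) then 1 else 0) :
    Uses X false verdict M 30 fun M' =>
      (M' 3 0 = 1 ∧ H = upperHull X.P) ∨ (M' 3 0 = 0 ∧ H ≠ upperHull X.P) := by
  have hR := hX.votes_pos
  have hm := hX.two_le
  have e4 := hX.words
  have hN := hX.procs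
  have hcl := hX.clog_m
  set bad : ℕ → ℕ := fun i => if inputMem H 2 i = expectedLabel H X.P i then 0 else 1 with hbad
  have hbad1 : ∀ i, bad i ≤ 1 := by
    intro i
    simp only [hbad]
    split_ifs <;> simp
  refine uses_fill_seq hR m bad (by simp [m0]) ?_ (by omega)
    (fun i _ => (hbad1 i).trans_lt (by omega)) (by norm_num) ?_
  · intro i hi
    have h1 : (Expr.ite (.bin .eq .pid (.const 0)) (.const 1)
        (.ite (.bin .eq (.pid + .const 1) (scalar 0)) (.const 1)
          (.read aOut (.const 2 * .pid)))).eval M i = expectedLabel H X.P i := by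
      simp only [eval_ite, eval_eq, eval_pid, eval_const, eval_add, eval_scalar, m0, eval_read,
        eval_mul, mO i hi, expectedLabel]
      by_cases c1 : i = 0
      · simp [c1]
      · by_cases c2 : i + 1 = m
        · simp [c1, c2]
        · simp [c1, c2]
    rw [eval_ite, eval_eq, h1]
    simp only [eval_read, eval_pid, mH, eval_const, hbad]
    by_cases c1 : inputMem H 2 i = expectedLabel H X.P i <;> simp [c1]
  intro M1 f1 v1
  refine (uses_prefixSum M1 m m hR (by omega) (by omega) (by simp [f1, mS]) (by simp [f1, mL])
    hcl (by omega) (by omega) (by omega) (fun x hx => by rw [v1 x hx]; exact hbad1 x)).next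
    (by norm_num) ?_
  rintro M2 ⟨f2, v2⟩
  have h1 : M2 aAcc (m - 1) = 0 ↔ H = upperHull X.P := by
    rw [← labels_expected_iff H hm hP, v2 _ (by omega), window_eq (show m - 1 < m by omega),
      Finset.sum_eq_zero_iff]
    constructor
    · intro h i hi
      have := h i (by simp; omega)
      rw [v1 i hi] at this
      simp only [hbad] at this
      by_contra hc
      simp [hc] at this
    · intro h i hi
      simp at hi
      rw [v1 i (by omega)]
      simp [hbad, h i (by omega)]
  refine uses_fill hR 1 (fun _ => if M2 aAcc (m - 1) ≠ 0 then 0 else 1) (by simp)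
    (by simp [f2, f1, m0]) (by omega) (fun i _ => by split_ifs <;> omega) (by norm_num) ?_
  intro M3 f3 v3
  have h2 := v3 0 (by norm_num)
  by_cases hc : H = upperHull X.P
  · left
    rw [h2, if_neg (by simpa using h1.2 hc)]
    exact ⟨rfl, hc⟩
  · right
    rw [h2, if_pos fun h => hc (h1.1 h)]
    exact ⟨rfl, hc⟩

theorem exec_failureSweep {m : ℕ} {X : Machine m} {K a : ℕ} (hX : X.Sweeps K a)
    (hP : StrictMono fun i => (X.P i).1) (H : Finset (Fin m)) :
    ∃ s, Exec X.P X.flip X.B false (failureSweep K) (start (inputMem H)) s ∧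
      s.span ≤ 200 * X.R ∧ s.work ≤ 200 * (X.N * X.R) ∧ s.log.length = m ∧
      (∀ e ∈ s.log, e.1.Correct X.P e.2) ∧
      ((s.mem 3 0 = 1 ∧ H = upperHull X.P) ∨ (s.mem 3 0 = 0 ∧ H ≠ upperHull X.P)) := by
  have hR := hX.votes_pos
  have hN := hX.procs
  have hT := hX.time
  obtain ⟨s₁, x1, x2, x3, x4, x5, xS, xL, xa, xb⟩ := uses_neighbours hX H (start (inputMem H)) rfl
    (by simp only [start]; omega)
  simp only [start] at x2 x3 x4
  have m01 : s₁.mem 0 0 = m := by rw [x5 0 (by simp)]; rfl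
  obtain ⟨s₂, M', y1, y2, y3, y4, y5, y6⟩ := exec_op (X := X) (n := scalar 0)
    (call := .decide .leftTurn (.read aFst .pid) (.read aSnd .pid) .pid)
    (out := aOut) (body := testChords K) (s := s₁) hR (by simp [m01]; omega)
    (uses_testChords hX s₁.mem m01 xS) (by omega)
  simp only [eval_scalar, m01] at y4 y6
  have hmem : ∀ a, a ≠ aOut → s₂.mem a = s₁.mem a := by
    intro a ha
    funext k
    rw [y6]
    simp [returnResults, ha]
  obtain ⟨s₃, z1, z2, z3, z4, z5⟩ := uses_verdict hX hP H s₂.mem (by simp [hmem, m01])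
    (by simp [hmem, xS]) (by simp [hmem, xL]) (by simp [hmem, x5]) (fun i hi => by
      rw [y6, returnResults, if_pos ⟨rfl, by omega⟩, (y5 i hi).2, xa i hi, xb i hi]) s₂ rfl
      (by omega)
  refine ⟨s₃, .seq _ _ _ _ _ _ x1 (.seq _ _ _ _ _ _ y1 z1), by omega, by omega, ?_, ?_, z5⟩
  · rw [z4, y4, x4]
    simp
  · intro e he
    rw [z4, y4, x4] at he
    simp only [List.nil_append, List.mem_map, List.mem_range] at he
    obtain ⟨j, hj, rfl⟩ := he
    obtain ⟨o1, o2⟩ := y5 j hj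
    refine ⟨?_, o1⟩
    simp only [eval_read, eval_pid, o2, Prim.Holds]
    by_cases hc : 0 < orient (pt X.P (s₁.mem aFst j)) (pt X.P (s₁.mem aSnd j)) (pt X.P j)
    · left
      simp [hc]
    · right
      rw [if_neg hc]
      exact ⟨rfl, hc⟩

/-! ### The probability of wrong majorities -/

/-- Hoeffding's inequality for the centred error indicators, which are independent because the steps
`t + 4 * k` are distinct. The expected number of errors is at most `R * p`, so half of `R` exceeds
it by at least `R * (1 / 2 - p)`; indicators with values in `[0, 1]` have variance proxy `1 / 4`. -/
theorem IsNoise.majority_error {Ω : Type*} [MeasurableSpace Ω] {μ : Measure Ω}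
    [IsProbabilityMeasure μ] {p : ℝ} {flip : ℕ → ℕ → Ω → Bool} (h : IsNoise μ p flip)
    (hp0 : 0 ≤ p) (hp : p < 1 / 2) (R t i : ℕ) (hR : 0 < R) :
    μ {ω | R ≤ 2 * ((Finset.range R).filter fun k => flip (t + 4 * k) i ω = true).card} ≤
      ENNReal.ofReal (Real.exp (-(2 * R * (1 / 2 - p) ^ 2))) := by
  set f : Bool → ℝ := fun b => if b = true then 1 else 0 with hf
  set Y : ℕ → Ω → ℝ := fun k ω => f (flip (t + 4 * k) i ω) with hY
  have hYm : ∀ k, Measurable (Y k) := fun k =>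
    (measurable_of_countable f).comp (h.measurable _ _)
  have hY01 : ∀ k ω, Y k ω ∈ Set.Icc (0 : ℝ) 1 := by
    intro k ω
    simp only [hY, hf]
    split_ifs <;> simp
  have hE : ∀ k, ∫ ω, Y k ω ∂μ ≤ p := by
    intro k
    have h1 : Y k = Set.indicator {ω | flip (t + 4 * k) i ω = true} 1 := by
      funext ω
      simp [hY, hf, Set.indicator_apply]
    have hms : MeasurableSet {ω | flip (t + 4 * k) i ω = true} :=
      h.measurable _ _ (measurableSet_singleton true)
    rw [h1, integral_indicator_one hms]
    exact ENNReal.toReal_le_of_le_ofReal hp0 (h.error_le _ _)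
  have hind : iIndepFun (fun k ω => Y k ω - ∫ ω', Y k ω' ∂μ) μ := by
    have h1 : iIndepFun (fun k : ℕ => flip (t + 4 * k) i) μ :=
      h.indep.precomp (g := fun k : ℕ => (t + 4 * k, i)) fun a b hab => by
        simp only [Prod.mk.injEq, and_true] at hab
        omega
    exact h1.comp (fun k b => f b - ∫ ω', Y k ω' ∂μ) fun k => measurable_of_countable _
  have hoeff := HasSubgaussianMGF.measure_sum_range_ge_le_of_iIndepFun hind (n := R)
    (c := (‖(1 : ℝ) - 0‖₊ / 2) ^ 2)
    (fun k _ => hasSubgaussianMGF_of_mem_Icc (hYm k).aemeasurable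
      (Filter.Eventually.of_forall (hY01 k)))
    (ε := R * (1 / 2 - p)) (mul_nonneg (Nat.cast_nonneg _) (by linarith))
  have hexp : -((R : ℝ) * (1 / 2 - p)) ^ 2 /
      (2 * R * (((‖(1 : ℝ) - 0‖₊ / 2) ^ 2 : NNReal) : ℝ)) = -(2 * R * (1 / 2 - p) ^ 2) := by
    have : (R : ℝ) ≠ 0 := by positivity
    simp
    field_simp
  rw [hexp] at hoeff
  rw [← ofReal_measureReal]
  refine ENNReal.ofReal_le_ofReal (le_trans (measureReal_mono ?_) hoeff)
  intro ω hω
  simp only [Set.mem_ofPred_eq] at hω ⊢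
  rw [Finset.sum_sub_distrib]
  have h1 : ∑ k ∈ Finset.range R, Y k ω =
      ((Finset.range R).filter fun k => flip (t + 4 * k) i ω = true).card := by
    simp [hY, hf]
  have h2 : ∑ k ∈ Finset.range R, ∫ ω', Y k ω' ∂μ ≤ R * p := by
    calc ∑ k ∈ Finset.range R, ∫ ω', Y k ω' ∂μ ≤ ∑ _k ∈ Finset.range R, p :=
          Finset.sum_le_sum fun k _ => hE k
      _ = R * p := by simp
  have h3 : (R : ℝ) ≤
      2 * ((Finset.range R).filter fun k => flip (t + 4 * k) i ω = true).card := by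
    exact_mod_cast hω
  rw [h1]
  linarith

theorem IsNoise.unreliable_le {Ω : Type*} [MeasurableSpace Ω] {μ : Measure Ω}
    [IsProbabilityMeasure μ] {p : ℝ} {flip : ℕ → ℕ → Ω → Bool} (h : IsNoise μ p flip)
    (hp0 : 0 ≤ p) (hp : p < 1 / 2) {m : ℕ} (P : Fin m → ℝ × ℝ) (B N R T : ℕ) (hR : 0 < R) :
    μ {ω | ¬ Machine.Reliable ⟨P, fun t i => flip t i ω, B, N, R, T⟩} ≤
      ENNReal.ofReal ((T + 1) * N * Real.exp (-(2 * R * (1 / 2 - p) ^ 2))) := by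
  have hsub : {ω | ¬ Machine.Reliable ⟨P, fun t i => flip t i ω, B, N, R, T⟩} ⊆
      ⋃ x ∈ Finset.range (T + 1) ×ˢ Finset.range N,
        {ω | R ≤ 2 * ((Finset.range R).filter fun k => flip (x.1 + 4 * k) x.2 ω = true).card} := by
    intro ω hω
    simp only [Machine.Reliable, Set.mem_ofPred_eq] at hω
    push Not at hω
    obtain ⟨t, ht, i, hi, hle⟩ := hω
    simp only [Set.mem_iUnion, Finset.mem_product, Finset.mem_range]
    exact ⟨(t, i), ⟨by simpa using Nat.lt_succ_of_le ht, hi⟩, hle⟩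
  refine (measure_mono hsub).trans ((measure_biUnion_finset_le _ _).trans ?_)
  refine (Finset.sum_le_sum fun x _ => h.majority_error hp0 hp R x.1 x.2 hR).trans ?_
  rw [Finset.sum_const, Finset.card_product, Finset.card_range, Finset.card_range, nsmul_eq_mul,
    ENNReal.ofReal_mul (by positivity)]
  refine mul_le_mul_left ?_ _
  rw [← ENNReal.ofReal_natCast]
  refine ENNReal.ofReal_le_ofReal ?_
  push_cast
  exact le_rfl

/-! ### Estimates -/

theorem pow_clog_le {m : ℕ} (hm : 2 ≤ m) : 16 ^ Nat.clog 16 m ≤ 16 * m := by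
  have h1 : 0 < Nat.clog 16 m := Nat.clog_pos (by norm_num) hm
  have h2 := Nat.pow_pred_clog_lt_self (b := 16) (by norm_num) (show 1 < m by omega)
  obtain ⟨k, hk⟩ := Nat.exists_eq_succ_of_ne_zero h1.ne'
  rw [hk] at h2 ⊢
  simp only [Nat.pred_succ, Nat.succ_eq_add_one, pow_succ] at h2 ⊢
  omega

/-- From `16 ^ a ≤ 16 * m` follows `4 a log 2 ≤ 4 log 2 + log m ≤ 5 log m`, and `5 < 2 * (4 *
0.69)`. -/
theorem clog_le_log {m : ℕ} (hm : 2 ≤ m) : (Nat.clog 16 m : ℝ) ≤ Real.log ((m : ℝ) ^ 2) := by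
  have hm0 : (2 : ℝ) ≤ m := by exact_mod_cast hm
  have h1 : ((16 : ℝ)) ^ Nat.clog 16 m ≤ 16 * m := by exact_mod_cast pow_clog_le hm
  have h2 := Real.log_le_log (by positivity) h1
  have h16 : Real.log 16 = 4 * Real.log 2 := by
    rw [show (16 : ℝ) = 2 ^ 4 by norm_num, Real.log_pow]
    norm_num
  rw [Real.log_pow, Real.log_mul (by norm_num) (by positivity), h16] at h2
  have h3 : Real.log 2 ≤ Real.log m := Real.log_le_log (by norm_num) hm0
  have h4 := Real.log_two_gt_d9
  rw [Real.log_pow]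
  have h5 : (Nat.clog 16 m : ℝ) * (4 * 0.69) ≤ Nat.clog 16 m * (4 * Real.log 2) :=
    mul_le_mul_of_nonneg_left (by linarith) (Nat.cast_nonneg _)
  push_cast
  linarith

theorem log_le_clog {m : ℕ} (hm : 2 ≤ m) : Real.log m ≤ 3 * Nat.clog 16 m := by
  have h1 : (m : ℝ) ≤ (16 : ℝ) ^ Nat.clog 16 m := by
    exact_mod_cast Nat.le_pow_clog (b := 16) (by norm_num) m
  have h2 := Real.log_le_log (by positivity) h1
  have h16 : Real.log 16 = 4 * Real.log 2 := by
    rw [show (16 : ℝ) = 2 ^ 4 by norm_num, Real.log_pow]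
    norm_num
  rw [Real.log_pow, h16] at h2
  have h4 := Real.log_two_lt_d9
  have h5 : (Nat.clog 16 m : ℝ) * (4 * Real.log 2) ≤ Nat.clog 16 m * 3 :=
    mul_le_mul_of_nonneg_left (by linarith) (Nat.cast_nonneg _)
  linarith

/-- With `x = R δ²` the exponent is `-2x`. One `x` pays for the number of steps, since `U * R + 1 ≤
1301 * R = y * x ≤ y * exp x` for `y = 1301 / δ²`. The other pays for `y ≤ exp y`, for the
processors, `N ≤ m ^ 6`, and for the claimed `m ^ (-2c)`. This needs `x ≥ y + (6 + 2c) log m`, which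
the choice of `K` gives because `log m ≤ 3a` and `a ≥ 1`. -/
theorem failure_probability_le {δ c : ℝ} (hδ : 0 < δ) (hc : 0 ≤ c) {m K N U : ℕ} (hm : 2 ≤ m)
    (hN : N ≤ 16 * m ^ 2) (hU : U ≤ 1300) (hK0 : 0 < K)
    (hK : 1301 / δ ^ 2 + 3 * (6 + 2 * c) ≤ K * δ ^ 2) :
    (((U * (K * Nat.clog 16 m) : ℕ) : ℝ) + 1) * N *
      Real.exp (-(2 * ((K * Nat.clog 16 m : ℕ) : ℝ) * δ ^ 2)) ≤ ((m : ℝ) ^ 2) ^ (-c) := by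
  have hm0 : (2 : ℝ) ≤ m := by exact_mod_cast hm
  have ha : 1 ≤ Nat.clog 16 m := Nat.clog_pos (by norm_num) hm
  have ha' : (1 : ℝ) ≤ Nat.clog 16 m := by exact_mod_cast ha
  set a := Nat.clog 16 m with hadef
  have hR1 : (1 : ℝ) ≤ ((K * a : ℕ) : ℝ) := by exact_mod_cast Nat.mul_pos hK0 ha
  set R : ℝ := ((K * a : ℕ) : ℝ) with hR
  have hd2 : 0 < δ ^ 2 := by positivity
  set x := R * δ ^ 2 with hx
  set y := 1301 / δ ^ 2 with hy
  have hy0 : 0 < y := by positivity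
  have h1 : ((U * (K * a) : ℕ) : ℝ) + 1 ≤ y * Real.exp x := by
    have hU' : (U : ℝ) ≤ 1300 := by exact_mod_cast hU
    have h2 : x ≤ Real.exp x := by linarith [Real.add_one_le_exp x]
    have h3 : ((U * (K * a) : ℕ) : ℝ) = U * R := by rw [hR]; push_cast; ring
    rw [h3]
    calc U * R + 1 ≤ 1301 * R := by nlinarith
      _ = y * x := by rw [hy, hx]; field_simp
      _ ≤ y * Real.exp x := mul_le_mul_of_nonneg_left h2 hy0.le
  have h2 : y + (6 + 2 * c) * Real.log m ≤ x := by
    have h3 : x = a * (K * δ ^ 2) := by rw [hx, hR]; push_cast; ring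
    have h4 := log_le_clog hm
    rw [← hadef] at h4
    rw [h3]
    have h5 : (a : ℝ) * (y + 3 * (6 + 2 * c)) ≤ a * (K * δ ^ 2) :=
      mul_le_mul_of_nonneg_left hK (by linarith)
    have h6 : (6 + 2 * c) * Real.log m ≤ (6 + 2 * c) * (3 * a) :=
      mul_le_mul_of_nonneg_left h4 (by linarith)
    have h7 : 1 * y ≤ a * y := mul_le_mul_of_nonneg_right ha' hy0.le
    linarith
  have h3 : (N : ℝ) ≤ Real.exp (6 * Real.log m) := by
    have h4 : Real.exp (6 * Real.log m) = (m : ℝ) ^ 6 := by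
      rw [mul_comm, Real.exp_mul, Real.exp_log (by linarith)]
      norm_cast
    rw [h4]
    calc (N : ℝ) ≤ 16 * (m : ℝ) ^ 2 := by exact_mod_cast hN
      _ ≤ (m : ℝ) ^ 4 * (m : ℝ) ^ 2 := by
          refine mul_le_mul_of_nonneg_right ?_ (by positivity)
          calc (16 : ℝ) = 2 ^ 4 := by norm_num
            _ ≤ (m : ℝ) ^ 4 := pow_le_pow_left₀ (by norm_num) hm0 4
      _ = (m : ℝ) ^ 6 := by ring
  have h4 : y ≤ Real.exp y := by linarith [Real.add_one_le_exp y]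
  have h5 : ((m : ℝ) ^ 2) ^ (-c) = Real.exp (-(2 * c * Real.log m)) := by
    rw [Real.rpow_def_of_pos (by positivity), Real.log_pow]
    congr 1
    push_cast
    ring
  rw [h5]
  calc (((U * (K * a) : ℕ) : ℝ) + 1) * N * Real.exp (-(2 * R * δ ^ 2))
      ≤ (Real.exp y * Real.exp x) * Real.exp (6 * Real.log m) * Real.exp (-(2 * R * δ ^ 2)) := by
        refine mul_le_mul_of_nonneg_right ?_ (Real.exp_pos _).le
        refine mul_le_mul (h1.trans (mul_le_mul_of_nonneg_right h4 (Real.exp_pos _).le)) h3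
          (Nat.cast_nonneg _) (by positivity)
    _ = Real.exp (y + x + 6 * Real.log m + -(2 * R * δ ^ 2)) := by
        rw [Real.exp_add, Real.exp_add, Real.exp_add]
    _ ≤ Real.exp (-(2 * c * Real.log m)) := by
        refine Real.exp_le_exp.2 ?_
        have : 2 * R * δ ^ 2 = 2 * x := by rw [hx]; ring
        rw [this]
        linarith

theorem sq_two_pow_le {m : ℕ} (hm : 2 ≤ m) :
    ((2 ^ Nat.clog 16 m * 2 ^ Nat.clog 16 m : ℕ) : ℝ) ≤ 4 * √m := by
  have h1 : (((2 ^ Nat.clog 16 m * 2 ^ Nat.clog 16 m : ℕ) : ℝ)) ^ 2 ≤ 16 * m := by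
    have h2 : (2 ^ Nat.clog 16 m * 2 ^ Nat.clog 16 m) ^ 2 = 16 ^ Nat.clog 16 m := by
      rw [← mul_pow, ← pow_mul, mul_comm (Nat.clog 16 m) 2, pow_mul]
      norm_num
    have h3 := pow_clog_le hm
    rw [← h2] at h3
    exact_mod_cast h3
  refine abs_le_of_sq_le_sq' ?_ (by positivity) |>.2
  rw [mul_pow, Real.sq_sqrt (Nat.cast_nonneg _)]
  linarith

/-- As `m ≥ 2`, the factor `m ^ 8` absorbs the numerical constants and `m ^ K` absorbs `K`. The
exponent depends on `K` only, so words have `O(log m)` bits. -/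
theorem word_bounds {m : ℕ} (hm : 2 ≤ m) (K : ℕ) :
    K * Nat.clog 16 m + 1 < m ^ (K + 10) ∧ 8 * (m * (2 ^ Nat.clog 16 m) ^ 4) < m ^ (K + 10) ∧
      8 * m < m ^ (K + 10) ∧ 2 * 2 ^ Nat.clog 16 m < m ^ (K + 10) := by
  set a := Nat.clog 16 m with ha
  have h16 : (2 ^ a) ^ 4 ≤ 16 * m := by
    rw [← pow_mul, mul_comm, pow_mul]
    exact pow_clog_le hm
  have hqq : 2 ^ a ≤ (2 ^ a) ^ 4 := Nat.le_self_pow (by norm_num) _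
  have ha2 : a < 2 ^ a := Nat.lt_two_pow_self
  have hK : K < m ^ K := Nat.lt_pow_self (by omega)
  have h2 : ∀ j, 2 ^ j ≤ m ^ j := fun j => Nat.pow_le_pow_left hm j
  have h8 := h2 8
  have hm2 : 256 * (m * m) ≤ m ^ 10 := by
    calc 256 * (m * m) ≤ m ^ 8 * (m * m) := Nat.mul_le_mul_right _ (by simpa using h8)
      _ = m ^ 10 := by ring
  have hmm : m ≤ m * m := Nat.le_mul_of_pos_left _ (by omega)
  have hle : m ^ 10 ≤ m ^ (K + 10) := Nat.pow_le_pow_right (by omega) (by omega)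
  have h5 : 8 * (m * (2 ^ a) ^ 4) ≤ 8 * (m * (16 * m)) :=
    Nat.mul_le_mul_left _ (Nat.mul_le_mul_left _ h16)
  have h6 : 8 * (m * (16 * m)) = 128 * (m * m) := by ring
  refine ⟨?_, by omega, by omega, by omega⟩
  calc K * a + 1 ≤ m ^ K * a + m ^ K := by
        have := Nat.mul_le_mul_right a hK.le
        omega
    _ = m ^ K * (a + 1) := by ring
    _ < m ^ K * m ^ 10 := Nat.mul_lt_mul_of_pos_left (by omega) (by positivity)
    _ = m ^ (K + 10) := by ring

end

end NoisyHull

/-! ### The choice of the constants and the two guarantees. -/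

theorem mainTheorem5 (p : ℝ) (hp0 : 0 ≤ p) (hp : p < 1 / 2) (c : ℝ) (hc : 1 ≤ c) :
    ∃ (sweep brute : NoisyHull.Cmd) (κ : ℕ) (C : ℝ),
      ∀ (m : ℕ), 2 ≤ m →
      ∀ (P : Fin m → ℝ × ℝ), StrictMono (fun i => (P i).1) →
      ∀ (Ω : Type*) [MeasurableSpace Ω] (μ : MeasureTheory.Measure Ω)
        [MeasureTheory.IsProbabilityMeasure μ] (flip : ℕ → ℕ → Ω → Bool),
        NoisyHull.IsNoise μ p flip →
        (∀ H : Finset (Fin m),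
          μ {ω | ¬ NoisyHull.Succeeds P (fun t i => flip t i ω) (m ^ κ) sweep
              (NoisyHull.inputMem H)
              (C * Real.log ((m : ℝ) ^ 2))
              (C * ((m : ℝ) * Real.log ((m : ℝ) ^ 2)))
              (C * (m : ℝ))
              (fun mem => (mem 3 0 = 1 ∧ H = NoisyHull.upperHull P) ∨
                (mem 3 0 = 0 ∧ H ≠ NoisyHull.upperHull P))}
            ≤ ENNReal.ofReal (((m : ℝ) ^ 2) ^ (-c))) ∧
        μ {ω | ¬ NoisyHull.Succeeds P (fun t i => flip t i ω) (m ^ κ) brute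
            (NoisyHull.inputMem (∅ : Finset (Fin m)))
            (C * Real.log ((m : ℝ) ^ 2))
            (C * ((m : ℝ) ^ (3 / 2 : ℝ) * Real.log ((m : ℝ) ^ 2)))
            (C * (m : ℝ))
            (NoisyHull.StoresHull (NoisyHull.upperHull P))}
          ≤ ENNReal.ofReal (((m : ℝ) ^ 2) ^ (-c)) := by
  open NoisyHull in
  set δ : ℝ := 1 / 2 - p with hδ
  have hδ0 : 0 < δ := by linarith
  obtain ⟨K, hK⟩ := exists_nat_ge ((1301 / δ ^ 2 + 3 * (6 + 2 * c)) / δ ^ 2)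
  have hd2 : 0 < δ ^ 2 := by positivity
  have hK' : 1301 / δ ^ 2 + 3 * (6 + 2 * c) ≤ K * δ ^ 2 := (div_le_iff₀ hd2).1 hK
  have hK0 : 0 < K := by
    have h1 : 0 < (1301 / δ ^ 2 + 3 * (6 + 2 * c)) / δ ^ 2 := by positivity
    exact_mod_cast h1.trans_le hK
  have hK1 : (1 : ℝ) ≤ K := by exact_mod_cast hK0
  -- The work of the brute-force program is the most demanding: `1300` units, times the `4` from `q
  -- ^ 2 ≤ 4 √m`, times `R ≤ K log (m ^ 2)`.
  refine ⟨failureSweep K, bruteForce K, K + 10, 5200 * K, ?_⟩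
  intro m hm P hP Ω _ μ _ flip hflip
  have ha : 1 ≤ Nat.clog 16 m := Nat.clog_pos (by norm_num) hm
  have hm0 : (2 : ℝ) ≤ m := by exact_mod_cast hm
  obtain ⟨w1, w2, w3, w4⟩ := word_bounds hm K
  have hlog := clog_le_log hm
  have h16 := pow_clog_le hm
  have hq4 : (2 ^ Nat.clog 16 m) ^ 4 = 16 ^ Nat.clog 16 m := by
    rw [← pow_mul, mul_comm, pow_mul]
    norm_num
  have hq2 := sq_two_pow_le hm
  set a := Nat.clog 16 m with hadef
  have haR : a ≤ K * a := Nat.le_mul_of_pos_left _ hK0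
  have hR0 : 0 < K * a := Nat.mul_pos hK0 ha
  have hlog0 : 0 ≤ Real.log ((m : ℝ) ^ 2) := le_trans (Nat.cast_nonneg _) hlog
  have hRl : ((K * a : ℕ) : ℝ) ≤ K * Real.log ((m : ℝ) ^ 2) := by
    push_cast
    exact mul_le_mul_of_nonneg_left hlog (by linarith)
  have hKl : 0 ≤ (K : ℝ) * Real.log ((m : ℝ) ^ 2) := mul_nonneg (by linarith) hlog0
  have hKm : (m : ℝ) ≤ 5200 * K * m := by nlinarith
  refine ⟨fun H => ?_, ?_⟩
  · refine le_trans (measure_mono ?_) ((hflip.unreliable_le hp0 hp P (m ^ (K + 10)) (2 * m) (K * a)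
      (200 * (K * a)) hR0).trans (ENNReal.ofReal_le_ofReal
        (failure_probability_le hδ0 (by linarith) hm ?_ (by norm_num) hK0 hK')))
    · intro ω hω
      simp only [Set.mem_ofPred_eq] at hω ⊢
      intro hrel
      refine hω ?_
      obtain ⟨s, s1, s2, s3, s4, s5, s6⟩ := exec_failureSweep (K := K) (a := a)
        (X := ⟨P, fun t i => flip t i ω, m ^ (K + 10), 2 * m, K * a, 200 * (K * a)⟩)
        ⟨hm, hadef, rfl, rfl, haR, hR0, w1, w3, w4, rfl, hrel⟩ hP H
      refine ⟨s, s1, ?_, ?_, ?_, s5, s6⟩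
      · have : (s.span : ℝ) ≤ 200 * ((K * a : ℕ) : ℝ) := by exact_mod_cast s2
        linarith
      · have h1 : (s.work : ℝ) ≤ 200 * (2 * m * ((K * a : ℕ) : ℝ)) := by exact_mod_cast s3
        have h2 : (m : ℝ) * ((K * a : ℕ) : ℝ) ≤ m * (K * Real.log ((m : ℝ) ^ 2)) :=
          mul_le_mul_of_nonneg_left hRl (by linarith)
        have h3 : 0 ≤ (m : ℝ) * (K * Real.log ((m : ℝ) ^ 2)) := mul_nonneg (by linarith) hKl
        linarith
      · rw [s4]
        exact hKm
    · nlinarith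
  · refine le_trans (measure_mono ?_) ((hflip.unreliable_le hp0 hp P (m ^ (K + 10))
      (m * 2 ^ a * 2 ^ a) (K * a) (1300 * (K * a)) hR0).trans (ENNReal.ofReal_le_ofReal
        (failure_probability_le hδ0 (by linarith) hm ?_ le_rfl hK0 hK')))
    · intro ω hω
      simp only [Set.mem_ofPred_eq] at hω ⊢
      intro hrel
      refine hω ?_
      obtain ⟨s, s1, s2, s3, s4, s5, s6⟩ := exec_bruteForce (K := K) (q := 2 ^ a) (a := a)
        (X := ⟨P, fun t i => flip t i ω, m ^ (K + 10), m * 2 ^ a * 2 ^ a, K * a,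
          1300 * (K * a)⟩)
        ⟨hm, rfl, Nat.le_self_pow (by omega) 2, by
          rw [hq4]; exact Nat.le_pow_clog (by norm_num) m, rfl, rfl, haR, hR0, w1, w2, hrel,
          pt_sortedTo hP⟩ hadef hP rfl
      refine ⟨s, s1, ?_, ?_, ?_, s5, s6⟩
      · have : (s.span : ℝ) ≤ 1300 * ((K * a : ℕ) : ℝ) := by exact_mod_cast s2
        linarith
      · have h1 : (s.work : ℝ) ≤
            1300 * (m * ((2 ^ a * 2 ^ a : ℕ) : ℝ) * ((K * a : ℕ) : ℝ)) := by
          have h0 : s.work ≤ 1300 * (m * (2 ^ a * 2 ^ a) * (K * a)) := by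
            rw [← mul_assoc m]
            exact s3
          exact_mod_cast h0
        have h2 : (m : ℝ) ^ (3 / 2 : ℝ) = m * √m := by
          rw [show (3 / 2 : ℝ) = 1 + 1 / 2 by norm_num, Real.rpow_add (by linarith),
            Real.rpow_one, ← Real.sqrt_eq_rpow]
        have h3 : (m : ℝ) * ((2 ^ a * 2 ^ a : ℕ) : ℝ) ≤ m * (4 * √m) :=
          mul_le_mul_of_nonneg_left hq2 (by linarith)
        have h4 : (m : ℝ) * ((2 ^ a * 2 ^ a : ℕ) : ℝ) * ((K * a : ℕ) : ℝ) ≤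
            m * (4 * √m) * (K * Real.log ((m : ℝ) ^ 2)) :=
          mul_le_mul h3 hRl (Nat.cast_nonneg _) (by positivity)
        rw [h2]
        linarith
      · rw [s4]
        exact hKm
    · have h1 : 2 ^ a * 2 ^ a ≤ (2 ^ a) ^ 4 := by
        calc 2 ^ a * 2 ^ a = (2 ^ a) ^ 2 := by ring
          _ ≤ (2 ^ a) ^ 4 := Nat.pow_le_pow_right (by positivity) (by norm_num)
      calc m * 2 ^ a * 2 ^ a = m * (2 ^ a * 2 ^ a) := by ring
        _ ≤ m * (16 * m) := Nat.mul_le_mul_left _ (by omega)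
        _ = 16 * m ^ 2 := by ring
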